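/- **Setting.** Let $D>0$, and let $\mathbf s,\mathbf t\subset\mathbb R^3$ be closed cubes of side $D$, parallel to the axes, with centres $S$ and $T$, where $\mathbf s\subset\{x_3\ge 0\}$ (image sources) and $\mathbf t\subset\{x_3\le 0\}$ (targets). Let $R>0$ and $\theta_1\in(0,\pi/2)$ satisfy $$\tfrac{\sqrt3}{2}D\le R,\qquad R+\tfrac{\sqrt3}{2}D<|S-T|,\qquad \tfrac{D}{\sqrt2}<\bigl(|S-T|-\tfrac{\sqrt3}{2}D\bigr)\sin\theta_1 .$$ (The sphere of radius $R$ about $S$ encloses $\mathbf s$ and is disjoint from the ball circumscribed about $\mathbf t$. The third condition holds in particular if $R\sin\theta_1\ge D/\sqrt2$.) Let $\mathcal B(R_1,R_2,R_3)=R_3\log(\varrho+R_3)-\varrho$ with $\varrho=\sqrt{R_1^2+R_2^2+R_3^2}$, and for a target $x$ and an image source $y$ put $\mathcal B(x;y)=\mathcal B(x_1-y_1,\,x_2-y_2,\,y_3-x_3)$. For force vectors $F^1,\dots,F^N\in\mathbb R^3$ ($N\ge1$) at image sources $Q_1,\dots,Q_N\in\mathbf s$ let $$\Phi_{\mathcal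 B}(x)=\sum_{i=1}^N F^i\cdot\nabla_y\mathcal B(x;y)\big|_{y=Q_i}.$$ Let $Y_n^m(\theta,\phi)=\sqrt{\tfrac{2n+1}{4\pi}}\sqrt{\tfrac{(n-|m|)!}{(n+|m|)!}}\,P_n^{|m|}(\cos\theta)e^{im\phi}$, with $P_n^m(t)=(-1)^m(1-t^2)^{m/2}\frac{d^m}{dt^m}P_n(t)$, and let $$M_n^m=\frac{4\pi}{2n+1}\sum_{i=1}^N F^i\cdot\nabla\bigl(r^nY_n^{-m}(\theta,\phi)\bigr)\big|_{Q_i},$$ with $(r,\theta,\phi)$ spherical coordinates about $S$. These are the coefficients of the multipole expansion $\partial_{x_3}^2\Phi_{\mathcal B}=\sum_{n,m}M_n^mY_n^m/r^{n+1}$. The *coefficients of order $p$* are those with $n\le p$, $|m|\le n$. **The split.** Place charge densities $\sigma_j(\phi)=\sum_{|m|\le p}\sigma_j^{(m)}e^{im\phi}$ (per unit arc length), $j=1,2$, on the two circles of latitude $\theta_1$ and $\pi-\theta_1$ of the sphere of radius $R$ about $S$. Let $\Psi$ be the integral of $\mathcal B(x;y)$ against this charge, and let $P_n^m$ be $\frac{4\pi}{2n+1}$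 times the integral of $r^nY_n^{-m}$ against it. The densities are chosen so that, for every $|m|\le p$, the coefficients $M_n^m-P_n^m$ with $n=|m|$ and $n=|m|+1$ vanish, where $M_n^m$ is replaced by $0$ if $n>p$. Write $\Phi_{\mathcal B}=(\Phi_{\mathcal B}-\Psi)+\Psi$. **Cost.** An operation is one instruction of a straight-line program over $\mathbb C$: an addition, subtraction or multiplication, or the loading of a constant. **Lemma.** There is an absolute constant $K$ such that in every setting as above there are $C$ and $\rho\in(0,1)$, depending only on $D,S,T,R,\theta_1$, with the following property. For every $p\ge1$ there is a straight-line program $A$ with at most $Kp^3$ operations, and for every $N\ge1$ a straight-line program $A_0$ with at most $KNp^2$ operations, such that for all force vectors $F^i\in\mathbb R^3$ and image sources $Q_i\in\mathbf s$ ($1\le i\le N$): 1. $A_0$ computes the multipole coefficients $M_n^m$ of order $p$ from the coordinates of the $F^i$ and $Q_i$. 2. Densities as required exist; and for all such densities, $A$ computes from the coefficients $M_n^m$ of order $p$ alone three families of numbers $L_n^{m,\mathrm{diff}}$, $L_n^{m,\mathrm{ring}}$ and $L_n^m=L_n^{m,\mathrm{diff}}+L_n^{m,\mathrm{ring}}$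 ($n\le p$, $|m|\le n$), which are the coefficients of local expansions in $\mathbf t$ of $\Phi_{\mathcal B}-\Psi$, of $\Psi$ and of $\Phi_{\mathcal B}$, respectively: for all $x\in\mathbf t$, with spherical coordinates $(r,\theta,\phi)$ about $T$, $$\Bigl|\Phi_{\mathcal B}(x)-\sum_{n=0}^p\sum_{m=-n}^nL_n^m\,Y_n^m(\theta,\phi)\,r^n\Bigr|\le C\,\rho^{\,p}\sum_{i=1}^N|F^i| ,$$ and the same bound holds for $\Phi_{\mathcal B}-\Psi$ with $L_n^{m,\mathrm{diff}}$ and for $\Psi$ with $L_n^{m,\mathrm{ring}}$. In particular, for a fixed number of sources, a local expansion of order $p$ of $\Phi_{\mathcal B}$ is computed in $O(p^3)$ operations; and it is computed from the multipole coefficients of order $p$ in $O(p^3)$ operations, uniformly in the number of sources. The programs may depend on $p$ and on $D,S,T,R,\theta_1$, and $A_0$ also on $N$, but not on the $F^i$ and $Q_i$; and $A$ does not depend on $N$. -/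

import Mathlib

open scoped BigOperators

noncomputable section

namespace HalfSpace

/-- Euclidean three-space; the coordinates `x₁, x₂, x₃` are `x 0, x 1, x 2`, and the third axis
points up. -/
abbrev Space : Type := EuclideanSpace ℝ (Fin 3)

/-- The closed cube with centre `c` and side length `D`. -/
def box (c : Space) (D : ℝ) : Set Space := {x | ∀ i, |x i - c i| ≤ D / 2}

/-! ### Sources of `𝓑`-type -/

/-- `(R₁, R₂, R₃)` for the target `x` and the image source `y = (ξ₁, ξ₂, -ξ₃)`: the vector from
`y` to `x` with the sign of the third component flipped. -/
def okada (x y : Space) : Space := !₂[x 0 - y 0, x 1 - y 1, y 2 - x 2]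

/-- The scalar potential `𝓑(R₁, R₂, R₃) = R₃ log (R + R₃) - R`, where `R = √(R₁² + R₂² + R₃²)`. -/
def potB (v : Space) : ℝ := v 2 * Real.log (‖v‖ + v 2) - ‖v‖

/-- `Φ_𝓑(x) = ∑ᵢ Fⁱ · ∇_y 𝓑(R₁, R₂, R₃)`, the gradient being taken with respect to the position `y`
of the image source, at `y = Qᵢ`. -/
def PhiB {N : ℕ} (F Q : Fin N → Space) (x : Space) : ℝ :=
  ∑ i, fderiv ℝ (fun y : Space => potB (okada x y)) (Q i) (F i)

/-! ### Spherical harmonics -/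

/-- The Legendre polynomial of degree `n` (Rodrigues' formula). -/
def legendre (n : ℕ) : Polynomial ℝ :=
  Polynomial.C (1 / (2 ^ n * (n.factorial : ℝ))) *
    Polynomial.derivative^[n] ((Polynomial.X ^ 2 - 1) ^ n)

/-- The associated Legendre function `P_n^m(t) = (-1)^m (1 - t²)^(m/2) (d/dt)^m P_n(t)`. -/
def assocLegendre (n m : ℕ) (t : ℝ) : ℝ :=
  (-1) ^ m * Real.sqrt (1 - t ^ 2) ^ m * (Polynomial.derivative^[m] (legendre n)).eval t

/-- The spherical harmonic `Y_n^m(θ, φ)` of degree `n` and order `m`, for `|m| ≤ n`. -/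
def sphericalY (n : ℕ) (m : ℤ) (θ φ : ℝ) : ℂ :=
  ((Real.sqrt ((2 * n + 1) / (4 * Real.pi)) *
      Real.sqrt (((n - m.natAbs).factorial : ℝ) / ((n + m.natAbs).factorial : ℝ)) *
      assocLegendre n m.natAbs (Real.cos θ) : ℝ) : ℂ) * Complex.exp (Complex.I * m * φ)

/-- The polar angle `θ ∈ [0, π]` of a vector, measured from the third axis. -/
def polar (v : Space) : ℝ := Real.arccos (v 2 / ‖v‖)

/-- The azimuthal angle `φ` of a vector. -/
def azimuth (v : Space) : ℝ := Complex.arg ⟨v 0, v 1⟩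

/-- The function `v ↦ r^n Y_n^m(θ, φ)`, where `(r, θ, φ)` are the spherical coordinates of `v`. -/
def solidY (n : ℕ) (m : ℤ) (v : Space) : ℂ :=
  ((‖v‖ ^ n : ℝ) : ℂ) * sphericalY n m (polar v) (azimuth v)

/-- The pairs `(n, m)` with `0 ≤ n ≤ p` and `-n ≤ m ≤ n`: the index set of an expansion of
order `p`. -/
def modes (p : ℕ) : Finset (ℕ × ℤ) :=
  (Finset.range (p + 1) ×ˢ Finset.Icc (-(p : ℤ)) (p : ℤ)).filter (fun k => |k.2| ≤ (k.1 : ℤ))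

/-- The value at `x` of the local expansion `∑_{n ≤ p} ∑_{|m| ≤ n} L_n^m Y_n^m(θ, φ) r^n`, where
`(r, θ, φ)` are the spherical coordinates of `x` with respect to `c`. -/
def localExpansion {p : ℕ} (c : Space) (L : modes p → ℂ) (x : Space) : ℂ :=
  ∑ k, L k * solidY k.1.1 k.1.2 (x - c)

/-! ### Multipole coefficients and rings of charge -/

/-- The multipole coefficient `M_n^m` about `S` of dipoles with vectors `Fⁱ` at the points `Qᵢ`: away
from the sources, `∑ᵢ Fⁱ · ∇_y (1 / |x - y|)` at `y = Qᵢ` is the sum over all `n` and `|m| ≤ n` of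
`M_n^m Y_n^m(θ, φ) / r^(n+1)`, with spherical coordinates about `S`. This field is the
second derivative of `PhiB F Q` with respect to `x₃`. -/
def multipoleCoeff {N : ℕ} (S : Space) (F Q : Fin N → Space) (n : ℕ) (m : ℤ) : ℂ :=
  ((4 * Real.pi / (2 * n + 1) : ℝ) : ℂ) * ∑ i, fderiv ℝ (solidY n (-m)) (Q i - S) (F i)

/-- The point with longitude `φ` on the circle of latitude `θ` of the sphere of radius `R`
about `S`. -/
def ringPoint (S : Space) (R θ φ : ℝ) : Space :=
  S + R • !₂[Real.sin θ * Real.cos φ, Real.sin θ * Real.sin φ, Real.cos θ]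

/-- The density `σ(φ) = ∑_{|m| ≤ p} σ^(m) e^(imφ)`. -/
def ringDensity (p : ℕ) (s : ℤ → ℂ) (φ : ℝ) : ℂ :=
  ∑ m ∈ Finset.Icc (-(p : ℤ)) (p : ℤ), s m * Complex.exp (Complex.I * m * φ)

/-- The integral of `g` over one ring against the charge density `σ` (arc length `R sin θ dφ`). -/
def ringIntegral (S : Space) (R θ : ℝ) (p : ℕ) (s : ℤ → ℂ) (g : Space → ℂ) : ℂ :=
  ∫ φ in (0 : ℝ)..(2 * Real.pi),
    g (ringPoint S R θ φ) * ringDensity p s φ * ((R * Real.sin θ : ℝ) : ℂ)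

/-- The field `Ψ` of two rings of `𝓑`-type charge, at the latitudes `θ₁` and `π - θ₁` of the sphere
of radius `R` about `S`, with densities `σ₁` and `σ₂`. -/
def ringField (S : Space) (R θ₁ : ℝ) (p : ℕ) (s₁ s₂ : ℤ → ℂ) (x : Space) : ℂ :=
  ringIntegral S R θ₁ p s₁ (fun y => (potB (okada x y) : ℂ)) +
    ringIntegral S R (Real.pi - θ₁) p s₂ (fun y => (potB (okada x y) : ℂ))

/-- The multipole coefficient `P_n^m` about `S` of the two rings of charge: outside the sphere, their
Coulomb field, the integral of `1 / |x - y|` against the charge, is the sum of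
`P_n^m Y_n^m(θ, φ) / r^(n+1)`. -/
def ringCoeff (S : Space) (R θ₁ : ℝ) (p : ℕ) (s₁ s₂ : ℤ → ℂ) (n : ℕ) (m : ℤ) : ℂ :=
  ((4 * Real.pi / (2 * n + 1) : ℝ) : ℂ) *
    (ringIntegral S R θ₁ p s₁ (fun y => solidY n (-m) (y - S)) +
      ringIntegral S R (Real.pi - θ₁) p s₂ (fun y => solidY n (-m) (y - S)))

/-- The two rings carry the densities of the split `Φ_𝓑 = (Φ_𝓑 - Ψ) + Ψ` for the multipole
coefficients `M` of order `p`: for every `|m| ≤ p`, the coefficients `M_n^m - P_n^m` with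
`n - |m| ≤ 1` vanish. These are two linear equations, `n = |m|` and `n = |m| + 1`, for the two
unknowns `σ₁^(m), σ₂^(m)`. Coefficients with `n > p`, which an expansion of order `p` does not
contain, are read as `0`. -/
def RingsCancel (S : Space) (R θ₁ : ℝ) (p : ℕ) (M : ℕ → ℤ → ℂ) (s₁ s₂ : ℤ → ℂ) : Prop :=
  ∀ m : ℤ, |m| ≤ (p : ℤ) → ∀ n : ℕ, (n = m.natAbs ∨ n = m.natAbs + 1) →
    ringCoeff S R θ₁ p s₁ s₂ n m = if n ≤ p then M n m else 0

end HalfSpace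

/-! ### Arithmetic operations -/

namespace StraightLine

/-- One instruction of a straight-line program over `ℂ` with inputs `ι`, after `t` instructions: load
a constant, or combine two numbers, each of which is an input or an earlier result. -/
inductive Instr (ι : Type) (t : ℕ) : Type
  | const (c : ℂ) : Instr ι t
  | add (a b : ι ⊕ Fin t) : Instr ι t
  | sub (a b : ι ⊕ Fin t) : Instr ι t
  | mul (a b : ι ⊕ Fin t) : Instr ι t

/-- The value of an instruction, for the inputs `x` and the earlier results `w`. -/
def Instr.value {ι : Type} {t : ℕ} (x : ι → ℂ) (w : Fin t → ℂ) : Instr ι t → ℂ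
  | .const c => c
  | .add a b => Sum.elim x w a + Sum.elim x w b
  | .sub a b => Sum.elim x w a - Sum.elim x w b
  | .mul a b => Sum.elim x w a * Sum.elim x w b

/-- Sequences of `t` instructions. -/
inductive Code (ι : Type) : ℕ → Type
  | nil : Code ι 0
  | step {t : ℕ} (P : Code ι t) (I : Instr ι t) : Code ι (t + 1)

/-- The results of all the instructions of a code on the inputs `x`. -/
def Code.results {ι : Type} (x : ι → ℂ) : {t : ℕ} → Code ι t → Fin t → ℂ
  | _, .nil => Fin.elim0
  | _, .step P I => Fin.snoc (α := fun _ => ℂ) (P.results x) (I.value x (P.results x))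

/-- A straight-line program over `ℂ` with inputs indexed by `ι` and outputs indexed by `κ`. Every
output is an input or the result of an instruction; `cost` is the number of instructions, so that
loading a constant costs as much as an arithmetic operation. -/
structure Program (ι κ : Type) : Type where
  cost : ℕ
  code : Code ι cost
  out : κ → ι ⊕ Fin cost

/-- The function that a program computes. -/
def Program.run {ι κ : Type} (A : Program ι κ) (x : ι → ℂ) (k : κ) : ℂ :=
  Sum.elim x (A.code.results x) (A.out k)

end StraightLine

namespace HalfSpace

/-- The source data as an input: the coordinates of the force vectors and of the image sources. -/
def sourceData {N : ℕ} (F Q : Fin N → Space) : (Fin N × Fin 3) ⊕ (Fin N × Fin 3) → ℂ :=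
  Sum.elim (fun j => ((F j.1 j.2 : ℝ) : ℂ)) (fun j => ((Q j.1 j.2 : ℝ) : ℂ))

/-- The three fields in the split `Φ_𝓑 = (Φ_𝓑 - Ψ) + Ψ`. -/
inductive Part : Type
  | difference
  | ring
  | total

end HalfSpace

end

/-! Solid harmonics as coefficients. Up to nonzero constants, `r^n Y_n^m` is a coefficient `harm n
j`, `j = n + m`, of the `n`th power of a quadratic polynomial in `X` whose coefficients are linear
in the vector and which, for each value of `X`, is the product with a null vector (`solidY_eq`). In
this form the addition theorem is the binomial theorem, and vertical differentiation is
multiplication by `X`: it lowers degree and index by one.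

Sharp bounds. The null form is homogeneous in a spinor `(s, t)` and bounded by `‖w‖` where `|s|² +
|t|² = 2`. Cauchy's estimate gives `‖harm n j w‖ ≤ ‖w‖^n / wt n j`, while the coefficients of the
Coulomb expansion about `b` are at most `wt N J / ‖b‖^(N+1)`. The weights cancel in products and are
submultiplicative, so if the moments of the sources grow like `q^n / wt n j`, then degrees `n` at
the sources and `k` at a target at distance at most `a` from `T` contribute, up to polynomial
factors, at most `(n+k choose n) (q/r)^n (a/r)^k` with `r = |S - T|`. Summing over `n + k = N` gives
`((q + a)/r)^N`, and truncation at degree `p` costs a geometrically small error as soon as `q + a <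
r` (`exists_truncation_bound`).

The kernel `𝓑`. Its second vertical derivative is the Coulomb potential, so `𝓑` is recovered by
integrating twice along an upward ray; this yields an expansion with the same radius and weights
(`hasSum_potB`). Conversely, all its coefficients except those with the two lowest and the two
highest indices of each degree are explicit multiples of Coulomb coefficients (`potBCoef_eq`).

Speed. Applied densely, the translation takes order `p⁴` operations. A Coulomb coefficient is a sum
over roots of unity of terms `s^J t^(2N-J)`, in which source and target orders separate
(`choose_mul_flipCoef`); the translation then factors into three stages of order `p³`. For `𝓑` this
is available only if the moments with `n - |m| ≤ 1` vanish, and the rings are there to achieve this.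
The field of the rings depends linearly on `2(2p + 1)` densities, so its local coefficients also
take order `p³` operations.

Size of the rings. The equations for `n = |m|` and `n = |m| + 1` decouple into one for the sum and
one for the difference of the two densities. Harmonics of these extremal orders involve high powers
of the horizontal distance only, which is at most `D/√2` for a source and equals `R sin θ₁` on a
ring. Hence the densities are of order `(D/(√2 R sin θ₁))^|m|`, up to a linear factor, and the ring
moments grow with `q = max(R, D/(√2 sin θ₁))`. The geometric hypotheses say precisely that `q +
√3D/2 < |S - T|`. -/

namespace StraightLine

/-- The functions of the inputs that are available after running a code. -/
def Code.avail {ι : Type} {t : ℕ} (P : Code ι t) : Set ((ι → ℂ) → ℂ) :=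
  {f | ∃ a : ι ⊕ Fin t, ∀ x, f x = Sum.elim x (P.results x) a}

/-- Any code after which the functions in `𝓕` are available can be continued by at most `n`
instructions so that the functions in `𝓖` become available. -/
def Cost {ι : Type} (n : ℕ) (𝓕 𝓖 : Set ((ι → ℂ) → ℂ)) : Prop :=
  ∀ (t : ℕ) (P : Code ι t), 𝓕 ⊆ P.avail →
    ∃ (t' : ℕ) (P' : Code ι t'), t' ≤ t + n ∧ P.avail ⊆ P'.avail ∧ 𝓖 ⊆ P'.avail

/-! ### Composition rules for the cost of straight-line computations -/

variable {ι : Type} {𝓕 𝓖 𝓗 : Set ((ι → ℂ) → ℂ)} {m n : ℕ}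

lemma Code.avail_subset_step {t : ℕ} (P : Code ι t) (I : Instr ι t) :
    P.avail ⊆ (P.step I).avail := by
  rintro f ⟨a, ha⟩
  rcases a with a | a
  · exact ⟨Sum.inl a, fun x => by simpa using ha x⟩
  · refine ⟨Sum.inr a.castSucc, fun x => ?_⟩
    rw [ha x]
    simp [Code.results]

lemma Code.value_mem_step {t : ℕ} (P : Code ι t) (I : Instr ι t) :
    (fun x => I.value x (P.results x)) ∈ (P.step I).avail :=
  ⟨Sum.inr (Fin.last t), fun x => by simp [Code.results]⟩

lemma Cost.of_subset (h : 𝓖 ⊆ 𝓕) : Cost n 𝓕 𝓖 :=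
  fun t P hP => ⟨t, P, by omega, le_rfl, h.trans hP⟩

lemma Cost.mono (h : Cost m 𝓕 𝓖) (hmn : m ≤ n) : Cost n 𝓕 𝓖 := fun t P hP => by
  obtain ⟨t', P', h1, h2⟩ := h t P hP
  exact ⟨t', P', by omega, h2⟩

lemma Cost.subset {𝓕' 𝓖' : Set ((ι → ℂ) → ℂ)} (h : Cost n 𝓕 𝓖) (h1 : 𝓕 ⊆ 𝓕') (h2 : 𝓖' ⊆ 𝓖) :
    Cost n 𝓕' 𝓖' := fun t P hP => by
  obtain ⟨t', P', h3, h4, h5⟩ := h t P (h1.trans hP)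
  exact ⟨t', P', h3, h4, h2.trans h5⟩

/-- Costs add because `Cost` quantifies over every starting code and a continuation keeps everything
available; shared intermediate results are therefore paid for once. -/
lemma Cost.trans (h : Cost m 𝓕 𝓖) (h' : Cost n (𝓕 ∪ 𝓖) 𝓗) : Cost (m + n) 𝓕 (𝓖 ∪ 𝓗) :=
  fun t P hP => by
    obtain ⟨t', P', h3, h4, h5⟩ := h t P hP
    obtain ⟨t'', P'', h6, h7, h8⟩ := h' t' P' (Set.union_subset (hP.trans h4) h5)
    exact ⟨t'', P'', by omega, h4.trans h7, Set.union_subset (h5.trans h7) h8⟩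

lemma Cost.comp (h : Cost m 𝓕 𝓖) (h' : Cost n 𝓖 𝓗) : Cost (m + n) 𝓕 𝓗 :=
  (h.trans (h'.subset Set.subset_union_right le_rfl)).subset le_rfl Set.subset_union_right

lemma cost_const (c : ℂ) : Cost (ι := ι) 1 𝓕 {fun _ => c} := fun t P _ =>
  ⟨t + 1, P.step (.const c), le_rfl, P.avail_subset_step _,
    Set.singleton_subset_iff.2 (P.value_mem_step (.const c))⟩

lemma cost_add {f g : (ι → ℂ) → ℂ} (hf : f ∈ 𝓕) (hg : g ∈ 𝓕) :
    Cost 1 𝓕 {fun x => f x + g x} := fun t P hP => by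
  obtain ⟨a, ha⟩ := hP hf
  obtain ⟨b, hb⟩ := hP hg
  refine ⟨t + 1, P.step (.add a b), le_rfl, P.avail_subset_step _, Set.singleton_subset_iff.2 ?_⟩
  convert P.value_mem_step (.add a b) using 2 with x
  simp [Instr.value, ha, hb]

lemma cost_mul {f g : (ι → ℂ) → ℂ} (hf : f ∈ 𝓕) (hg : g ∈ 𝓕) :
    Cost 1 𝓕 {fun x => f x * g x} := fun t P hP => by
  obtain ⟨a, ha⟩ := hP hf
  obtain ⟨b, hb⟩ := hP hg
  refine ⟨t + 1, P.step (.mul a b), le_rfl, P.avail_subset_step _, Set.singleton_subset_iff.2 ?_⟩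
  convert P.value_mem_step (.mul a b) using 2 with x
  simp [Instr.value, ha, hb]

lemma Cost.add {f g : (ι → ℂ) → ℂ} (hf : Cost m 𝓕 {f}) (hg : Cost n 𝓕 {g}) :
    Cost (m + n + 1) 𝓕 {fun x => f x + g x} := by
  have h := (hf.trans (hg.subset Set.subset_union_left le_rfl)).comp
    (cost_add (f := f) (g := g) (by simp) (by simp))
  exact h

lemma Cost.mul {f g : (ι → ℂ) → ℂ} (hf : Cost m 𝓕 {f}) (hg : Cost n 𝓕 {g}) :
    Cost (m + n + 1) 𝓕 {fun x => f x * g x} := by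
  have h := (hf.trans (hg.subset Set.subset_union_left le_rfl)).comp
    (cost_mul (f := f) (g := g) (by simp) (by simp))
  exact h

lemma cost_of_mem {f : (ι → ℂ) → ℂ} (hf : f ∈ 𝓕) : Cost 0 𝓕 {f} :=
  Cost.of_subset (Set.singleton_subset_iff.2 hf)

lemma Cost.const_mul {f : (ι → ℂ) → ℂ} (c : ℂ) (hf : Cost m 𝓕 {f}) :
    Cost (m + 2) 𝓕 {fun x => c * f x} :=
  ((cost_const c).mul hf).mono (by omega)

lemma Cost.family {α : Type*} (s : Finset α) (g : α → (ι → ℂ) → ℂ)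
    (h : ∀ i ∈ s, Cost n 𝓕 {g i}) : Cost (s.card * n) 𝓕 (g '' s) := by
  classical
  induction s using Finset.induction_on with
  | empty => exact Cost.of_subset (by simp)
  | insert a s ha ih =>
    have h1 := (h a (by simp)).trans
      ((ih fun i hi => h i (by simp [hi])).subset Set.subset_union_left le_rfl)
    refine (h1.mono (n := (insert a s).card * n) ?_).subset le_rfl ?_
    · rw [Finset.card_insert_of_notMem ha]; linarith [add_mul s.card 1 n]
    · rw [Finset.coe_insert, Set.image_insert_eq]
      exact (Set.insert_eq _ _).subset

/-- Linear combinations of available functions. -/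
lemma Cost.linear {α : Type*} (s : Finset α) (c : α → ℂ) (g : α → (ι → ℂ) → ℂ)
    (h : ∀ i ∈ s, Cost n 𝓕 {g i}) :
    Cost (s.card * (n + 3) + 1) 𝓕 {fun x => ∑ i ∈ s, c i * g i x} := by
  classical
  induction s using Finset.induction_on with
  | empty => simpa using cost_const (𝓕 := 𝓕) (0 : ℂ)
  | insert a s ha ih =>
    have h1 := ((h a (by simp)).const_mul (c a)).add (ih fun i hi => h i (by simp [hi]))
    simp only [Finset.sum_insert ha]
    refine h1.mono ?_
    rw [Finset.card_insert_of_notMem ha]; linarith [add_mul s.card 1 (n + 3)]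

lemma cost_linear {α : Type*} (s : Finset α) (c : α → ℂ) (g : α → (ι → ℂ) → ℂ)
    (h : ∀ i ∈ s, g i ∈ 𝓕) :
    Cost (s.card * 3 + 1) 𝓕 {fun x => ∑ i ∈ s, c i * g i x} :=
  Cost.linear (n := 0) s c g fun i hi => cost_of_mem (h i hi)

/-- A program computes any family of functions that become available. -/
lemma Cost.exists_program {κ : Type} (f : κ → (ι → ℂ) → ℂ)
    (h : Cost n (Set.range fun i : ι => fun x : ι → ℂ => x i) (Set.range f)) :
    ∃ A : Program ι κ, A.cost ≤ n ∧ ∀ x k, A.run x k = f k x := by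
  obtain ⟨t, P, h1, -, h3⟩ := h 0 .nil (by
    rintro _ ⟨i, rfl⟩
    exact ⟨Sum.inl i, fun x => rfl⟩)
  have h4 : ∀ k, ∃ a : ι ⊕ Fin t, ∀ x, f k x = Sum.elim x (P.results x) a :=
    fun k => h3 ⟨k, rfl⟩
  choose out hout using h4
  exact ⟨⟨t, P, out⟩, by simpa using h1, fun x k => (hout k x).symm⟩

end StraightLine

/-! ### Solid harmonics as coefficients of powers of null forms, with sharp bounds -/

noncomputable section

namespace HalfSpace

open Polynomial Complex

/-- The quadratic polynomial `γ + αX + βX²`. -/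
def quadPoly (γ α β : ℂ) : ℂ[X] := C γ + C α * X + C β * X ^ 2

/-- The complex horizontal coordinate. -/
def hor (w : Space) : ℂ := ⟨w 0, w 1⟩

/-- A null linear form, parametrized rationally: `-ū/2 + zX + (u/2)X²`. -/
def quad (w : Space) : ℂ[X] := quadPoly (-(starRingEnd ℂ) (hor w) / 2) (w 2 : ℝ) (hor w / 2)

/-- The solid harmonics of degree `n` that are generated by the powers of the null forms;
the order is `j - n`. -/
def harm (n j : ℕ) (w : Space) : ℂ := (quad w ^ n).coeff j

lemma natDegree_quadPoly_le (γ α β : ℂ) : (quadPoly γ α β).natDegree ≤ 2 := by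
  unfold quadPoly; compute_degree

lemma natDegree_quadPoly_pow_le (γ α β : ℂ) (n : ℕ) :
    (quadPoly γ α β ^ n).natDegree ≤ 2 * n := by
  refine natDegree_pow_le.trans ?_
  have := natDegree_quadPoly_le γ α β
  nlinarith

lemma eval_quadPoly (γ α β x : ℂ) : (quadPoly γ α β).eval x = γ + α * x + β * x ^ 2 := by
  simp [quadPoly]

lemma coeff_quadPoly_mul_zero (γ α β : ℂ) (f : ℂ[X]) :
    (quadPoly γ α β * f).coeff 0 = γ * f.coeff 0 := by
  simp [quadPoly, mul_coeff_zero]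

lemma coeff_quadPoly_mul_one (γ α β : ℂ) (f : ℂ[X]) :
    (quadPoly γ α β * f).coeff 1 = γ * f.coeff 1 + α * f.coeff 0 := by
  have : quadPoly γ α β * f = C γ * f + C α * (f * X) + C β * (f * X * X) := by
    unfold quadPoly; ring
  rw [this]
  simp [coeff_mul_X]

lemma coeff_quadPoly_mul_add_two (γ α β : ℂ) (f : ℂ[X]) (j : ℕ) :
    (quadPoly γ α β * f).coeff (j + 2) =
      γ * f.coeff (j + 2) + α * f.coeff (j + 1) + β * f.coeff j := by
  have : quadPoly γ α β * f = C γ * f + C α * (f * X) + C β * (f * X * X) := by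
    unfold quadPoly; ring
  rw [this]
  simp only [coeff_add, coeff_C_mul]
  rw [show j + 2 = j + 1 + 1 from rfl, coeff_mul_X, coeff_mul_X, coeff_mul_X]

lemma coeff_quadPoly_pow_eq_zero (γ α β : ℂ) {n j : ℕ} (h : 2 * n < j) :
    (quadPoly γ α β ^ n).coeff j = 0 :=
  coeff_eq_zero_of_natDegree_lt ((natDegree_quadPoly_pow_le γ α β n).trans_lt h)

lemma coeff_quadPoly_pow_zero (γ α β : ℂ) (n : ℕ) :
    (quadPoly γ α β ^ n).coeff 0 = γ ^ n := by
  induction n with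
  | zero => simp
  | succ n ih => rw [pow_succ', coeff_quadPoly_mul_zero, ih, pow_succ']

/-- The coefficients of powers are homogeneous in the two spinor components. -/
lemma coeff_quadPoly_pow_homogeneous (γ α β s t : ℂ) (n : ℕ) : ∀ j ≤ 2 * n,
    (quadPoly (γ * t ^ 2) (α * (s * t)) (β * s ^ 2) ^ n).coeff j =
      (quadPoly γ α β ^ n).coeff j * (s ^ j * t ^ (2 * n - j)) := by
  induction n with
  | zero => intro j hj; obtain rfl : j = 0 := by omega
            simp
  | succ n ih =>
    -- The exponent is a free variable, tied to `2n - j` only where this subtraction is not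
    -- truncated; for larger `j` both coefficients vanish and any exponent will do.
    have key : ∀ j, ∀ e, (j ≤ 2 * n → e = 2 * n - j) →
        (quadPoly (γ * t ^ 2) (α * (s * t)) (β * s ^ 2) ^ n).coeff j =
        (quadPoly γ α β ^ n).coeff j * (s ^ j * t ^ e) := by
      intro j e he
      rcases le_or_gt j (2 * n) with h | h
      · rw [ih j h, he h]
      · rw [coeff_quadPoly_pow_eq_zero _ _ _ h, coeff_quadPoly_pow_eq_zero _ _ _ h, zero_mul]
    intro j hj
    rw [pow_succ' (quadPoly _ _ _), pow_succ' (quadPoly _ _ _)]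
    rcases j with _ | _ | j
    · rw [coeff_quadPoly_mul_zero, coeff_quadPoly_mul_zero, key 0 (2 * n) (by omega),
        show 2 * (n + 1) - 0 = 2 * n + 2 by omega]
      ring
    · rw [zero_add, coeff_quadPoly_mul_one, coeff_quadPoly_mul_one, key 0 (2 * n) (by omega)]
      rcases n with _ | n
      · have h1 : (1 : ℂ[X]).coeff 1 = 0 := by rw [coeff_one]; simp
        simp [h1]
      · rw [key 1 (2 * n + 1) (by omega), show 2 * (n + 1 + 1) - 1 = 2 * n + 3 by omega,
          show 2 * (n + 1) = 2 * n + 2 by omega]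
        ring
    · rw [coeff_quadPoly_mul_add_two, coeff_quadPoly_mul_add_two,
        key j (2 * n - j) (by omega), show 2 * (n + 1) - (j + 1 + 1) = 2 * n - j by omega]
      rcases le_or_gt (2 * n) j with h | h
      · obtain rfl : j = 2 * n := by omega
        rw [coeff_quadPoly_pow_eq_zero (j := 2 * n + 2) _ _ _ (by omega),
          coeff_quadPoly_pow_eq_zero (j := 2 * n + 2) _ _ _ (by omega),
          coeff_quadPoly_pow_eq_zero (j := 2 * n + 1) _ _ _ (by omega),
          coeff_quadPoly_pow_eq_zero (j := 2 * n + 1) _ _ _ (by omega)]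
        ring
      · obtain ⟨e, he⟩ : ∃ e, 2 * n = j + 1 + e := ⟨2 * n - j - 1, by omega⟩
        rw [key (j + 1) e (by omega), show 2 * n - j = e + 1 by omega]
        rcases e with _ | e
        · rw [coeff_quadPoly_pow_eq_zero (j := j + 2) _ _ _ (by omega),
            coeff_quadPoly_pow_eq_zero (j := j + 2) _ _ _ (by omega)]
          ring
        · rw [key (j + 2) e (by omega)]
          ring

lemma pow_eq_sum_coeff_quadPoly (γ α β s t : ℂ) (n : ℕ) :
    (γ * t ^ 2 + α * (s * t) + β * s ^ 2) ^ n =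
      ∑ j ∈ Finset.range (2 * n + 1),
        (quadPoly γ α β ^ n).coeff j * (s ^ j * t ^ (2 * n - j)) := by
  -- The left side is the rescaled polynomial evaluated at `X = 1`.
  have h := eval_eq_sum_range' (Nat.lt_succ_of_le
    (natDegree_quadPoly_pow_le (γ * t ^ 2) (α * (s * t)) (β * s ^ 2) n)) 1
  rw [eval_pow, eval_quadPoly] at h
  simp only [mul_one, one_pow] at h
  rw [h]
  exact Finset.sum_congr rfl fun j hj =>
    coeff_quadPoly_pow_homogeneous _ _ _ _ _ _ _ (by simp at hj; omega)

/-! ### Roots of unity -/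

/-- A primitive root of unity. -/
def rootU (q : ℕ) : ℂ := Complex.exp (2 * Real.pi * I / q)

lemma norm_rootU (q : ℕ) : ‖rootU q‖ = 1 := by
  rw [rootU, show (2 * Real.pi * I / q : ℂ) = ((2 * Real.pi / q : ℝ) : ℂ) * I by push_cast; ring]
  exact Complex.norm_exp_ofReal_mul_I _

/-- Discrete Fourier inversion, by orthogonality of the powers of a root of unity; it is exact
because the degree is below the number of nodes. It serves as a Cauchy formula, as a proof of
smoothness, and as the quadrature that makes the translation fast. -/
lemma coeff_eq_sum_rootU {q : ℕ} (f : ℂ[X]) (hf : f.natDegree < q) {j : ℕ} (hj : j < q) :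
    f.coeff j = (q : ℂ)⁻¹ * ∑ l ∈ Finset.range q,
      ((rootU q ^ l) ^ j)⁻¹ * f.eval (rootU q ^ l) := by
  have hq : q ≠ 0 := by omega
  have hp : IsPrimitiveRoot (rootU q) q := Complex.isPrimitiveRoot_exp q hq
  have hne : rootU q ≠ 0 := hp.ne_zero hq
  have h1 : ∀ i ∈ Finset.range q, (∑ l ∈ Finset.range q,
      ((rootU q ^ l) ^ j)⁻¹ * (f.coeff i * (rootU q ^ l) ^ i)) =
      if i = j then (q : ℂ) * f.coeff j else 0 := by
    intro i hi
    have hi' : i < q := by simpa using hi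
    have h2 : ∀ l, ((rootU q ^ l) ^ j)⁻¹ * (f.coeff i * (rootU q ^ l) ^ i) =
        f.coeff i * (rootU q ^ i / rootU q ^ j) ^ l := by
      intro l
      rw [div_pow, ← pow_mul, ← pow_mul, ← pow_mul, ← pow_mul, mul_comm l j, mul_comm l i]
      field_simp
    simp only [h2, ← Finset.mul_sum]
    split_ifs with hij
    · subst hij
      rw [div_self (pow_ne_zero _ hne)]
      simp [mul_comm]
    · have h3 : rootU q ^ i / rootU q ^ j ≠ 1 := by
        intro h
        rw [div_eq_one_iff_eq (pow_ne_zero _ hne)] at h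
        exact hij (hp.pow_inj hi' hj h)
      have h4 : (rootU q ^ i / rootU q ^ j) ^ q = 1 := by
        rw [div_pow, ← pow_mul, ← pow_mul, mul_comm i, mul_comm j, pow_mul, pow_mul, hp.pow_eq_one]
        simp
      rw [geom_sum_eq h3, h4]
      simp
  have h5 : ∑ l ∈ Finset.range q, ((rootU q ^ l) ^ j)⁻¹ * f.eval (rootU q ^ l) =
      (q : ℂ) * f.coeff j := by
    simp only [eval_eq_sum_range' hf, Finset.mul_sum]
    rw [Finset.sum_comm, Finset.sum_congr rfl h1]
    simp [hj]
  rw [h5]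
  field_simp

/-- Cauchy's estimate: the coefficient is an average of values on the unit circle with unimodular
factors. -/
lemma norm_coeff_le {f : ℂ[X]} {B : ℝ} (hB : ∀ x : ℂ, ‖x‖ = 1 → ‖f.eval x‖ ≤ B) (j : ℕ) :
    ‖f.coeff j‖ ≤ B := by
  set q := f.natDegree + j + 1
  rw [coeff_eq_sum_rootU (q := q) f (by omega) (j := j) (by omega), norm_mul, norm_inv,
    Complex.norm_natCast]
  have hn : ∀ l, ‖rootU q ^ l‖ = 1 := fun l => by rw [norm_pow, norm_rootU, one_pow]
  have h1 : ‖∑ l ∈ Finset.range q, ((rootU q ^ l) ^ j)⁻¹ * f.eval (rootU q ^ l)‖ ≤ q * B := by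
    refine (norm_sum_le _ _).trans ?_
    have : ∀ l ∈ Finset.range q, ‖((rootU q ^ l) ^ j)⁻¹ * f.eval (rootU q ^ l)‖ ≤ B := by
      intro l _
      rw [norm_mul, norm_inv, norm_pow, hn, one_pow, inv_one, one_mul]
      exact hB _ (hn l)
    simpa using Finset.sum_le_card_nsmul _ _ _ this
  have hq : (0 : ℝ) < q := by positivity
  rw [inv_mul_le_iff₀ hq]
  exact h1

/-! ### Weights -/

/-- The supremum of `s^j t^(2n-j)` over `s² + t² = 2`. -/
def wt (n j : ℕ) : ℝ :=
  ⨆ p : {p : ℝ × ℝ // 0 ≤ p.1 ∧ 0 ≤ p.2 ∧ p.1 ^ 2 + p.2 ^ 2 = 2},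
    p.1.1 ^ j * p.1.2 ^ (2 * n - j)

instance : Nonempty {p : ℝ × ℝ // 0 ≤ p.1 ∧ 0 ≤ p.2 ∧ p.1 ^ 2 + p.2 ^ 2 = 2} :=
  ⟨⟨(1, 1), by norm_num⟩⟩

lemma le_wt (n j : ℕ) {s t : ℝ} (hs : 0 ≤ s) (ht : 0 ≤ t) (h : s ^ 2 + t ^ 2 = 2) :
    s ^ j * t ^ (2 * n - j) ≤ wt n j := by
  refine le_ciSup (f := fun p : {p : ℝ × ℝ // 0 ≤ p.1 ∧ 0 ≤ p.2 ∧ p.1 ^ 2 + p.2 ^ 2 = 2} =>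
    p.1.1 ^ j * p.1.2 ^ (2 * n - j)) ?_ ⟨(s, t), hs, ht, h⟩
  -- The supremum is meaningful only if the set is bounded; on the circle both coordinates are at
  -- most 2.
  refine ⟨2 ^ j * 2 ^ (2 * n - j), ?_⟩
  rintro _ ⟨⟨⟨a, b⟩, ha, hb, hab⟩, rfl⟩
  dsimp only at *
  have h1 : a ≤ 2 := by nlinarith
  have h2 : b ≤ 2 := by nlinarith
  gcongr

lemma wt_le {n j : ℕ} {B : ℝ} (h : ∀ s t : ℝ, 0 ≤ s → 0 ≤ t → s ^ 2 + t ^ 2 = 2 →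
    s ^ j * t ^ (2 * n - j) ≤ B) : wt n j ≤ B :=
  ciSup_le fun p => h _ _ p.2.1 p.2.2.1 p.2.2.2

lemma one_le_wt (n j : ℕ) : 1 ≤ wt n j := by
  simpa using le_wt n j zero_le_one zero_le_one (by norm_num)

lemma wt_pos (n j : ℕ) : 0 < wt n j := zero_lt_one.trans_le (one_le_wt n j)

/-- The supremum of a product is at most the product of the suprema. This submultiplicativity lets
translations be estimated without exponential loss. -/
lemma wt_add_le {n j k i : ℕ} (hj : j ≤ 2 * n) (hi : i ≤ 2 * k) :
    wt (n + k) (j + i) ≤ wt n j * wt k i := by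
  refine wt_le fun s t hs ht h => ?_
  have : s ^ (j + i) * t ^ (2 * (n + k) - (j + i)) =
      (s ^ j * t ^ (2 * n - j)) * (s ^ i * t ^ (2 * k - i)) := by
    rw [show 2 * (n + k) - (j + i) = (2 * n - j) + (2 * k - i) by omega]; ring
  rw [this]
  exact mul_le_mul (le_wt n j hs ht h) (le_wt k i hs ht h) (by positivity) (wt_pos n j).le

lemma norm_le_wt (n j : ℕ) {s t : ℂ} (h : ‖s‖ ^ 2 + ‖t‖ ^ 2 = 2) :
    ‖s ^ j * t ^ (2 * n - j)‖ ≤ wt n j := by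
  rw [norm_mul, norm_pow, norm_pow]
  exact le_wt n j (norm_nonneg _) (norm_nonneg _) h

/-! ### Bounds -/

lemma norm_sq_space (w : Space) : ‖w‖ ^ 2 = w 0 ^ 2 + w 1 ^ 2 + w 2 ^ 2 := by
  rw [EuclideanSpace.norm_sq_eq, Fin.sum_univ_three]
  simp

/-- The value of the null form at a spinor. -/
def spinForm (s t : ℂ) (w : Space) : ℂ :=
  -(starRingEnd ℂ) (hor w) / 2 * t ^ 2 + (w 2 : ℝ) * (s * t) + hor w / 2 * s ^ 2

/-- The real and imaginary parts of a null vector are orthogonal and of equal length. Completing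
them to an orthogonal frame gives the identity `h1`, which is Pythagoras for `w` in this frame;
dropping the third component gives the bound. -/
lemma norm_spinForm_le {s t : ℂ} (h : ‖s‖ ^ 2 + ‖t‖ ^ 2 = 2) (w : Space) :
    ‖spinForm s t w‖ ≤ ‖w‖ := by
  refine le_of_sq_le_sq ?_ (norm_nonneg _)
  have h1 : ‖spinForm s t w‖ ^ 2 +
      ((‖s‖ ^ 2 - ‖t‖ ^ 2) / 2 * w 2 - (s * (starRingEnd ℂ) t * hor w).re) ^ 2 =
      ((‖s‖ ^ 2 + ‖t‖ ^ 2) / 2) ^ 2 * ‖w‖ ^ 2 := by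
    rw [norm_sq_space, ← Complex.normSq_eq_norm_sq, ← Complex.normSq_eq_norm_sq,
      ← Complex.normSq_eq_norm_sq]
    obtain ⟨a, b⟩ := s
    obtain ⟨c, d⟩ := t
    simp only [spinForm, hor, Complex.normSq_apply, Complex.add_re, Complex.add_im, Complex.mul_re,
      Complex.mul_im, Complex.neg_re, Complex.neg_im, Complex.conj_re, Complex.conj_im,
      Complex.div_ofNat_re, Complex.div_ofNat_im, pow_two, Complex.ofReal_re, Complex.ofReal_im]
    ring
  rw [h] at h1
  nlinarith [sq_nonneg ((‖s‖ ^ 2 - ‖t‖ ^ 2) / 2 * w 2 - (s * (starRingEnd ℂ) t * hor w).re)]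

lemma spinForm_pow (s t : ℂ) (w : Space) (n : ℕ) :
    spinForm s t w ^ n =
      ∑ j ∈ Finset.range (2 * n + 1), harm n j w * (s ^ j * t ^ (2 * n - j)) :=
  pow_eq_sum_coeff_quadPoly _ _ _ _ _ _

lemma harm_eq_zero {n j : ℕ} (h : 2 * n < j) (w : Space) : harm n j w = 0 :=
  coeff_quadPoly_pow_eq_zero _ _ _ h

lemma spinForm_add (s t : ℂ) (v w : Space) :
    spinForm s t (v + w) = spinForm s t v + spinForm s t w := by
  simp only [spinForm, hor, PiLp.add_apply]
  apply Complex.ext <;> simp [Complex.add_re, pow_two] <;> ring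

lemma spinForm_smul (s t : ℂ) (c : ℝ) (w : Space) :
    spinForm s t (c • w) = c * spinForm s t w := by
  simp only [spinForm, hor, PiLp.smul_apply, smul_eq_mul]
  apply Complex.ext <;> simp [pow_two] <;> ring

lemma eval_quad (x : ℂ) (w : Space) : (quad w).eval x = spinForm x 1 w := by
  rw [quad, eval_quadPoly, spinForm]; ring

lemma quad_add (v w : Space) : quad (v + w) = quad v + quad w := by
  refine Polynomial.funext fun x => ?_
  rw [eval_add, eval_quad, eval_quad, eval_quad, spinForm_add]

lemma quad_smul (c : ℝ) (w : Space) : quad (c • w) = C (c : ℂ) * quad w := by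
  refine Polynomial.funext fun x => ?_
  rw [eval_mul, eval_quad, eval_quad, spinForm_smul, eval_C]

lemma natDegree_quad_pow_le (w : Space) (n : ℕ) : (quad w ^ n).natDegree ≤ 2 * n :=
  natDegree_quadPoly_pow_le _ _ _ _

lemma harm_smul (n j : ℕ) (c : ℝ) (w : Space) : harm n j (c • w) = c ^ n * harm n j w := by
  rw [harm, quad_smul, mul_pow, ← C_pow, coeff_C_mul, harm]

lemma harm_neg (n j : ℕ) (w : Space) : harm n j (-w) = (-1) ^ n * harm n j w := by
  have := harm_smul n j (-1) w
  simpa using this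

/-- The addition theorem. -/
lemma harm_add (N J : ℕ) (v w : Space) :
    harm N J (v + w) = ∑ n ∈ Finset.range (N + 1), (N.choose n : ℂ) *
      ∑ x ∈ Finset.HasAntidiagonal.antidiagonal J, harm n x.1 v * harm (N - n) x.2 w := by
  rw [harm, quad_add, add_pow, finsetSum_coeff]
  refine Finset.sum_congr rfl fun n _ => ?_
  rw [← C_eq_natCast, coeff_mul_C, coeff_mul, mul_comm]
  rfl

lemma spinForm_scaled (s t x : ℂ) (w : Space) :
    (quadPoly (-(starRingEnd ℂ) (hor w) / 2 * t ^ 2) ((w 2 : ℝ) * (s * t))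
      (hor w / 2 * s ^ 2)).eval x = spinForm (s * x) t w := by
  rw [eval_quadPoly, spinForm]; ring

/-- For fixed `s, t` the product with `s^j t^(2n-j)` is a coefficient of the polynomial `x ↦
spinForm (s x) t w ^ n`, which is bounded by `‖w‖^n` on the unit circle since `(s x, t)` keeps its
norm. The supremum over `(s, t)` produces the weight. -/
lemma norm_harm_mul_wt_le (n j : ℕ) (w : Space) : ‖harm n j w‖ * wt n j ≤ ‖w‖ ^ n := by
  rcases lt_or_ge (2 * n) j with hj | hj
  · rw [harm_eq_zero hj]; simp
  have key : ∀ s t : ℝ, 0 ≤ s → 0 ≤ t → s ^ 2 + t ^ 2 = 2 →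
      ‖harm n j w‖ * (s ^ j * t ^ (2 * n - j)) ≤ ‖w‖ ^ n := by
    intro s t hs ht hst
    have h1 := coeff_quadPoly_pow_homogeneous (-(starRingEnd ℂ) (hor w) / 2) (w 2 : ℝ)
      (hor w / 2) (s : ℂ) (t : ℂ) n j hj
    have h2 : ‖harm n j w‖ * (s ^ j * t ^ (2 * n - j)) =
        ‖(quadPoly (-(starRingEnd ℂ) (hor w) / 2) (w 2 : ℝ) (hor w / 2) ^ n).coeff j *
          ((s : ℂ) ^ j * (t : ℂ) ^ (2 * n - j))‖ := by
      rw [norm_mul, norm_mul, norm_pow, norm_pow, Complex.norm_of_nonneg hs,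
        Complex.norm_of_nonneg ht]
      rfl
    rw [h2, ← h1]
    refine norm_coeff_le (fun x hx => ?_) j
    rw [eval_pow, norm_pow, spinForm_scaled]
    gcongr
    refine norm_spinForm_le ?_ w
    rw [norm_mul, hx, mul_one, Complex.norm_of_nonneg hs, Complex.norm_of_nonneg ht, hst]
  rcases eq_or_ne (harm n j w) 0 with h0 | h0
  · rw [h0]; simp
  · have h3 : 0 < ‖harm n j w‖ := norm_pos_iff.2 h0
    rw [← le_div_iff₀' h3]
    exact wt_le fun s t hs ht hst => (le_div_iff₀' h3).2 (key s t hs ht hst)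

lemma norm_harm_le (n j : ℕ) (w : Space) : ‖harm n j w‖ ≤ ‖w‖ ^ n / wt n j :=
  (le_div_iff₀ (wt_pos n j)).2 (norm_harm_mul_wt_le n j w)

/-! ### Derivatives -/

/-- `spinForm` as a continuous linear map. -/
def spinCLM (s t : ℂ) : Space →L[ℝ] ℂ :=
  LinearMap.toContinuousLinearMap
    { toFun := spinForm s t
      map_add' := spinForm_add s t
      map_smul' := fun c w => by simp [spinForm_smul] }

/-- The derivative of `harm n j` at `w` in the direction `v`. -/
def harmD (n j : ℕ) (w v : Space) : ℂ := n * (quad v * quad w ^ (n - 1)).coeff j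

lemma natDegree_quad_mul_quad_pow_le (v w : Space) (n : ℕ) :
    (quad v * quad w ^ n).natDegree ≤ 2 * (n + 1) := by
  refine natDegree_mul_le.trans ?_
  have := natDegree_quad_pow_le w n
  have h2 : (quad v).natDegree ≤ 2 := natDegree_quadPoly_le _ _ _
  omega

/-- `harmD` as a continuous linear map. -/
def harmCLM (n j : ℕ) (w : Space) : Space →L[ℝ] ℂ :=
  LinearMap.toContinuousLinearMap
    { toFun := harmD n j w
      map_add' := fun v v' => by simp [harmD, quad_add, add_mul, mul_add]
      map_smul' := fun c v => by
        simp only [harmD, quad_smul, mul_assoc, coeff_C_mul, RingHom.id_apply, Complex.real_smul]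
        ring }

@[simp] lemma harmCLM_apply (n j : ℕ) (w v : Space) : harmCLM n j w v = harmD n j w v := rfl

/-- By Fourier inversion `harm n j` is a finite combination of `n`th powers of linear forms; the
derivative of these, inverted back, is again a coefficient. -/
lemma hasFDerivAt_harm (n j : ℕ) (w : Space) : HasFDerivAt (harm n j) (harmCLM n j w) w := by
  -- The number of nodes exceeds `j`, the degree `2n`, and the degree bound of the derivative, which
  -- is 2 when `n = 0` because `n - 1` is truncated.
  set q := 2 * n + j + 3
  have h1 : harm n j = fun w => (q : ℂ)⁻¹ * ∑ l ∈ Finset.range q,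
      ((rootU q ^ l) ^ j)⁻¹ * spinCLM (rootU q ^ l) 1 w ^ n := by
    funext w
    rw [harm, coeff_eq_sum_rootU (q := q) _
      (by have := natDegree_quad_pow_le w n; omega) (by omega)]
    simp only [eval_pow, eval_quad]
    rfl
  have h2 : HasFDerivAt (fun w => (q : ℂ)⁻¹ * ∑ l ∈ Finset.range q,
      ((rootU q ^ l) ^ j)⁻¹ * spinCLM (rootU q ^ l) 1 w ^ n) _ w :=
    (HasFDerivAt.fun_sum fun l _ =>
      (((spinCLM (rootU q ^ l) 1).hasFDerivAt (x := w)).pow n).const_mul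
        (((rootU q ^ l) ^ j)⁻¹)).const_mul (q : ℂ)⁻¹
  rw [h1]
  refine h2.congr_fderiv (ContinuousLinearMap.ext fun v => ?_)
  symm
  rw [harmCLM_apply, harmD, coeff_eq_sum_rootU (q := q) _
      (by have := natDegree_quad_mul_quad_pow_le v w (n - 1); omega) (by omega)]
  simp only [eval_mul, eval_pow, eval_quad, smul_apply,
    sum_apply, smul_eq_mul, nsmul_eq_mul]
  rw [mul_left_comm, Finset.mul_sum]
  refine congrArg _ (Finset.sum_congr rfl fun l _ => ?_)
  have h3 : ∀ v, spinCLM (rootU q ^ l) 1 v = spinForm (rootU q ^ l) 1 v := fun _ => rfl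
  simp only [h3]
  ring

/-- The rescaling argument for `harm`, with one of the `n` factors taken at the direction `v`. -/
lemma norm_harmD_mul_wt_le (n j : ℕ) (w v : Space) :
    ‖harmD n j w v‖ * wt n j ≤ n * ‖w‖ ^ (n - 1) * ‖v‖ := by
  rcases n with _ | n
  · simp [harmD]
  rcases lt_or_ge (2 * (n + 1)) j with hj | hj
  · rw [harmD, coeff_eq_zero_of_natDegree_lt
      ((natDegree_quad_mul_quad_pow_le v w _).trans_lt (by simpa using hj))]
    simp; positivity
  have key : ∀ s t : ℝ, 0 ≤ s → 0 ≤ t → s ^ 2 + t ^ 2 = 2 →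
      ‖(quad v * quad w ^ n).coeff j‖ * (s ^ j * t ^ (2 * (n + 1) - j)) ≤ ‖w‖ ^ n * ‖v‖ := by
    intro s t hs ht hst
    have h1 : (quadPoly (-(starRingEnd ℂ) (hor v) / 2 * t ^ 2) ((v 2 : ℝ) * (s * t))
        (hor v / 2 * s ^ 2) * quadPoly (-(starRingEnd ℂ) (hor w) / 2 * t ^ 2) ((w 2 : ℝ) * (s * t))
        (hor w / 2 * s ^ 2) ^ n).coeff j =
        (quad v * quad w ^ n).coeff j * ((s : ℂ) ^ j * (t : ℂ) ^ (2 * (n + 1) - j)) := by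
      rw [coeff_mul, coeff_mul, Finset.sum_mul]
      refine Finset.sum_congr rfl fun x hx => ?_
      rw [Finset.HasAntidiagonal.mem_antidiagonal] at hx
      rcases lt_or_ge 2 x.1 with h | h
      · rw [coeff_eq_zero_of_natDegree_lt ((natDegree_quadPoly_le _ _ _).trans_lt h),
          coeff_eq_zero_of_natDegree_lt (p := quad v) ((natDegree_quadPoly_le _ _ _).trans_lt h)]
        simp
      rcases lt_or_ge (2 * n) x.2 with h' | h'
      · rw [coeff_quadPoly_pow_eq_zero _ _ _ h', quad, quad, coeff_quadPoly_pow_eq_zero _ _ _ h']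
        simp
      have h2 := coeff_quadPoly_pow_homogeneous (-(starRingEnd ℂ) (hor v) / 2) (v 2 : ℝ)
        (hor v / 2) (s : ℂ) (t : ℂ) 1 x.1 (by omega)
      have h3 := coeff_quadPoly_pow_homogeneous (-(starRingEnd ℂ) (hor w) / 2) (w 2 : ℝ)
        (hor w / 2) (s : ℂ) (t : ℂ) n x.2 (by omega)
      rw [pow_one, pow_one] at h2
      rw [h2, h3, ← hx, show 2 * (n + 1) - (x.1 + x.2) = (2 * 1 - x.1) + (2 * n - x.2) by omega,
        quad, quad]
      ring
    have h2 : ‖(quad v * quad w ^ n).coeff j‖ * (s ^ j * t ^ (2 * (n + 1) - j)) =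
        ‖(quad v * quad w ^ n).coeff j * ((s : ℂ) ^ j * (t : ℂ) ^ (2 * (n + 1) - j))‖ := by
      rw [norm_mul, norm_mul, norm_pow, norm_pow, Complex.norm_of_nonneg hs,
        Complex.norm_of_nonneg ht]
    rw [h2, ← h1]
    refine norm_coeff_le (fun x hx => ?_) j
    have h3 : ‖(s : ℂ) * x‖ ^ 2 + ‖(t : ℂ)‖ ^ 2 = 2 := by
      rw [norm_mul, hx, mul_one, Complex.norm_of_nonneg hs, Complex.norm_of_nonneg ht, hst]
    rw [eval_mul, eval_pow, norm_mul, norm_pow, spinForm_scaled, spinForm_scaled, mul_comm]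
    gcongr
    · exact norm_spinForm_le h3 w
    · exact norm_spinForm_le h3 v
  have h4 : ‖(quad v * quad w ^ n).coeff j‖ * wt (n + 1) j ≤ ‖w‖ ^ n * ‖v‖ := by
    rcases eq_or_ne ((quad v * quad w ^ n).coeff j) 0 with h0 | h0
    · rw [h0]; simp; positivity
    · have h3 : 0 < ‖(quad v * quad w ^ n).coeff j‖ := norm_pos_iff.2 h0
      rw [← le_div_iff₀' h3]
      exact wt_le fun s t hs ht hst => (le_div_iff₀' h3).2 (key s t hs ht hst)
  rw [harmD, Nat.add_sub_cancel, norm_mul, Complex.norm_natCast, mul_assoc, mul_assoc]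
  exact mul_le_mul_of_nonneg_left h4 (Nat.cast_nonneg _)

end HalfSpace

end

/-! ### Identification with the spherical harmonics -/

noncomputable section

namespace HalfSpace

open Polynomial Complex

/-- Central coefficients of the powers of a quadratic polynomial, by a linear substitution. -/
lemma coeff_quadPoly_pow_central (u v z : ℂ) (n m : ℕ) :
    (quadPoly (-v / 2) z (u / 2) ^ n).coeff (n + m) =
      (2 ^ n)⁻¹ * u ^ m * ((quadPoly (-(u * v)) (2 * z) 1) ^ n).coeff (n + m) := by
  -- The substitution `X ↦ uX` carries one quadratic into a multiple of the other. It degenerates at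
  -- `u = 0`, where the coefficients are read off from powers of linear polynomials.
  rcases eq_or_ne u 0 with rfl | hu
  · rcases m with _ | m
    · have h : quadPoly (-(0 * v)) (2 * z) 1 ^ n = (X + C (2 * z)) ^ n * X ^ n := by
        rw [← mul_pow]; congr 1; simp [quadPoly]; ring
      have h' : ∀ n, (quadPoly (-v / 2) z (0 / 2) ^ n) = (C z * X + C (-v / 2)) ^ n := by
        intro n; congr 1; simp [quadPoly]; ring
      rw [h, add_zero, coeff_mul_X_pow', h']
      have h2 : (C z * X + C (-v / 2)) ^ n =
          ((X + C (-v / 2)) ^ n).comp (C z * X) := by simp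
      rw [h2, comp_C_mul_X_coeff, coeff_X_add_C_pow]
      simp [coeff_zero_eq_eval_zero, mul_pow]
    · have h' : (quadPoly (-v / 2) z (0 / 2) ^ n) = (C z * X + C (-v / 2)) ^ n := by
        congr 1; simp [quadPoly]; ring
      rw [h', coeff_eq_zero_of_natDegree_lt]
      · simp
      · refine lt_of_le_of_lt natDegree_pow_le (lt_of_le_of_lt (Nat.mul_le_mul_left n
          (natDegree_linear_le)) (by omega))
  · have h : (quadPoly (-(u * v)) (2 * z) 1).comp (C u * X) =
        C (2 * u) * quadPoly (-v / 2) z (u / 2) := by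
      refine Polynomial.funext fun x => ?_
      rw [eval_comp, eval_mul, eval_quadPoly]
      simp [eval_quadPoly]
      ring
    have h2 := congrArg (fun f => (f ^ n).coeff (n + m)) h
    simp only [mul_pow, ← C_pow, coeff_C_mul] at h2
    rw [← pow_comp, comp_C_mul_X_coeff] at h2
    have h3 : (2 * u) ^ n ≠ 0 := pow_ne_zero _ (mul_ne_zero two_ne_zero hu)
    rw [← mul_pow] at h2
    apply mul_left_cancel₀ h3
    rw [← h2]
    field_simp
    ring

/-- Reversal of the coefficients is multiplicative relative to degree bounds, so it suffices to
reverse the quadratic itself. It exchanges the orders `m` and `-m`. -/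
lemma coeff_quadPoly_pow_reverse (γ α β : ℂ) {n j : ℕ} (hj : j ≤ 2 * n) :
    (quadPoly γ α β ^ n).coeff (2 * n - j) = (quadPoly β α γ ^ n).coeff j := by
  have h1 : reflect 2 (quadPoly γ α β) = quadPoly β α γ := by
    ext i
    rw [coeff_reflect]
    rcases i with _ | _ | _ | i
    · simp [quadPoly, revAt_le, coeff_X, coeff_C]
    · simp [quadPoly, revAt_le (show 1 ≤ 2 by norm_num), coeff_C]
    · simp [quadPoly, revAt_le, coeff_X, coeff_C]
    · rw [revAt_eq_self_of_lt (by omega), coeff_eq_zero_of_natDegree_lt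
        ((natDegree_quadPoly_le _ _ _).trans_lt (by omega)), coeff_eq_zero_of_natDegree_lt
        ((natDegree_quadPoly_le _ _ _).trans_lt (by omega))]
  have h2 : ∀ n, reflect (2 * n) (quadPoly γ α β ^ n) = quadPoly β α γ ^ n := by
    intro n
    induction n with
    | zero => simp [reflect_one]
    | succ n ih =>
      rw [pow_succ, mul_add, mul_one, reflect_mul _ _ (natDegree_quadPoly_pow_le _ _ _ _)
        (natDegree_quadPoly_le _ _ _), ih, h1, pow_succ]
  rw [← h2 n, coeff_reflect, revAt_le hj]

/-- The polynomial is the Taylor shift by `t` of the one in Rodrigues' formula, so its coefficient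
of index `n + m` is a derivative of order `n + m` at `t`, divided by `(n + m)!`. -/
lemma coeff_taylor_legendre (n m : ℕ) (t : ℝ) :
    (((X + C t) ^ 2 - 1) ^ n : ℝ[X]).coeff (n + m) =
      2 ^ n * n.factorial / (n + m).factorial * (derivative^[m] (legendre n)).eval t := by
  have h1 : ((X + C t) ^ 2 - 1 : ℝ[X]) ^ n = taylor t ((X ^ 2 - 1) ^ n) := by
    rw [taylor_apply]; simp
  have h2 : ((n + m).factorial : ℝ) * (taylor t ((X ^ 2 - 1 : ℝ[X]) ^ n)).coeff (n + m) =
      (derivative^[n + m] ((X ^ 2 - 1 : ℝ[X]) ^ n)).eval t := by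
    rw [taylor_coeff, ← factorial_smul_hasseDeriv]
    simp
  have h3 : (derivative^[m] (legendre n)).eval t =
      1 / (2 ^ n * n.factorial) * (derivative^[n + m] ((X ^ 2 - 1 : ℝ[X]) ^ n)).eval t := by
    rw [legendre, iterate_derivative_C_mul, eval_mul, eval_C, ← Function.iterate_add_apply,
      add_comm m n]
  rw [h1, h3, ← h2]
  have : ((n + m).factorial : ℝ) ≠ 0 := by positivity
  have : (n.factorial : ℝ) ≠ 0 := by positivity
  field_simp

lemma hor_mul_conj (w : Space) :
    hor w * (starRingEnd ℂ) (hor w) = ((‖w‖ ^ 2 - w 2 ^ 2 : ℝ) : ℂ) := by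
  rw [Complex.mul_conj, norm_sq_space, Complex.normSq_apply, hor]
  push_cast
  ring

/-- After `X ↦ ‖w‖ X` and completion of the square the quadratic becomes `‖w‖² ((X + cos θ)² - 1)`.
-/
lemma coeff_quadPoly_pow_legendre {w : Space} (hw : w ≠ 0) {n m : ℕ} (hm : m ≤ n) :
    ((quadPoly (-(hor w * (starRingEnd ℂ) (hor w))) (2 * (w 2 : ℝ)) 1) ^ n).coeff (n + m) =
      ((‖w‖ ^ (n - m) * (2 ^ n * n.factorial / (n + m).factorial *
        (derivative^[m] (legendre n)).eval (w 2 / ‖w‖)) : ℝ) : ℂ) := by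
  have hr : ‖w‖ ≠ 0 := norm_ne_zero_iff.2 hw
  have h : (quadPoly (-(hor w * (starRingEnd ℂ) (hor w))) (2 * (w 2 : ℝ)) 1).comp
      (C (‖w‖ : ℂ) * X) =
      C ((‖w‖ : ℂ) ^ 2) * ((X + C (w 2 / ‖w‖)) ^ 2 - 1 : ℝ[X]).map ofRealHom := by
    have hr' : (‖w‖ : ℂ) ≠ 0 := by exact_mod_cast hr
    refine Polynomial.funext fun x => ?_
    rw [hor_mul_conj, eval_comp, eval_mul]
    simp [eval_quadPoly]
    field_simp
    ring
  have h2 := congrArg (fun f => (f ^ n).coeff (n + m)) h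
  simp only [mul_pow, ← C_pow, coeff_C_mul, ← Polynomial.map_pow, coeff_map] at h2
  rw [← pow_comp, comp_C_mul_X_coeff, coeff_taylor_legendre] at h2
  have h3 : (‖w‖ : ℂ) ^ (n + m) ≠ 0 := pow_ne_zero _ (by exact_mod_cast hr)
  apply mul_right_cancel₀ h3
  rw [h2]
  have h4 : ((‖w‖ : ℂ) ^ 2) ^ n = (‖w‖ : ℂ) ^ (n - m) * (‖w‖ : ℂ) ^ (n + m) := by
    rw [← pow_add, ← pow_mul]; congr 1; omega
  rw [h4]
  simp only [ofRealHom_eq_coe]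
  push_cast
  ring

lemma harm_add_legendre {w : Space} (hw : w ≠ 0) {n m : ℕ} (hm : m ≤ n) :
    harm n (n + m) w = hor w ^ m * ((‖w‖ ^ (n - m) * (n.factorial / (n + m).factorial *
        (derivative^[m] (legendre n)).eval (w 2 / ‖w‖)) : ℝ) : ℂ) := by
  rw [harm, quad, coeff_quadPoly_pow_central, coeff_quadPoly_pow_legendre hw hm]
  push_cast
  field_simp

lemma harm_sub_legendre {w : Space} (hw : w ≠ 0) {n m : ℕ} (hm : m ≤ n) :
    harm n (n - m) w = (-(starRingEnd ℂ) (hor w)) ^ m * ((‖w‖ ^ (n - m) *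
      (n.factorial / (n + m).factorial *
        (derivative^[m] (legendre n)).eval (w 2 / ‖w‖)) : ℝ) : ℂ) := by
  have h := coeff_quadPoly_pow_reverse (-(starRingEnd ℂ) (hor w) / 2) (w 2 : ℝ) (hor w / 2)
    (show n + m ≤ 2 * n by omega)
  rw [show 2 * n - (n + m) = n - m by omega] at h
  have h2 := coeff_quadPoly_pow_central (-(starRingEnd ℂ) (hor w)) (-hor w) (w 2 : ℝ) n m
  rw [neg_neg, show -(starRingEnd ℂ) (hor w) * -hor w = hor w * (starRingEnd ℂ) (hor w) by ring,
    coeff_quadPoly_pow_legendre hw hm] at h2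
  rw [harm, quad, h, h2]
  push_cast
  field_simp

lemma norm_hor_sq (w : Space) : ‖hor w‖ ^ 2 = ‖w‖ ^ 2 - w 2 ^ 2 := by
  rw [← Complex.normSq_eq_norm_sq, Complex.normSq_apply, norm_sq_space, hor]
  ring

/-- The factor between `solidY` and `harm`. -/
def solCoef (n : ℕ) (m : ℤ) : ℂ :=
  ((Real.sqrt ((2 * n + 1) / (4 * Real.pi)) *
      Real.sqrt (((n - m.natAbs).factorial : ℝ) / ((n + m.natAbs).factorial : ℝ)) *
      ((n + m.natAbs).factorial / n.factorial : ℝ) : ℝ) : ℂ) * (if 0 ≤ m then (-1) ^ m.natAbs else 1)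

lemma solCoef_ne_zero (n : ℕ) (m : ℤ) : solCoef n m ≠ 0 := by
  unfold solCoef
  refine mul_ne_zero ?_ ?_
  · have : Real.sqrt ((2 * n + 1) / (4 * Real.pi)) *
      Real.sqrt (((n - m.natAbs).factorial : ℝ) / ((n + m.natAbs).factorial : ℝ)) *
      ((n + m.natAbs).factorial / n.factorial : ℝ) ≠ 0 := by
      have := Real.pi_pos
      positivity
    exact_mod_cast this
  · split_ifs <;> simp

/-- The angles of the zero vector are default values. They do no harm: both sides vanish for `n > 0`
and are constant for `n = 0`. -/
lemma solidY_zero (n : ℕ) (m : ℤ) (hm : |m| ≤ n) :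
    solidY n m 0 = solCoef n m * harm n (n + m).toNat 0 := by
  rcases n with _ | n
  · obtain rfl : m = 0 := by simpa using hm
    simp [solidY, sphericalY, assocLegendre, solCoef, harm, legendre]
  · have : quad 0 = 0 := by
      have := quad_smul 0 0
      simpa using this
    simp [solidY, harm, this]

/-- The functions `r^n Y_n^m` are the solid harmonics. -/
lemma solidY_eq {n : ℕ} {m : ℤ} (hm : |m| ≤ n) (w : Space) :
    solidY n m w = solCoef n m * harm n (n + m).toNat w := by
  rcases eq_or_ne w 0 with rfl | hw
  · exact solidY_zero n m hm
  have hr : 0 < ‖w‖ := norm_pos_iff.2 hw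
  have hz : |w 2| ≤ ‖w‖ := by
    rw [← Real.norm_eq_abs]; exact PiLp.norm_apply_le w 2
  have h1 : Real.cos (polar w) = w 2 / ‖w‖ := by
    rw [polar, Real.cos_arccos]
    · rw [le_div_iff₀ hr]; linarith [neg_abs_le (w 2)]
    · rw [div_le_one hr]; linarith [le_abs_self (w 2)]
  have h2 : ‖w‖ * Real.sqrt (1 - (w 2 / ‖w‖) ^ 2) = ‖hor w‖ := by
    rw [← Real.sqrt_sq (norm_nonneg (hor w)), norm_hor_sq,
      show ‖w‖ ^ 2 - w 2 ^ 2 = ‖w‖ ^ 2 * (1 - (w 2 / ‖w‖) ^ 2) by field_simp,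
      Real.sqrt_mul (by positivity), Real.sqrt_sq hr.le]
  have h3 : (‖hor w‖ : ℂ) * Complex.exp (azimuth w * I) = hor w :=
    Complex.norm_mul_exp_arg_mul_I (hor w)
  have h4 : (‖hor w‖ : ℂ) * Complex.exp (-(azimuth w * I)) = (starRingEnd ℂ) (hor w) := by
    rw [← h3, map_mul, Complex.conj_ofReal, ← Complex.exp_conj]
    simp
  set k := m.natAbs with hk
  have hkn : k ≤ n := by rw [Int.abs_eq_natAbs] at hm; omega
  have hf : ((n + k).factorial : ℂ) ≠ 0 := by exact_mod_cast (n + k).factorial_ne_zero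
  have hf' : (n.factorial : ℂ) ≠ 0 := by exact_mod_cast n.factorial_ne_zero
  have h5 : (‖w‖ : ℂ) ^ n = ‖w‖ ^ (n - k) * ‖w‖ ^ k := by
    rw [← pow_add, Nat.sub_add_cancel hkn]
  have h2' : (‖w‖ : ℂ) ^ k * (Real.sqrt (1 - (w 2 / ‖w‖) ^ 2) : ℂ) ^ k = (‖hor w‖ : ℂ) ^ k := by
    rw [← mul_pow, ← h2]; push_cast; rfl
  rw [solidY, sphericalY, h1, assocLegendre, solCoef, ← hk]
  rcases le_or_gt 0 m with h0 | h0
  · have hm' : (m : ℂ) = k := by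
      have : m = k := by omega
      rw [this]; simp
    rw [if_pos h0, show (n + m).toNat = n + k by omega, harm_add_legendre hw hkn, ← h3, mul_pow,
      ← Complex.exp_nat_mul, hm', show I * (k : ℂ) * azimuth w = k * (azimuth w * I) by ring,
      ← h2']
    push_cast
    rw [h5]
    field_simp
  · have hm' : (m : ℂ) = -k := by
      have : m = -k := by omega
      rw [this]; simp
    have h6 : (-(starRingEnd ℂ) (hor w)) ^ k = (-1) ^ k * ((‖w‖ : ℂ) ^ k *
        (Real.sqrt (1 - (w 2 / ‖w‖) ^ 2) : ℂ) ^ k) * Complex.exp (I * m * azimuth w) := by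
      rw [h2', ← h4, neg_pow, mul_pow, ← Complex.exp_nat_mul, hm',
        show I * (-k : ℂ) * azimuth w = k * -(azimuth w * I) by ring]
      ring
    rw [if_neg (not_le.2 h0), show (n + m).toNat = n - k by omega, harm_sub_legendre hw hkn, h6]
    push_cast
    rw [h5]
    field_simp

end HalfSpace

end

/-! ### The Coulomb expansion, by spinors adapted to the centre and Whittaker's integral -/

noncomputable section

namespace HalfSpace

open Polynomial Complex

/-- First component of the spinor of the direction `b`. -/
def spinP (b : Space) : ℝ := Real.sqrt ((‖b‖ + b 2) / (2 * ‖b‖))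

/-- Second component of the spinor of the direction `b`. -/
def spinQ (b : Space) : ℂ := (starRingEnd ℂ) (hor b) / ((2 * spinP b * ‖b‖ : ℝ) : ℂ)

/-- The spinors of the null forms over the direction `b`: first component. -/
def polyS (b : Space) : ℂ[X] := C (spinP b : ℂ) * X + C (spinQ b)

/-- The spinors of the null forms over the direction `b`: second component. -/
def polyT (b : Space) : ℂ[X] := C (-(starRingEnd ℂ) (spinQ b)) * X + C (spinP b : ℂ)

/-- The angular part of the coefficients of the Coulomb expansion. -/
def angCoef (b : Space) (N J : ℕ) : ℂ := (polyS b ^ J * polyT b ^ (2 * N - J)).coeff N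

/-- The coefficients of the expansion of `v ↦ 1 / |b + v|` in solid harmonics. -/
def coulCoef (b : Space) (N J : ℕ) : ℂ := (-1) ^ N * ((‖b‖ : ℂ) ^ (N + 1))⁻¹ * angCoef b N J

variable {b : Space}

lemma norm_pos_of_pos (hb : 0 < b 2) : 0 < ‖b‖ := by
  rw [norm_pos_iff]; rintro rfl; simp at hb

lemma spinP_sq (hb : 0 < b 2) : spinP b ^ 2 = (‖b‖ + b 2) / (2 * ‖b‖) := by
  have := norm_pos_of_pos hb
  rw [spinP, Real.sq_sqrt (by positivity)]

lemma spinP_pos (hb : 0 < b 2) : 0 < spinP b := by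
  have := norm_pos_of_pos hb
  exact Real.sqrt_pos.2 (by positivity)

lemma two_mul_spinP_mul_spinQ (hb : 0 < b 2) :
    2 * (spinP b : ℂ) * spinQ b = (starRingEnd ℂ) (hor b) / (‖b‖ : ℂ) := by
  have h1 : (‖b‖ : ℂ) ≠ 0 := by exact_mod_cast (norm_pos_of_pos hb).ne'
  have h2 : (spinP b : ℂ) ≠ 0 := by exact_mod_cast (spinP_pos hb).ne'
  rw [spinQ]
  push_cast
  field_simp

lemma norm_spinQ_sq (hb : 0 < b 2) : ‖spinQ b‖ ^ 2 = (‖b‖ - b 2) / (2 * ‖b‖) := by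
  have h0 := norm_pos_of_pos hb
  have h1 : 0 < ‖b‖ + b 2 := by positivity
  rw [spinQ, norm_div, Complex.norm_real, RCLike.norm_conj, div_pow, Real.norm_eq_abs, sq_abs,
    norm_hor_sq, mul_pow, mul_pow, spinP_sq hb]
  field_simp
  ring

lemma spinQ_mul_conj (hb : 0 < b 2) :
    spinQ b * (starRingEnd ℂ) (spinQ b) = 1 - (spinP b : ℂ) ^ 2 := by
  have h0 := norm_pos_of_pos hb
  rw [Complex.mul_conj, Complex.normSq_eq_norm_sq, norm_spinQ_sq hb, ← Complex.ofReal_pow,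
    spinP_sq hb]
  norm_cast
  field_simp
  ring

/-- The pair is the image of `(x, 1)` under a unitary matrix with entries `spinP` and `spinQ`. -/
lemma norm_sq_spinor (hb : 0 < b 2) {x : ℂ} (hx : ‖x‖ = 1) :
    ‖(polyS b).eval x‖ ^ 2 + ‖(polyT b).eval x‖ ^ 2 = 2 := by
  have h1 : spinP b ^ 2 + ‖spinQ b‖ ^ 2 = 1 := by
    have h0 := norm_pos_of_pos hb
    rw [spinP_sq hb, norm_spinQ_sq hb]
    field_simp
    ring
  have hx2 : x.re * x.re + x.im * x.im = 1 := by
    have : ‖x‖ ^ 2 = 1 := by rw [hx]; norm_num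
    rwa [← Complex.normSq_eq_norm_sq, Complex.normSq_apply] at this
  simp only [polyS, polyT, eval_add, eval_mul, eval_C, eval_X]
  rw [← Complex.normSq_eq_norm_sq, Complex.normSq_apply] at h1
  rw [← Complex.normSq_eq_norm_sq, ← Complex.normSq_eq_norm_sq, Complex.normSq_apply,
    Complex.normSq_apply]
  simp only [Complex.add_re, Complex.add_im, Complex.mul_re, Complex.mul_im, Complex.ofReal_re,
    Complex.ofReal_im, Complex.neg_re, Complex.neg_im, Complex.conj_re, Complex.conj_im]
  linear_combination (spinP b ^ 2 + (spinQ b).re ^ 2 + (spinQ b).im ^ 2) * hx2 + 2 * h1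

/-- On the unit circle the spinor lies on the sphere over which `wt` is a supremum. This is the
weight by which `norm_harm_le` divides, so the two cancel in every term of the expansion. -/
lemma norm_angCoef_le (hb : 0 < b 2) (N J : ℕ) : ‖angCoef b N J‖ ≤ wt N J := by
  refine norm_coeff_le (fun x hx => ?_) N
  rw [eval_mul, eval_pow, eval_pow]
  exact norm_le_wt N J (norm_sq_spinor hb hx)

/-- The axial component of `v`, with respect to `b`. -/
def axial (b v : Space) : ℝ := (b 0 * v 0 + b 1 * v 1 + b 2 * v 2) / ‖b‖

/-- The transversal component of `v`, with respect to `b`. -/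
def transv (b v : Space) : ℂ :=
  -(spinP b : ℂ) * (starRingEnd ℂ) (spinQ b) * (v 2 : ℝ) +
    ((spinP b : ℂ) ^ 2 * hor v - (starRingEnd ℂ) (spinQ b) ^ 2 * (starRingEnd ℂ) (hor v)) / 2

/-- The unitary change of spinor is a rotation taking the vertical axis to the direction of `b`: in
the new parameter `x` the middle coefficient of the null form is the component along `b`. -/
lemma spinForm_polyS_polyT (hb : 0 < b 2) (v : Space) (x : ℂ) :
    spinForm ((polyS b).eval x) ((polyT b).eval x) v =
      transv b v * x ^ 2 + axial b v * x - (starRingEnd ℂ) (transv b v) := by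
  have h0 := norm_pos_of_pos hb
  have h0' : (‖b‖ : ℂ) ≠ 0 := by exact_mod_cast h0.ne'
  have h1 := two_mul_spinP_mul_spinQ hb
  have h2 := congrArg (starRingEnd ℂ) h1
  simp only [map_mul, Complex.conj_ofReal, map_div₀, Complex.conj_conj, map_ofNat] at h2
  have h3 : (spinP b : ℂ) ^ 2 - spinQ b * (starRingEnd ℂ) (spinQ b) = (b 2 : ℂ) / ‖b‖ := by
    rw [spinQ_mul_conj hb, ← Complex.ofReal_pow, spinP_sq hb]
    push_cast
    field_simp
    ring
  have h4 : (axial b v : ℂ) = ((starRingEnd ℂ) (hor b) / (‖b‖ : ℂ) * hor v +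
      hor b / (‖b‖ : ℂ) * (starRingEnd ℂ) (hor v)) / 2 + (b 2 : ℂ) / ‖b‖ * v 2 := by
    rw [axial]
    have h5 : (starRingEnd ℂ) (hor b) * hor v + hor b * (starRingEnd ℂ) (hor v) =
        2 * ((b 0 * v 0 + b 1 * v 1 : ℝ) : ℂ) := by
      apply Complex.ext <;> simp [hor] <;> ring
    push_cast at h5 ⊢
    field_simp
    linear_combination (-1) * h5
  rw [h4, ← h1, ← h2, ← h3]
  simp only [polyS, polyT, eval_add, eval_mul, eval_neg, eval_C, eval_X, spinForm, transv, map_add, map_mul,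
    map_sub, map_neg, map_pow, map_div₀, map_ofNat, Complex.conj_ofReal, Complex.conj_conj]
  ring

/-- The discriminant of the null form is invariant, because the change of spinor has determinant
one. -/
lemma axial_sq_add (hb : 0 < b 2) (v : Space) :
    axial b v ^ 2 + 4 * ‖transv b v‖ ^ 2 = ‖v‖ ^ 2 := by
  have hdisc : (axial b v : ℂ) ^ 2 + 4 * (transv b v * (starRingEnd ℂ) (transv b v)) =
      ((‖v‖ ^ 2 : ℝ) : ℂ) := by
    have h1 := spinForm_polyS_polyT hb v 1
    have h2 := spinForm_polyS_polyT hb v (-1)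
    have h3 := spinQ_mul_conj hb
    have h4 := hor_mul_conj v
    have h5 : (axial b v : ℂ) = (spinForm ((polyS b).eval 1) ((polyT b).eval 1) v -
      spinForm ((polyS b).eval (-1)) ((polyT b).eval (-1)) v) / 2 := by
      rw [h1, h2]; ring
    rw [h5]
    have h6 : ((‖v‖ ^ 2 : ℝ) : ℂ) = hor v * (starRingEnd ℂ) (hor v) + (v 2 : ℂ) ^ 2 := by
      rw [h4]; push_cast; ring
    rw [h6]
    simp only [polyS, polyT, eval_add, eval_mul, eval_neg, eval_C, eval_X, spinForm, transv, map_add, map_mul,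
      map_sub, map_neg, map_pow, map_div₀, map_ofNat, Complex.conj_ofReal, Complex.conj_conj]
    generalize (starRingEnd ℂ) (spinQ b) = q' at *
    generalize (starRingEnd ℂ) (hor v) = u' at *
    generalize spinQ b = q at *
    generalize (spinP b : ℂ) = p at *
    generalize hor v = u at *
    generalize (v 2 : ℂ) = z at *
    have h7 : p ^ 2 + q * q' = 1 := by rw [h3]; ring
    linear_combination (z ^ 2 + u * u') * (p ^ 2 + q * q' + 1) * h7
  rw [Complex.mul_conj, Complex.normSq_eq_norm_sq] at hdisc
  exact_mod_cast hdisc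

lemma axial_self (hb : 0 < b 2) : axial b b = ‖b‖ := by
  have h0 := norm_pos_of_pos hb
  rw [axial, div_eq_iff h0.ne', show ‖b‖ * ‖b‖ = ‖b‖ ^ 2 by ring, norm_sq_space]; ring

lemma axial_add (b v w : Space) : axial b (v + w) = axial b v + axial b w := by
  simp only [axial, PiLp.add_apply]; ring

lemma abs_axial_le (hb : 0 < b 2) (v : Space) : |axial b v| ≤ ‖v‖ := by
  refine abs_le_of_sq_le_sq ?_ (norm_nonneg v)
  nlinarith [axial_sq_add hb v, sq_nonneg ‖transv b v‖]

open scoped Real in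
/-- Whittaker's integral for the Coulomb potential. -/
lemma circleIntegral_inv_quadratic {β : ℝ} (hβ : 0 < β) (c : ℂ) {ϱ : ℝ} (hϱ : 0 < ϱ)
    (h : β ^ 2 + 4 * ‖c‖ ^ 2 = ϱ ^ 2) :
    (∮ x in C(0, 1), (c * x ^ 2 + β * x - (starRingEnd ℂ) c)⁻¹) = 2 * π * I * (ϱ : ℂ)⁻¹ := by
  set κ : ℝ := (ϱ + β) / 2 with hκ
  have hκ0 : 0 < κ := by positivity
  have hcκ : ‖c‖ < κ := by
    refine lt_of_pow_lt_pow_left₀ 2 hκ0.le ?_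
    rw [hκ]; nlinarith
  have h1 : ‖c‖ ^ 2 = κ ^ 2 - β * κ := by rw [hκ]; nlinarith
  have hcc : c * (starRingEnd ℂ) c = (κ ^ 2 - β * κ : ℝ) := by
    rw [Complex.mul_conj, Complex.normSq_eq_norm_sq, h1]
  have hκc : (κ : ℂ) ≠ 0 := by exact_mod_cast hκ0.ne'
  have hne : ∀ x : ℂ, ‖x‖ ≤ 1 → c * x + κ ≠ 0 := by
    intro x hx h0
    have h2 : ‖c * x‖ = κ := by
      rw [eq_neg_of_add_eq_zero_left h0, norm_neg, Complex.norm_of_nonneg hκ0.le]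
    rw [norm_mul] at h2
    nlinarith [norm_nonneg c, norm_nonneg x]
  -- The quadratic factors with one zero inside the unit disc, while `cx + κ` has no zero in its
  -- closure. Cauchy's formula then evaluates the second factor at the inner zero.
  have h2 : ∀ x : ℂ, (c * x ^ 2 + β * x - (starRingEnd ℂ) c)⁻¹ =
      (x - (starRingEnd ℂ) c / κ)⁻¹ • (c * x + κ)⁻¹ := by
    intro x
    rw [smul_eq_mul, ← mul_inv]
    congr 1
    push_cast at hcc
    field_simp
    linear_combination (x) * hcc
  simp only [h2]
  have hd : DiffContOnCl ℂ (fun x : ℂ => (c * x + κ)⁻¹) (Metric.ball 0 1) := by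
    refine DifferentiableOn.diffContOnCl fun x hx => ?_
    rw [closure_ball _ one_ne_zero, mem_closedBall_zero_iff] at hx
    exact (DifferentiableAt.inv (h := fun x : ℂ => c * x + κ) (by fun_prop) (hne x hx)).differentiableWithinAt
  have hmem : (starRingEnd ℂ) c / κ ∈ Metric.ball (0 : ℂ) 1 := by
    rw [mem_ball_zero_iff, norm_div, RCLike.norm_conj, Complex.norm_of_nonneg hκ0.le]
    exact (div_lt_one hκ0).2 hcκ
  rw [hd.circleIntegral_sub_inv_smul hmem, smul_eq_mul]
  congr 2
  have h3 : c * ((starRingEnd ℂ) c / κ) = ((κ ^ 2 - β * κ : ℝ) : ℂ) / κ := by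
    rw [← hcc]; ring
  rw [h3]
  have h4 : ϱ = 2 * κ - β := by rw [hκ]; ring
  rw [h4]
  push_cast
  field_simp
  ring

open scoped Real in
lemma circleIntegral_pow_div (f : ℂ[X]) (N : ℕ) :
    (∮ x in C(0, 1), f.eval x * (x ^ (N + 1))⁻¹) = 2 * π * I * f.coeff N := by
  have h1 : ∀ i : ℕ, (∮ x in C((0 : ℂ), 1), x ^ i * (x ^ (N + 1))⁻¹) =
      if i = N then 2 * π * I else 0 := by
    intro i
    have h2 : Set.EqOn (fun x : ℂ => x ^ i * (x ^ (N + 1))⁻¹)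
        (fun x => (x - 0) ^ ((i : ℤ) - (N + 1 : ℕ))) (Metric.sphere 0 1) := by
      intro x hx
      have hx0 : x ≠ 0 := by rintro rfl; simp at hx
      simp only [sub_zero]
      rw [zpow_sub₀ hx0, zpow_natCast, zpow_natCast, div_eq_mul_inv]
    rw [circleIntegral.integral_congr zero_le_one h2]
    split_ifs with hi
    · subst hi
      rw [show ((i : ℤ) - (i + 1 : ℕ)) = -1 by push_cast; ring]
      simp only [zpow_neg_one]
      exact circleIntegral.integral_sub_center_inv 0 one_ne_zero
    · exact circleIntegral.integral_sub_zpow_of_ne (by push_cast; omega) _ _ _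
  have h3 : ∀ x : ℂ, f.eval x * (x ^ (N + 1))⁻¹ = ∑ i ∈ Finset.range (f.natDegree + 1),
      f.coeff i * (x ^ i * (x ^ (N + 1))⁻¹) := by
    intro x
    rw [eval_eq_sum_range, Finset.sum_mul]
    exact Finset.sum_congr rfl fun i _ => by ring
  simp only [h3]
  rw [circleIntegral.integral_fun_sum]
  · simp only [circleIntegral.integral_const_mul, h1]
    rw [Finset.sum_eq_single N]
    · simp; ring
    · intro i _ hi; simp [hi]
    · intro hN
      rw [coeff_eq_zero_of_natDegree_lt (by simp at hN; omega)]; simp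
  · intro i _
    refine ContinuousOn.circleIntegrable zero_le_one ?_
    refine continuousOn_const.mul ((continuousOn_pow _).mul (ContinuousOn.inv₀ (by fun_prop) ?_))
    intro x hx
    have hx0 : x ≠ 0 := by rintro rfl; simp at hx
    exact pow_ne_zero _ hx0

open scoped Real in
/-- The expansion of the Coulomb potential in solid harmonics. -/
lemma hasSum_coulomb (hb : 0 < b 2) {v : Space} (hv : ‖v‖ < ‖b‖) :
    HasSum (fun N => ∑ J ∈ Finset.range (2 * N + 1), coulCoef b N J * harm N J v)
      ((‖b + v‖⁻¹ : ℝ) : ℂ) := by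
  have h0 := norm_pos_of_pos hb
  have h0' : (‖b‖ : ℂ) ≠ 0 := by exact_mod_cast h0.ne'
  have hbv : b + v ≠ 0 := by
    intro h
    rw [eq_neg_of_add_eq_zero_left h, norm_neg] at hv
    exact lt_irrefl _ hv
  set e : ℂ → ℂ := fun x => spinForm ((polyS b).eval x) ((polyT b).eval x) v with he
  set F : ℕ → ℂ → ℂ := fun N x => (-1) ^ N * ((‖b‖ : ℂ) ^ (N + 1))⁻¹ *
    (e x ^ N * (x ^ (N + 1))⁻¹) with hF
  set E : ℕ → ℂ[X] := fun N => ∑ J ∈ Finset.range (2 * N + 1),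
    C (harm N J v) * (polyS b ^ J * polyT b ^ (2 * N - J)) with hE
  have heE : ∀ N x, e x ^ N = (E N).eval x := by
    intro N x
    simp only [he, hE, spinForm_pow, eval_finsetSum, eval_mul, eval_pow, eval_C]
  have heb : ∀ x : ℂ, spinForm ((polyS b).eval x) ((polyT b).eval x) b = ‖b‖ * x := by
    intro x
    have h1 := axial_sq_add hb b
    rw [axial_self hb] at h1
    have h2 : transv b b = 0 := by
      rw [← norm_eq_zero, ← sq_eq_zero_iff]; linarith
    rw [spinForm_polyS_polyT hb, axial_self hb, h2]
    simp
  have hnorm : ∀ x : ℂ, ‖x‖ = 1 → ‖e x‖ ≤ ‖v‖ := fun x hx =>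
    norm_spinForm_le (norm_sq_spinor hb hx) v
  -- The null form of `b + v` is `‖b‖ x` plus that of `v`, which is at most `‖v‖ < ‖b‖` in modulus:
  -- a geometric series, dominated uniformly on the circle.
  have hsum : ∀ x : ℂ, ‖x‖ = 1 → HasSum (fun N => F N x)
      (transv b (b + v) * x ^ 2 + axial b (b + v) * x - (starRingEnd ℂ) (transv b (b + v)))⁻¹ := by
    intro x hx
    have hx0 : x ≠ 0 := by rintro rfl; simp at hx
    rw [← spinForm_polyS_polyT hb, spinForm_add, heb]
    change HasSum _ (‖b‖ * x + e x)⁻¹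
    have h1 : ‖-e x / (‖b‖ * x)‖ < 1 := by
      rw [norm_div, norm_neg, norm_mul, hx, mul_one, Complex.norm_of_nonneg h0.le, div_lt_one h0]
      exact (hnorm x hx).trans_lt hv
    have h2 := (hasSum_geometric_of_norm_lt_one h1).mul_left ((‖b‖ * x : ℂ)⁻¹)
    have h3 : (‖b‖ * x : ℂ) + e x ≠ 0 := by
      intro h
      have h4 : ‖e x‖ = ‖b‖ := by
        rw [eq_neg_of_add_eq_zero_right h, norm_neg, norm_mul, hx, mul_one,
          Complex.norm_of_nonneg h0.le]
      linarith [hnorm x hx]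
    have h4 : (fun N => F N x) = fun i => (‖b‖ * x : ℂ)⁻¹ * (-e x / (‖b‖ * x)) ^ i := by
      funext N
      simp only [hF]
      rw [div_pow, neg_pow (e x), mul_pow]
      field_simp
      ring
    have h5 : (‖b‖ * x + e x)⁻¹ = (‖b‖ * x : ℂ)⁻¹ * (1 - -e x / (‖b‖ * x))⁻¹ := by
      rw [← mul_inv]
      congr 1
      field_simp
      ring
    rw [h4, h5]
    exact h2
  have hterm : ∀ N, (∮ x in C(0, 1), F N x) =
      2 * π * I * ∑ J ∈ Finset.range (2 * N + 1), coulCoef b N J * harm N J v := by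
    intro N
    simp only [hF, heE]
    rw [circleIntegral.integral_const_mul, circleIntegral_pow_div]
    simp only [hE, finsetSum_coeff, coeff_C_mul, coulCoef, angCoef, Finset.mul_sum]
    exact Finset.sum_congr rfl fun J _ => by ring
  have hcont : ∀ N, Continuous fun θ : ℝ => F N (circleMap 0 1 θ) := by
    intro N
    simp only [hF, heE]
    have h1 : ∀ θ : ℝ, circleMap 0 1 θ ^ (N + 1) ≠ 0 := fun θ => pow_ne_zero _ (by simp)
    have h2 : Continuous fun θ : ℝ => (circleMap 0 1 θ ^ (N + 1))⁻¹ :=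
      Continuous.inv₀ (by fun_prop) h1
    have h3 : Continuous fun θ : ℝ => (E N).eval (circleMap 0 1 θ) :=
      (E N).continuous.comp (continuous_circleMap 0 1)
    exact continuous_const.mul (h3.mul h2)
  have hint : HasSum (fun N => ∮ x in C(0, 1), F N x) (∮ x in C(0, 1),
      (transv b (b + v) * x ^ 2 + axial b (b + v) * x -
        (starRingEnd ℂ) (transv b (b + v)))⁻¹) := by
    have hr : ‖v‖ / ‖b‖ < 1 := (div_lt_one h0).2 hv
    have hunit : ∀ θ : ℝ, ‖circleMap 0 1 θ‖ = 1 := fun θ => by simp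
    have hgeo : Summable fun N : ℕ => ‖b‖⁻¹ * (‖v‖ / ‖b‖) ^ N :=
      (summable_geometric_of_lt_one (by positivity) hr).mul_left _
    refine intervalIntegral.hasSum_integral_of_dominated_convergence
      (fun N _ => ‖b‖⁻¹ * (‖v‖ / ‖b‖) ^ N) (fun N => ?_) (fun N => ?_) ?_ ?_ ?_
    · refine Continuous.aestronglyMeasurable ?_
      simp only [deriv_circleMap]
      exact ((continuous_circleMap 0 1).mul continuous_const).smul (hcont N)
    · refine Filter.Eventually.of_forall fun θ _ => ?_
      simp only [hF]
      rw [norm_smul, deriv_circleMap, norm_mul, hunit, Complex.norm_I, one_mul, one_mul, norm_mul,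
        norm_mul, norm_mul, norm_pow, norm_neg, norm_one, one_pow, one_mul, norm_inv, norm_inv,
        norm_pow, norm_pow, norm_pow, hunit, one_pow, inv_one, mul_one,
        Complex.norm_of_nonneg h0.le, div_pow]
      have : ‖e (circleMap 0 1 θ)‖ ^ N ≤ ‖v‖ ^ N :=
        pow_le_pow_left₀ (norm_nonneg _) (hnorm _ (hunit θ)) N
      calc (‖b‖ ^ (N + 1))⁻¹ * ‖e (circleMap 0 1 θ)‖ ^ N
          ≤ (‖b‖ ^ (N + 1))⁻¹ * ‖v‖ ^ N := by gcongr
        _ = ‖b‖⁻¹ * (‖v‖ ^ N / ‖b‖ ^ N) := by rw [pow_succ]; field_simp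
    · exact Filter.Eventually.of_forall fun θ _ => hgeo
    · exact intervalIntegrable_const
    · exact Filter.Eventually.of_forall fun θ _ => (hsum _ (hunit θ)).const_smul _
  -- Whittaker's integral in the frame of `b` needs a positive component along `b`.
  have hpos : 0 < axial b (b + v) := by
    rw [axial_add, axial_self hb]
    linarith [neg_abs_le (axial b v), abs_axial_le hb v]
  rw [circleIntegral_inv_quadratic hpos _ (norm_pos_iff.2 hbv) (axial_sq_add hb _)] at hint
  simp only [hterm] at hint
  have h2 : (2 * π * I : ℂ) ≠ 0 := by simp [Real.pi_ne_zero]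
  have h3 := hint.mul_left ((2 * π * I : ℂ)⁻¹)
  simp only [inv_mul_cancel_left₀ h2] at h3
  rw [Complex.ofReal_inv]
  exact h3

lemma norm_coulCoef_le (hb : 0 < b 2) (N J : ℕ) :
    ‖coulCoef b N J‖ ≤ (‖b‖ ^ (N + 1))⁻¹ * wt N J := by
  have h0 := norm_pos_of_pos hb
  rw [coulCoef, norm_mul, norm_mul, norm_pow, norm_neg, norm_one, one_pow, one_mul, norm_inv,
    norm_pow, Complex.norm_of_nonneg h0.le]
  exact mul_le_mul_of_nonneg_left (norm_angCoef_le hb N J) (by positivity)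

end HalfSpace

end

/-! ### Vertical derivatives of `𝓑` and behaviour along upward rays -/

noncomputable section

namespace HalfSpace

open Polynomial Complex MeasureTheory

/-- The upward unit vector. -/
def up : Space := EuclideanSpace.single 2 1

@[simp] lemma up_zero : up 0 = 0 := by simp [up]
@[simp] lemma up_one : up 1 = 0 := by simp [up]
@[simp] lemma up_two : up 2 = 1 := by simp [up]
@[simp] lemma norm_up : ‖up‖ = 1 := by simp [up]
@[simp] lemma hor_up : hor up = 0 := by apply Complex.ext <;> simp [hor]

lemma norm_sq_add_up (w : Space) (τ : ℝ) :
    ‖w + τ • up‖ ^ 2 = ‖w‖ ^ 2 + 2 * τ * w 2 + τ ^ 2 := by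
  rw [norm_sq_space, norm_sq_space]
  simp
  ring

lemma reg_add_up {w : Space} (h : 0 < ‖w‖ + w 2) {τ : ℝ} (hτ : 0 ≤ τ) :
    0 < ‖w + τ • up‖ + (w + τ • up) 2 := by
  have h1 : ‖w‖ ≤ ‖w + τ • up‖ + τ := by
    have := norm_sub_le (w + τ • up) (τ • up)
    rwa [add_sub_cancel_right, norm_smul, norm_up, mul_one, Real.norm_of_nonneg hτ] at this
  simp only [PiLp.add_apply, PiLp.smul_apply, up_two, smul_eq_mul, mul_one]
  linarith

lemma norm_pos_of_reg {w : Space} (h : 0 < ‖w‖ + w 2) : 0 < ‖w‖ := by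
  rw [norm_pos_iff]; rintro rfl; simp at h

/-- The logarithm is singular only on the closed downward vertical ray from the origin. For `b` in
the upper half-space the nearest point of this ray is the origin, so the expansion of `𝓑` can have
the same radius as the Coulomb expansion. -/
lemma reg_add {b v : Space} (hb : 0 < b 2) (hv : ‖v‖ < ‖b‖) : 0 < ‖b + v‖ + (b + v) 2 := by
  by_contra hcon
  push Not at hcon
  have h1 := norm_sq_space (b + v)
  have h2 := norm_sq_space v
  have h3 := norm_sq_space b
  simp only [PiLp.add_apply] at h1 hcon
  set x := b 0 + v 0 with hx
  set y := b 1 + v 1 with hy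
  set z := b 2 + v 2 with hz
  have h5 : ‖b + v‖ ^ 2 ≤ z ^ 2 := by
    have := norm_nonneg (b + v)
    nlinarith
  have hx0 : x = 0 := by nlinarith [sq_nonneg x, sq_nonneg y]
  have hy0 : y = 0 := by nlinarith [sq_nonneg x, sq_nonneg y]
  have hz0 : z ≤ 0 := by linarith [norm_nonneg (b + v)]
  have e0 : v 0 = - b 0 := by linarith
  have e1 : v 1 = - b 1 := by linarith
  have e2 : v 2 = z - b 2 := by linarith
  rw [e0, e1, e2] at h2
  have : ‖v‖ ^ 2 < ‖b‖ ^ 2 := by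
    have := norm_nonneg v
    nlinarith
  nlinarith [sq_nonneg z]

lemma hasDerivAt_norm_up {w : Space} {τ : ℝ} (h : 0 < ‖w + τ • up‖) :
    HasDerivAt (fun τ : ℝ => ‖w + τ • up‖) ((w 2 + τ) / ‖w + τ • up‖) τ := by
  have h1 : (fun τ : ℝ => ‖w + τ • up‖) =
      fun τ => Real.sqrt (‖w‖ ^ 2 + 2 * τ * w 2 + τ ^ 2) := by
    funext τ
    rw [← norm_sq_add_up, Real.sqrt_sq (norm_nonneg _)]
  have h2 : HasDerivAt (fun τ : ℝ => ‖w‖ ^ 2 + 2 * τ * w 2 + τ ^ 2) (2 * w 2 + 2 * τ) τ := by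
    have h3 := (((hasDerivAt_id τ).const_mul 2).mul_const (w 2)).const_add (‖w‖ ^ 2)
    refine (h3.add (hasDerivAt_pow 2 τ)).congr_deriv ?_
    simp
  have h4 := h2.sqrt (by rw [← norm_sq_add_up]; positivity)
  rw [← h1, ← norm_sq_add_up, Real.sqrt_sq (norm_nonneg _)] at h4
  convert h4 using 1
  field_simp

lemma hasDerivAt_reg_up {w : Space} {τ : ℝ} (h : 0 < ‖w + τ • up‖ + (w + τ • up) 2) :
    HasDerivAt (fun τ : ℝ => ‖w + τ • up‖ + (w + τ • up) 2)
      ((‖w + τ • up‖ + (w + τ • up) 2) / ‖w + τ • up‖) τ := by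
  have h0 := norm_pos_of_reg h
  have h1 := (hasDerivAt_norm_up h0).add ((hasDerivAt_id τ).const_add (w 2))
  simp only [PiLp.add_apply, PiLp.smul_apply, up_two, smul_eq_mul, mul_one]
  refine h1.congr_deriv ?_
  field_simp
  ring

lemma hasDerivAt_log_up {w : Space} {τ : ℝ} (h : 0 < ‖w + τ • up‖ + (w + τ • up) 2) :
    HasDerivAt (fun τ : ℝ => Real.log (‖w + τ • up‖ + (w + τ • up) 2)) (‖w + τ • up‖⁻¹) τ := by
  have h0 := norm_pos_of_reg h
  refine ((hasDerivAt_reg_up h).log h.ne').congr_deriv ?_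
  field_simp

/-- With `hasDerivAt_log_up`, this makes `𝓑` a double vertical antiderivative of the Coulomb
potential. -/
lemma hasDerivAt_potB_up {w : Space} {τ : ℝ} (h : 0 < ‖w + τ • up‖ + (w + τ • up) 2) :
    HasDerivAt (fun τ : ℝ => potB (w + τ • up))
      (Real.log (‖w + τ • up‖ + (w + τ • up) 2)) τ := by
  have h0 := norm_pos_of_reg h
  have h1 : HasDerivAt (fun τ : ℝ => (w + τ • up) 2) 1 τ := by
    simp only [PiLp.add_apply, PiLp.smul_apply, up_two, smul_eq_mul, mul_one]
    exact (hasDerivAt_id τ).const_add (w 2)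
  have h2 := (h1.mul (hasDerivAt_log_up h)).sub (hasDerivAt_norm_up h0)
  refine h2.congr_deriv ?_
  simp only [PiLp.add_apply, PiLp.smul_apply, up_two, smul_eq_mul, mul_one]
  field_simp
  ring

/-- The linear part of `potB (b + v)` in `v`. -/
def potBLin (b v : Space) : ℝ :=
  v 2 * Real.log (‖b‖ + b 2) - (b 0 * v 0 + b 1 * v 1) / (‖b‖ + b 2)

/-- The vertical derivative of `potBLin`. -/
def potBLin' (b v : Space) : ℝ :=
  v 2 / ‖b‖ + (b 0 * v 0 + b 1 * v 1) / (‖b‖ * (‖b‖ + b 2))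

variable {b v : Space}

lemma hasDerivAt_potBLin_up {τ : ℝ} (h : 0 < ‖b + τ • up‖ + (b + τ • up) 2) :
    HasDerivAt (fun τ : ℝ => potBLin (b + τ • up) v) (potBLin' (b + τ • up) v) τ := by
  have h0 := norm_pos_of_reg h
  have h1 := ((hasDerivAt_log_up h).const_mul (v 2)).sub
    (((hasDerivAt_reg_up h).inv h.ne').const_mul (b 0 * v 0 + b 1 * v 1))
  have h2 : (fun τ : ℝ => potBLin (b + τ • up) v) = fun τ : ℝ =>
      v 2 * Real.log (‖b + τ • up‖ + (b + τ • up) 2) -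
      (b 0 * v 0 + b 1 * v 1) * (‖b + τ • up‖ + (b + τ • up) 2)⁻¹ := by
    funext τ
    simp [potBLin, div_eq_mul_inv]
  rw [h2]
  refine h1.congr_deriv ?_
  have e0 : (b + τ • up) 0 = b 0 := by simp
  have e1 : (b + τ • up) 1 = b 1 := by simp
  rw [potBLin', e0, e1]
  field_simp
  ring

lemma hasDerivAt_potBLin'_up {τ : ℝ} (h : 0 < ‖b + τ • up‖ + (b + τ • up) 2) :
    HasDerivAt (fun τ : ℝ => potBLin' (b + τ • up) v)
      (-(axial (b + τ • up) v / ‖b + τ • up‖ ^ 2)) τ := by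
  have h0 := norm_pos_of_reg h
  have h1 := (((hasDerivAt_norm_up h0).inv h0.ne').const_mul (v 2)).add
    ((((hasDerivAt_norm_up h0).mul (hasDerivAt_reg_up h)).inv (mul_pos h0 h).ne').const_mul
      (b 0 * v 0 + b 1 * v 1))
  have h2 : (fun τ : ℝ => potBLin' (b + τ • up) v) = fun τ : ℝ =>
      v 2 * ‖b + τ • up‖⁻¹ +
      (b 0 * v 0 + b 1 * v 1) * (‖b + τ • up‖ * (‖b + τ • up‖ + (b + τ • up) 2))⁻¹ := by
    funext τ
    simp [potBLin', div_eq_mul_inv]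
  rw [h2]
  refine h1.congr_deriv ?_
  have e0 : (b + τ • up) 0 = b 0 := by simp
  have e1 : (b + τ • up) 1 = b 1 := by simp
  have e2 : b 2 + τ = (b + τ • up) 2 := by simp
  rw [axial, e0, e1, e2]
  simp only [Pi.mul_apply]
  generalize ‖b + τ • up‖ = n at *
  generalize (b + τ • up) 2 = z at *
  field_simp
  ring

/-- The remainder of first order of `potB`. -/
def potBRem (b v : Space) : ℝ := potB (b + v) - potB b - potBLin b v

/-- The vertical derivative of `potBRem`. -/
def potBRem' (b v : Space) : ℝ :=
  Real.log (‖b + v‖ + (b + v) 2) - Real.log (‖b‖ + b 2) - potBLin' b v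

lemma hasDerivAt_potBRem_up {τ : ℝ} (h : 0 < ‖b + τ • up‖ + (b + τ • up) 2)
    (h' : 0 < ‖b + τ • up + v‖ + (b + τ • up + v) 2) :
    HasDerivAt (fun τ : ℝ => potBRem (b + τ • up) v) (potBRem' (b + τ • up) v) τ := by
  have e : ∀ τ : ℝ, b + τ • up + v = (b + v) + τ • up := fun τ => by abel
  simp only [e, potBRem, potBRem'] at h' ⊢
  exact ((hasDerivAt_potB_up h').sub (hasDerivAt_potB_up h)).sub (hasDerivAt_potBLin_up h)

lemma hasDerivAt_potBRem'_up {τ : ℝ} (h : 0 < ‖b + τ • up‖ + (b + τ • up) 2)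
    (h' : 0 < ‖b + τ • up + v‖ + (b + τ • up + v) 2) :
    HasDerivAt (fun τ : ℝ => potBRem' (b + τ • up) v)
      (‖b + τ • up + v‖⁻¹ - ‖b + τ • up‖⁻¹ + axial (b + τ • up) v / ‖b + τ • up‖ ^ 2) τ := by
  have e : ∀ τ : ℝ, b + τ • up + v = (b + v) + τ • up := fun τ => by abel
  simp only [e, potBRem'] at h' ⊢
  refine (((hasDerivAt_log_up h').sub (hasDerivAt_log_up h)).sub
    (hasDerivAt_potBLin'_up h)).congr_deriv ?_
  ring

lemma norm_le_norm_up (hb : 0 < b 2) {τ : ℝ} (hτ : 0 ≤ τ) :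
    ‖b‖ ^ 2 + τ ^ 2 ≤ ‖b + τ • up‖ ^ 2 := by
  rw [norm_sq_add_up]; nlinarith [mul_nonneg hτ hb.le]

open Filter Topology in
lemma tendsto_norm_up_div (w : Space) :
    Tendsto (fun τ : ℝ => ‖w + τ • up‖ / τ) atTop (𝓝 1) := by
  have h1 : Tendsto (fun τ : ℝ => ‖τ⁻¹ • w + up‖) atTop (𝓝 ‖(0 : ℝ) • w + up‖) :=
    ((tendsto_inv_atTop_zero.smul_const w).add_const up).norm
  rw [zero_smul, zero_add, norm_up] at h1
  refine h1.congr' ?_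
  filter_upwards [eventually_gt_atTop 0] with τ hτ
  rw [show w + τ • up = τ • (τ⁻¹ • w + up) by rw [smul_add, smul_inv_smul₀ hτ.ne'], norm_smul,
    Real.norm_of_nonneg hτ.le, mul_div_cancel_left₀ _ hτ.ne']

open Filter Topology in
lemma tendsto_reg_up_div (w : Space) :
    Tendsto (fun τ : ℝ => (‖w + τ • up‖ + (w + τ • up) 2) / τ) atTop (𝓝 2) := by
  have h1 := (tendsto_norm_up_div w).add ((tendsto_inv_atTop_zero.const_mul (w 2)).add_const 1)
  rw [mul_zero, zero_add, one_add_one_eq_two] at h1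
  refine h1.congr' ?_
  filter_upwards [eventually_gt_atTop 0] with τ hτ
  simp
  field_simp

open Filter Topology in
lemma tendsto_inv_reg_up (w : Space) :
    Tendsto (fun τ : ℝ => (‖w + τ • up‖ + (w + τ • up) 2)⁻¹) atTop (𝓝 0) := by
  have h1 := tendsto_inv_atTop_zero.mul ((tendsto_reg_up_div w).inv₀ two_ne_zero)
  rw [zero_mul] at h1
  refine h1.congr' ?_
  filter_upwards [eventually_gt_atTop 0] with τ hτ
  rw [inv_div, ← mul_div_assoc, inv_mul_cancel₀ hτ.ne', one_div]

open Filter Topology in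
lemma tendsto_norm_up_sub (b v : Space) :
    Tendsto (fun τ : ℝ => ‖b + v + τ • up‖ - ‖b + τ • up‖) atTop (𝓝 (v 2)) := by
  have h1 := ((tendsto_inv_atTop_zero.const_mul (‖b + v‖ ^ 2 - ‖b‖ ^ 2)).add_const (2 * v 2)).div
    ((tendsto_norm_up_div (b + v)).add (tendsto_norm_up_div b)) (by norm_num)
  rw [mul_zero, zero_add, one_add_one_eq_two, mul_div_cancel_left₀ _ two_ne_zero] at h1
  refine h1.congr' ?_
  have h2 := (tendsto_norm_up_div (b + v)).eventually (lt_mem_nhds zero_lt_one)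
  filter_upwards [eventually_gt_atTop 0, h2] with τ hτ h2
  have h3 : 0 < ‖b + v + τ • up‖ := by
    by_contra hcon
    exact absurd h2 (not_lt.2 (div_nonpos_of_nonpos_of_nonneg (not_lt.1 hcon) hτ.le))
  have h4 := norm_sq_add_up (b + v) τ
  have h5 := norm_sq_add_up b τ
  have h6 := norm_nonneg (b + τ • up)
  simp only [PiLp.add_apply] at h4
  simp only [Pi.div_apply]
  rw [← add_div, div_div_eq_mul_div, div_eq_iff (by positivity)]
  field_simp
  linear_combination h5 - h4

open Filter Topology in
-- The boundary term at infinity when the Coulomb remainder is integrated twice. The products of `τ`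
-- with logarithms cancel between the two summands, and what is left converges termwise, with limits
-- adding to zero.
lemma tendsto_potBRem (hb : 0 < b 2) (hv : ‖v‖ < ‖b‖) :
    Tendsto (fun τ : ℝ => τ * potBRem' (b + τ • up) v - potBRem (b + τ • up) v) atTop (𝓝 0) := by
  have hrb : 0 < ‖b‖ + b 2 := by positivity
  have hrv := reg_add hb hv
  have h1 : Tendsto (fun τ : ℝ => Real.log (‖b + v + τ • up‖ + (b + v + τ • up) 2) -
      Real.log (‖b + τ • up‖ + (b + τ • up) 2)) atTop (𝓝 0) := by
    have h2 := ((tendsto_reg_up_div (b + v)).div (tendsto_reg_up_div b) two_ne_zero).log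
      (by norm_num)
    rw [div_self two_ne_zero, Real.log_one] at h2
    refine h2.congr' ?_
    filter_upwards [eventually_gt_atTop 0] with τ hτ
    simp only [Pi.div_apply]
    rw [div_div_div_cancel_right₀ hτ.ne',
      Real.log_div (reg_add_up hrv hτ.le).ne' (reg_add_up hrb hτ.le).ne']
  have h2 : Tendsto (fun τ : ℝ => τ / ‖b + τ • up‖) atTop (𝓝 1) := by
    have := (tendsto_norm_up_div b).inv₀ one_ne_zero
    simpa using this
  have h3 := tendsto_inv_reg_up b
  have h4 := (((h1.const_mul (-b 2 - v 2)).add (tendsto_norm_up_sub b v)).sub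
    (h2.const_mul (v 2))).sub (((h2.mul h3).add h3).const_mul (b 0 * v 0 + b 1 * v 1))
  have h5 : (-b 2 - v 2) * 0 + v 2 - v 2 * 1 - (b 0 * v 0 + b 1 * v 1) * (1 * 0 + 0) = 0 := by ring
  rw [h5] at h4
  refine h4.congr' ?_
  filter_upwards [eventually_gt_atTop 0] with τ hτ
  have e : b + τ • up + v = (b + v) + τ • up := by abel
  have e0 : (b + τ • up) 0 = b 0 := by simp
  have e1 : (b + τ • up) 1 = b 1 := by simp
  have e2 : (b + τ • up) 2 = b 2 + τ := by simp
  have e3 : (b + v + τ • up) 2 = b 2 + v 2 + τ := by simp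
  have h6 := reg_add_up hrb hτ.le
  have h7 := norm_pos_of_reg h6
  simp only [potBRem, potBRem', potB, potBLin, potBLin', e]
  rw [e0, e1, e2, e3]
  rw [e2] at h6
  field_simp
  ring

lemma continuousOn_of_pos_up {f : Space → ℂ} (hf : ContinuousOn f {w | 0 < w 2}) (hb : 0 < b 2) :
    ContinuousOn (fun τ : ℝ => f (b + τ • up)) (Set.Ioi 0) := by
  refine hf.comp (by fun_prop) fun τ hτ => ?_
  have : (0 : ℝ) < τ := hτ
  simp only [Set.mem_ofPred_eq, PiLp.add_apply, PiLp.smul_apply, up_two, smul_eq_mul, mul_one]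
  positivity

/-- Needed for measurability of the integrals over `τ`. Fourier inversion with a number of nodes
independent of `w` reduces it to continuity of the spinor. -/
lemma continuousOn_coulCoef (N J : ℕ) :
    ContinuousOn (fun w : Space => coulCoef w N J) {w | 0 < w 2} := by
  have h0 : ∀ w ∈ {w : Space | 0 < w 2}, ‖w‖ ≠ 0 := fun w hw => (norm_pos_of_pos hw).ne'
  have hP : ContinuousOn spinP {w | 0 < w 2} := by
    unfold spinP
    refine ContinuousOn.sqrt (ContinuousOn.div (by fun_prop) (by fun_prop) fun w hw => ?_)
    exact mul_ne_zero two_ne_zero (h0 w hw)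
  have hQ : ContinuousOn spinQ {w | 0 < w 2} := by
    unfold spinQ
    have h1 : Continuous fun w : Space => hor w := by
      have : (fun w : Space => hor w) = fun w => ((w 0 : ℝ) : ℂ) + ((w 1 : ℝ) : ℂ) * I := by
        funext w; apply Complex.ext <;> simp [hor]
      rw [this]; fun_prop
    refine ContinuousOn.div ((Complex.continuous_conj.comp h1).continuousOn) ?_ fun w hw => ?_
    · exact Complex.continuous_ofReal.comp_continuousOn
        ((continuousOn_const.mul hP).mul continuous_norm.continuousOn)
    · have := spinP_pos hw
      have := norm_pos_of_pos hw
      exact_mod_cast (by positivity : 2 * spinP w * ‖w‖ ≠ 0)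
  have hg : ContinuousOn (fun w : Space => angCoef w N J) {w | 0 < w 2} := by
    have h1 : ∀ w : Space, (polyS w ^ J * polyT w ^ (2 * N - J)).natDegree < J + 2 * N + 1 := by
      intro w
      have hS : (polyS w).natDegree ≤ 1 := natDegree_linear_le
      have hT : (polyT w).natDegree ≤ 1 := natDegree_linear_le
      have h2 := natDegree_mul_le (p := polyS w ^ J) (q := polyT w ^ (2 * N - J))
      have h3 := natDegree_pow_le_of_le J hS
      have h4 := natDegree_pow_le_of_le (2 * N - J) hT
      omega
    have h2 : (fun w : Space => angCoef w N J) = fun w => ((J + 2 * N + 1 : ℕ) : ℂ)⁻¹ *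
        ∑ l ∈ Finset.range (J + 2 * N + 1), ((rootU (J + 2 * N + 1) ^ l) ^ N)⁻¹ *
          (polyS w ^ J * polyT w ^ (2 * N - J)).eval (rootU (J + 2 * N + 1) ^ l) := by
      funext w
      exact coeff_eq_sum_rootU _ (h1 w) (by omega)
    rw [h2]
    refine continuousOn_const.mul (continuousOn_finsetSum _ fun l _ => continuousOn_const.mul ?_)
    simp only [polyS, polyT, eval_mul, eval_pow, eval_add, eval_C, eval_X]
    have hP' := Complex.continuous_ofReal.comp_continuousOn hP
    have hQ' := Complex.continuous_conj.comp_continuousOn hQ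
    exact (((hP'.mul continuousOn_const).add hQ).pow J).mul
      (((hQ'.neg.mul continuousOn_const).add hP').pow _)
  unfold coulCoef
  refine (continuousOn_const.mul (ContinuousOn.inv₀ ?_ ?_)).mul hg
  · exact (Complex.continuous_ofReal.comp continuous_norm).continuousOn.pow _
  · exact fun w hw => pow_ne_zero _ (by exact_mod_cast h0 w hw)

lemma sum_coulCoef_zero (b v : Space) :
    ∑ J ∈ Finset.range (2 * 0 + 1), coulCoef b 0 J * harm 0 J v = ((‖b‖⁻¹ : ℝ) : ℂ) := by
  simp [coulCoef, angCoef, harm]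

lemma sum_coulCoef_one (hb : 0 < b 2) :
    ∑ J ∈ Finset.range (2 * 1 + 1), coulCoef b 1 J * harm 1 J v =
      ((-(axial b v / ‖b‖ ^ 2) : ℝ) : ℂ) := by
  have h1 : ∑ J ∈ Finset.range (2 * 1 + 1), angCoef b 1 J * harm 1 J v = axial b v := by
    have h2 : ∑ J ∈ Finset.range (2 * 1 + 1), C (harm 1 J v) * (polyS b ^ J * polyT b ^ (2 * 1 - J)) =
        quadPoly (-(starRingEnd ℂ) (transv b v)) (axial b v) (transv b v) := by
      refine Polynomial.funext fun x => ?_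
      have h3 := spinForm_pow ((polyS b).eval x) ((polyT b).eval x) v 1
      rw [pow_one, spinForm_polyS_polyT hb] at h3
      simp only [eval_finsetSum, eval_mul, eval_pow, eval_C]
      rw [← h3, eval_quadPoly]
      ring
    have h4 := congrArg (fun f => f.coeff 1) h2
    simp only [finsetSum_coeff, coeff_C_mul] at h4
    have h5 := coeff_quadPoly_mul_one (-(starRingEnd ℂ) (transv b v)) (axial b v) (transv b v) 1
    rw [mul_one] at h5
    rw [h5] at h4
    simp only [angCoef]
    rw [Finset.sum_congr rfl fun J _ => mul_comm _ _, h4, coeff_one, coeff_one]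
    simp
  simp only [coulCoef, mul_assoc]
  rw [← Finset.mul_sum, ← Finset.mul_sum, h1]
  push_cast
  rw [div_eq_mul_inv]
  ring

end HalfSpace

end

/-! ### The expansion of `𝓑` in solid harmonics -/

noncomputable section

namespace HalfSpace

open Polynomial Complex MeasureTheory Filter Topology

variable {b v : Space}

lemma hasSum_of_eq {f : ℕ → ℂ} {x y : ℂ} (h : HasSum f x) (hxy : x = y) : HasSum f y := hxy ▸ h

/-- The coefficients of the expansion of `v ↦ potB (b + v)` in solid harmonics. -/
def potBCoef (b : Space) : ℕ → ℕ → ℂ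
  | 0, J => if J = 0 then (potB b : ℂ) else 0
  | 1, J => if J = 0 then hor b / ((‖b‖ + b 2 : ℝ) : ℂ) else
      if J = 1 then (Real.log (‖b‖ + b 2) : ℂ) else
      if J = 2 then -(starRingEnd ℂ) (hor b) / ((‖b‖ + b 2 : ℝ) : ℂ) else 0
  -- The factor `τ` comes from integrating twice from infinity. In degrees at least 2 the integrand
  -- is `O(τ⁻²)`; in degrees 0 and 1 this decay fails, and the Taylor coefficients of `𝓑` are given
  -- explicitly.
  | N + 2, J => ∫ τ in Set.Ioi (0 : ℝ), (τ : ℂ) * coulCoef (b + τ • up) (N + 2) J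

lemma add_up_two_pos (hb : 0 < b 2) {τ : ℝ} (hτ : 0 ≤ τ) : 0 < (b + τ • up) 2 := by
  simp only [PiLp.add_apply, PiLp.smul_apply, up_two, smul_eq_mul, mul_one]
  positivity

lemma norm_le_norm_add_up (hb : 0 < b 2) {τ : ℝ} (hτ : 0 ≤ τ) : ‖b‖ ≤ ‖b + τ • up‖ := by
  refine le_of_sq_le_sq ?_ (norm_nonneg _)
  nlinarith [norm_le_norm_up hb hτ, sq_nonneg τ]

lemma integrableOn_up (hb : 0 < b 2) :
    IntegrableOn (fun τ : ℝ => τ * (‖b + τ • up‖ ^ 3)⁻¹) (Set.Ioi 0) := by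
  have h0 := norm_pos_of_pos hb
  set c : ℝ := min 1 (‖b‖ ^ 2) with hc
  have hc0 : 0 < c := lt_min one_pos (by positivity)
  have hcont : ContinuousOn (fun τ : ℝ => τ * (‖b + τ • up‖ ^ 3)⁻¹) (Set.Ioi 0) := by
    refine continuousOn_id.mul (ContinuousOn.inv₀ (by fun_prop) fun τ hτ => ?_)
    exact pow_ne_zero _ (norm_pos_of_pos (add_up_two_pos hb (le_of_lt hτ))).ne'
  refine Integrable.mono' (g := fun τ => c⁻¹ * (1 + τ ^ 2)⁻¹)
    ((integrable_inv_one_add_sq.const_mul c⁻¹).integrableOn)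
    (hcont.aestronglyMeasurable measurableSet_Ioi) ?_
  refine (ae_restrict_iff' measurableSet_Ioi).2 (Eventually.of_forall fun τ hτ => ?_)
  have hτ' : (0 : ℝ) < τ := hτ
  have h1 := norm_le_norm_up hb hτ'.le
  have h2 := norm_pos_of_pos (add_up_two_pos hb hτ'.le)
  have h3 : τ ≤ ‖b + τ • up‖ := le_of_sq_le_sq (by nlinarith) h2.le
  rw [Real.norm_of_nonneg (by positivity), ← mul_inv]
  have h4 : c * (1 + τ ^ 2) ≤ ‖b + τ • up‖ ^ 2 := by
    have h5 : c ≤ 1 := min_le_left _ _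
    have h6 : c ≤ ‖b‖ ^ 2 := min_le_right _ _
    nlinarith [sq_nonneg τ]
  calc τ * (‖b + τ • up‖ ^ 3)⁻¹ ≤ ‖b + τ • up‖ * (‖b + τ • up‖ ^ 3)⁻¹ := by gcongr
    _ = (‖b + τ • up‖ ^ 2)⁻¹ := by field_simp
    _ ≤ (c * (1 + τ ^ 2))⁻¹ := by gcongr

/-- The integral of `τ / |b + τ e₃|³`. -/
def upInt (b : Space) : ℝ := ∫ τ in Set.Ioi (0 : ℝ), τ * (‖b + τ • up‖ ^ 3)⁻¹

/-- Three powers of the distance are kept for integrability in `τ`; the others are traded for powers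
of `‖b‖`, since the distance only grows along the ray. -/
lemma norm_mul_coulCoef_le (hb : 0 < b 2) (N J : ℕ) {τ : ℝ} (hτ : 0 < τ) :
    ‖(τ : ℂ) * coulCoef (b + τ • up) (N + 2) J‖ ≤
      wt (N + 2) J * (‖b‖ ^ N)⁻¹ * (τ * (‖b + τ • up‖ ^ 3)⁻¹) := by
  have h0 := norm_pos_of_pos hb
  have hb' := add_up_two_pos hb hτ.le
  have h2 := norm_pos_of_pos hb'
  rw [norm_mul, Complex.norm_of_nonneg hτ.le]
  have h3 : (‖b + τ • up‖ ^ (N + 2 + 1))⁻¹ ≤ (‖b‖ ^ N)⁻¹ * (‖b + τ • up‖ ^ 3)⁻¹ := by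
    rw [← mul_inv, add_assoc, pow_add]
    gcongr
    exact norm_le_norm_add_up hb hτ.le
  calc τ * ‖coulCoef (b + τ • up) (N + 2) J‖
      ≤ τ * (((‖b‖ ^ N)⁻¹ * (‖b + τ • up‖ ^ 3)⁻¹) * wt (N + 2) J) := by
        refine mul_le_mul_of_nonneg_left ((norm_coulCoef_le hb' _ _).trans ?_) hτ.le
        exact mul_le_mul_of_nonneg_right h3 (wt_pos _ _).le
    _ = _ := by ring

lemma integrableOn_coulCoef_up (hb : 0 < b 2) (N J : ℕ) :
    IntegrableOn (fun τ : ℝ => (τ : ℂ) * coulCoef (b + τ • up) (N + 2) J) (Set.Ioi 0) := by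
  refine Integrable.mono' (((integrableOn_up hb).const_mul (wt (N + 2) J * (‖b‖ ^ N)⁻¹)))
    (ContinuousOn.aestronglyMeasurable ?_ measurableSet_Ioi)
    ((ae_restrict_iff' measurableSet_Ioi).2 (Eventually.of_forall fun τ hτ =>
      norm_mul_coulCoef_le hb N J hτ))
  exact (Complex.continuous_ofReal.continuousOn).mul
    (continuousOn_of_pos_up (continuousOn_coulCoef (N + 2) J) hb)

lemma exists_norm_potBCoef_le (hb : 0 < b 2) :
    ∃ K, 0 ≤ K ∧ ∀ N J, ‖potBCoef b N J‖ ≤ K * (wt N J * (‖b‖ ^ N)⁻¹) := by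
  have h0 := norm_pos_of_pos hb
  have hI : 0 ≤ upInt b := setIntegral_nonneg measurableSet_Ioi fun τ hτ =>
    mul_nonneg (le_of_lt hτ) (by positivity)
  -- One summand each for degree 0, degree 1, and all higher degrees.
  set K := ‖potB b‖ + (‖potBCoef b 1 0‖ + ‖potBCoef b 1 1‖ + ‖potBCoef b 1 2‖) * ‖b‖ +
    upInt b * ‖b‖ ^ 2 with hK
  have hK0 : 0 ≤ K := by positivity
  have key : ∀ N J, ‖potBCoef b N J‖ * ‖b‖ ^ N ≤ K * wt N J := by
    intro N J
    have hw := one_le_wt N J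
    rcases N with _ | _ | N
    · have h1 : ‖potBCoef b 0 J‖ ≤ ‖potB b‖ := by
        simp only [potBCoef]; split_ifs <;> simp
      have : ‖potB b‖ ≤ K := by rw [hK, add_assoc]; exact le_add_of_nonneg_right (by positivity)
      rw [pow_zero, mul_one]
      nlinarith
    · have h1 : ‖potBCoef b 1 J‖ ≤ ‖potBCoef b 1 0‖ + ‖potBCoef b 1 1‖ + ‖potBCoef b 1 2‖ := by
        have e0 := norm_nonneg (potBCoef b 1 0)
        have e1 := norm_nonneg (potBCoef b 1 1)
        have e2 := norm_nonneg (potBCoef b 1 2)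
        rcases J with _ | _ | _ | J
        · linarith
        · simp only [zero_add]; linarith
        · simp only [zero_add, one_add_one_eq_two]; linarith
        · have : potBCoef b 1 (J + 1 + 1 + 1) = 0 := by simp [potBCoef]
          rw [this, norm_zero]; positivity
      have h2 : ‖potBCoef b 1 J‖ * ‖b‖ ≤ K := by
        refine (mul_le_mul_of_nonneg_right h1 h0.le).trans ?_
        rw [hK]
        nlinarith [norm_nonneg (potB b), mul_nonneg hI (sq_nonneg ‖b‖)]
      rw [zero_add, pow_one]
      nlinarith [norm_nonneg (potBCoef b 1 J)]
    · have h1 : ‖potBCoef b (N + 2) J‖ ≤ wt (N + 2) J * (‖b‖ ^ N)⁻¹ * upInt b := by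
        rw [potBCoef, upInt, ← integral_const_mul]
        exact norm_integral_le_of_norm_le ((integrableOn_up hb).const_mul _)
          ((ae_restrict_iff' measurableSet_Ioi).2 (Eventually.of_forall fun τ hτ =>
            norm_mul_coulCoef_le hb N J hτ))
      have h2 : upInt b * ‖b‖ ^ 2 ≤ K := by
        rw [hK]; exact le_add_of_nonneg_left (by positivity)
      calc ‖potBCoef b (N + 1 + 1) J‖ * ‖b‖ ^ (N + 1 + 1)
          ≤ wt (N + 2) J * (‖b‖ ^ N)⁻¹ * upInt b * ‖b‖ ^ (N + 2) := by gcongr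
        _ = (upInt b * ‖b‖ ^ 2) * wt (N + 2) J := by rw [pow_add]; field_simp
        _ ≤ K * wt (N + 2) J := mul_le_mul_of_nonneg_right h2 (wt_pos _ _).le
  refine ⟨K, hK0, fun N J => ?_⟩
  rw [← mul_assoc, ← div_eq_mul_inv, le_div_iff₀ (by positivity)]
  exact key N J

/-- With `g` the remainder along the ray, `τ g'' = (τ g' - g)'`; the antiderivative vanishes at
infinity and equals `-g` at `τ = 0`. -/
lemma potBRem_eq_integral (hb : 0 < b 2) (hv : ‖v‖ < ‖b‖)
    (hint : IntegrableOn (fun τ : ℝ => τ * (‖b + τ • up + v‖⁻¹ - ‖b + τ • up‖⁻¹ +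
      axial (b + τ • up) v / ‖b + τ • up‖ ^ 2)) (Set.Ioi 0)) :
    ∫ τ in Set.Ioi (0 : ℝ), τ * (‖b + τ • up + v‖⁻¹ - ‖b + τ • up‖⁻¹ +
      axial (b + τ • up) v / ‖b + τ • up‖ ^ 2) = potBRem b v := by
  have hrb : 0 < ‖b‖ + b 2 := by have := norm_pos_of_pos hb; positivity
  have hrv := reg_add hb hv
  have e : ∀ τ : ℝ, b + τ • up + v = (b + v) + τ • up := fun τ => by abel
  have hd : ∀ τ ∈ Set.Ici (0 : ℝ), HasDerivAt
      (fun τ : ℝ => τ * potBRem' (b + τ • up) v - potBRem (b + τ • up) v)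
      (τ * (‖b + τ • up + v‖⁻¹ - ‖b + τ • up‖⁻¹ +
      axial (b + τ • up) v / ‖b + τ • up‖ ^ 2)) τ := by
    intro τ hτ
    have h1 := reg_add_up hrb hτ
    have h2 := reg_add_up hrv hτ
    rw [← e] at h2
    refine (((hasDerivAt_id τ).mul (hasDerivAt_potBRem'_up h1 h2)).sub
      (hasDerivAt_potBRem_up h1 h2)).congr_deriv ?_
    simp only [id]
    ring
  rw [integral_Ioi_of_hasDerivAt_of_tendsto' hd hint (tendsto_potBRem hb hv)]
  simp

lemma harm_one_zero (v : Space) : harm 1 0 v = -(starRingEnd ℂ) (hor v) / 2 := by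
  simp [harm, quad, quadPoly]

lemma harm_one_one (v : Space) : harm 1 1 v = (v 2 : ℝ) := by
  simp [harm, quad, quadPoly, coeff_C]

lemma harm_one_two (v : Space) : harm 1 2 v = hor v / 2 := by
  simp [harm, quad, quadPoly]

lemma potBLin_eq_sum (hb : 0 < b 2) (v : Space) :
    (potBLin b v : ℂ) = ∑ J ∈ Finset.range (2 * 1 + 1), potBCoef b 1 J * harm 1 J v := by
  have h0 := norm_pos_of_pos hb
  have h3 : ((‖b‖ + b 2 : ℝ) : ℂ) ≠ 0 := by
    exact_mod_cast (by positivity : ‖b‖ + b 2 ≠ 0)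
  have h6 : (starRingEnd ℂ) (hor b) * hor v + hor b * (starRingEnd ℂ) (hor v) =
      2 * ((b 0 * v 0 + b 1 * v 1 : ℝ) : ℂ) := by
    apply Complex.ext <;> simp [hor] <;> ring
  rw [show 2 * 1 + 1 = 3 by norm_num, Finset.sum_range_succ, Finset.sum_range_succ,
    Finset.sum_range_one, harm_one_zero, harm_one_one, harm_one_two]
  simp only [potBCoef, potBLin, if_true, one_ne_zero, if_false, OfNat.ofNat_ne_zero,
    OfNat.ofNat_ne_one]
  rw [Complex.ofReal_sub, Complex.ofReal_div]
  have h7 : ((b 0 * v 0 + b 1 * v 1 : ℝ) : ℂ) =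
    ((starRingEnd ℂ) (hor b) * hor v + hor b * (starRingEnd ℂ) (hor v)) / 2 := by
    rw [h6]; ring
  rw [h7]
  field_simp
  push_cast
  ring

/-- The expansion of `potB` in solid harmonics. -/
lemma hasSum_potB (hb : 0 < b 2) (hv : ‖v‖ < ‖b‖) :
    HasSum (fun N => ∑ J ∈ Finset.range (2 * N + 1), potBCoef b N J * harm N J v)
      (potB (b + v) : ℂ) := by
  have h0 := norm_pos_of_pos hb
  set f : ℝ → ℝ := fun τ => τ * (‖b + τ • up + v‖⁻¹ - ‖b + τ • up‖⁻¹ +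
      axial (b + τ • up) v / ‖b + τ • up‖ ^ 2) with hf
  set F : ℕ → ℝ → ℂ := fun N τ => ∑ J ∈ Finset.range (2 * (N + 2) + 1),
    ((τ : ℂ) * coulCoef (b + τ • up) (N + 2) J) * harm (N + 2) J v with hF
  set B : ℕ → ℝ → ℝ := fun N τ => ((2 * (N + 2) + 1 : ℕ) * (‖v‖ ^ 2 * (‖v‖ / ‖b‖) ^ N)) *
    (τ * (‖b + τ • up‖ ^ 3)⁻¹) with hB
  have hr : ‖v‖ / ‖b‖ < 1 := (div_lt_one h0).2 hv
  have hsumm : Summable fun N : ℕ => ((2 * (N + 2) + 1 : ℕ) * (‖v‖ ^ 2 * (‖v‖ / ‖b‖) ^ N)) := by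
    have h1 := summable_pow_mul_geometric_of_norm_lt_one (R := ℝ) 1
      (r := ‖v‖ / ‖b‖) (by rwa [Real.norm_of_nonneg (by positivity)])
    have h2 := summable_geometric_of_lt_one (by positivity) hr
    refine ((h1.mul_left (2 * ‖v‖ ^ 2)).add (h2.mul_left (5 * ‖v‖ ^ 2))).congr fun N => ?_
    push_cast
    ring
  have hFB : ∀ N, ∀ τ ∈ Set.Ioi (0 : ℝ), ‖F N τ‖ ≤ B N τ := by
    intro N τ hτ
    have hτ' : (0 : ℝ) < τ := hτ
    have h2 := norm_pos_of_pos (add_up_two_pos hb hτ'.le)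
    refine (norm_sum_le _ _).trans ?_
    have h1 : ∀ J ∈ Finset.range (2 * (N + 2) + 1),
        ‖((τ : ℂ) * coulCoef (b + τ • up) (N + 2) J) * harm (N + 2) J v‖ ≤
        (‖v‖ ^ 2 * (‖v‖ / ‖b‖) ^ N) * (τ * (‖b + τ • up‖ ^ 3)⁻¹) := by
      intro J _
      rw [norm_mul]
      calc ‖(τ : ℂ) * coulCoef (b + τ • up) (N + 2) J‖ * ‖harm (N + 2) J v‖
          ≤ (wt (N + 2) J * (‖b‖ ^ N)⁻¹ * (τ * (‖b + τ • up‖ ^ 3)⁻¹)) *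
            (‖v‖ ^ (N + 2) / wt (N + 2) J) :=
          mul_le_mul (norm_mul_coulCoef_le hb N J hτ) (norm_harm_le _ _ _) (norm_nonneg _)
            (by have := wt_pos (N + 2) J; positivity)
        _ = _ := by
          have := wt_pos (N + 2) J
          rw [pow_add, div_pow]
          field_simp
    refine (Finset.sum_le_card_nsmul _ _ _ h1).trans_eq ?_
    rw [Finset.card_range, nsmul_eq_mul]
    simp only [hB]
    ring
  have hfF : ∀ τ ∈ Set.Ioi (0 : ℝ), HasSum (fun N => F N τ) (f τ : ℂ) := by
    intro τ hτ
    have hτ' : (0 : ℝ) < τ := hτ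
    have h1 := hasSum_coulomb (add_up_two_pos hb hτ'.le)
      (hv.trans_le (norm_le_norm_add_up hb hτ'.le))
    -- The Coulomb terms of degrees 0 and 1 are exactly those subtracted in the second derivative of
    -- `potBRem`.
    have h2 := ((hasSum_nat_add_iff' 2).2 h1).mul_left (τ : ℂ)
    rw [Finset.sum_range_succ, Finset.sum_range_one, sum_coulCoef_zero,
      sum_coulCoef_one (add_up_two_pos hb hτ'.le)] at h2
    have h3 : (fun N => F N τ) = fun N => (τ : ℂ) * ∑ J ∈ Finset.range (2 * (N + 2) + 1),
        coulCoef (b + τ • up) (N + 2) J * harm (N + 2) J v := by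
      funext N
      simp only [hF, Finset.mul_sum, mul_assoc]
    rw [h3]
    refine hasSum_of_eq h2 ?_
    simp only [hf]
    push_cast
    ring
  have hfint : IntegrableOn f (Set.Ioi 0) := by
    refine Integrable.mono' (g := fun τ => (∑' N : ℕ,
      ((2 * (N + 2) + 1 : ℕ) * (‖v‖ ^ 2 * (‖v‖ / ‖b‖) ^ N))) * (τ * (‖b + τ • up‖ ^ 3)⁻¹))
      ((integrableOn_up hb).const_mul _) (ContinuousOn.aestronglyMeasurable ?_ measurableSet_Ioi)
      ((ae_restrict_iff' measurableSet_Ioi).2 (Eventually.of_forall fun τ hτ => ?_))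
    · have h1 : ∀ τ ∈ Set.Ioi (0 : ℝ), ‖b + τ • up‖ ≠ 0 := fun τ hτ =>
        (norm_pos_of_pos (add_up_two_pos hb (le_of_lt hτ))).ne'
      have h2 : ∀ τ ∈ Set.Ioi (0 : ℝ), ‖b + τ • up + v‖ ≠ 0 := by
        intro τ hτ h
        have h3 := norm_le_norm_add_up hb (le_of_lt hτ)
        rw [norm_eq_zero] at h
        rw [eq_neg_of_add_eq_zero_left h, norm_neg] at h3
        linarith
      simp only [hf, axial]
      refine continuousOn_id.mul (((ContinuousOn.inv₀ (by fun_prop) h2).sub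
        (ContinuousOn.inv₀ (by fun_prop) h1)).add ?_)
      refine ContinuousOn.div (ContinuousOn.div (by fun_prop) (by fun_prop) h1) (by fun_prop)
        fun τ hτ => pow_ne_zero _ (h1 τ hτ)
    · rw [← Complex.norm_real, ← (hfF τ hτ).tsum_eq, ← tsum_mul_right]
      exact tsum_of_norm_bounded (hsumm.mul_right _).hasSum fun N => hFB N τ hτ
  have hmain : HasSum (fun N => ∫ τ in Set.Ioi (0 : ℝ), F N τ)
      (∫ τ in Set.Ioi (0 : ℝ), (f τ : ℂ)) := by
    refine hasSum_integral_of_dominated_convergence B (fun N => ?_) (fun N => ?_) ?_ ?_ ?_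
    · refine ContinuousOn.aestronglyMeasurable ?_ measurableSet_Ioi
      refine continuousOn_finsetSum _ fun J _ => ContinuousOn.mul ?_ continuousOn_const
      exact (Complex.continuous_ofReal.continuousOn).mul
        (continuousOn_of_pos_up (continuousOn_coulCoef (N + 2) J) hb)
    · exact (ae_restrict_iff' measurableSet_Ioi).2 (Eventually.of_forall fun τ hτ => hFB N τ hτ)
    · exact Eventually.of_forall fun τ => hsumm.mul_right _
    · simp only [hB, tsum_mul_right]
      exact (integrableOn_up hb).const_mul _
    · exact (ae_restrict_iff' measurableSet_Ioi).2 (Eventually.of_forall fun τ hτ => hfF τ hτ)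
  have h1 : ∀ N, ∫ τ in Set.Ioi (0 : ℝ), F N τ =
      ∑ J ∈ Finset.range (2 * (N + 2) + 1), potBCoef b (N + 2) J * harm (N + 2) J v := by
    intro N
    simp only [hF]
    rw [integral_finsetSum]
    · simp only [integral_mul_const, potBCoef]
    · intro J _
      exact (integrableOn_coulCoef_up hb N J).mul_const _
  simp only [h1] at hmain
  rw [show ∫ τ in Set.Ioi (0 : ℝ), (f τ : ℂ) = ((∫ τ in Set.Ioi (0 : ℝ), f τ : ℝ) : ℂ) from
    integral_ofReal, potBRem_eq_integral hb hv hfint] at hmain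
  have h2 := (hasSum_nat_add_iff (f := fun N => ∑ J ∈ Finset.range (2 * N + 1),
    potBCoef b N J * harm N J v) 2).1 hmain
  refine hasSum_of_eq h2 ?_
  have h4 := potBLin_eq_sum hb v
  have h5 : (potB b : ℂ) = ∑ J ∈ Finset.range (2 * 0 + 1), potBCoef b 0 J * harm 0 J v := by
    simp [potBCoef, harm]
  rw [Finset.sum_range_succ, Finset.sum_range_one, ← h4, ← h5, potBRem]
  push_cast
  ring

end HalfSpace

end

/-! ### Uniqueness, termwise differentiation, and the comparison of `𝓑` with the Coulomb potential
-/

noncomputable section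

namespace HalfSpace

open Polynomial Complex Filter Topology

lemma harm_zero_right (n : ℕ) (w : Space) : harm n 0 w = (-(starRingEnd ℂ) (hor w) / 2) ^ n :=
  coeff_quadPoly_pow_zero _ _ _ _

lemma harm_two_mul (n : ℕ) (w : Space) : harm n (2 * n) w = (hor w / 2) ^ n := by
  have h := coeff_quadPoly_pow_reverse (-(starRingEnd ℂ) (hor w) / 2) (w 2 : ℝ) (hor w / 2)
    (n := n) (j := 0) (by omega)
  rw [Nat.sub_zero, coeff_quadPoly_pow_zero] at h
  exact h

lemma quad_up : quad up = X := by
  simp [quad, quadPoly]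

lemma harmD_up_zero (n : ℕ) (w : Space) : harmD n 0 w up = 0 := by
  simp [harmD, quad_up, mul_coeff_zero]

/-- The null form of `up` is `X`, so vertical differentiation lowers degree and index together and
keeps the order `j - n`. -/
lemma harmD_up_succ (n j : ℕ) (w : Space) : harmD n (j + 1) w up = n * harm (n - 1) j w := by
  rw [harmD, quad_up, coeff_X_mul, harm]

lemma sum_harmD_up (n : ℕ) (c : ℕ → ℂ) (w : Space) :
    ∑ J ∈ Finset.range (2 * (n + 1) + 1), c J * harmD (n + 1) J w up =
      ∑ J ∈ Finset.range (2 * n + 1), ((n + 1 : ℕ) * c (J + 1)) * harm n J w := by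
  rw [show 2 * (n + 1) + 1 = (2 * n + 1) + 1 + 1 by ring, Finset.sum_range_succ',
    harmD_up_zero, mul_zero, add_zero, Finset.sum_range_succ, harmD_up_succ, Nat.add_sub_cancel,
    harm_eq_zero (by omega), mul_zero, mul_zero, add_zero]
  refine Finset.sum_congr rfl fun J _ => ?_
  rw [harmD_up_succ, Nat.add_sub_cancel]
  ring

/-- The solid harmonics of a given degree are linearly independent. -/
lemma harm_linearIndependent (n : ℕ) : ∀ c : ℕ → ℂ,
    (∀ w, ∑ J ∈ Finset.range (2 * n + 1), c J * harm n J w = 0) → ∀ J ≤ 2 * n, c J = 0 := by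
  induction n with
  | zero =>
    intro c h J hJ
    obtain rfl : J = 0 := by omega
    simpa [harm] using h 0
  | succ n ih =>
    intro c h
    -- The vertical derivative of the relation is a relation in degree `n`. It kills the two extreme
    -- indices, which are treated separately.
    have h1 : ∀ J ≤ 2 * n, ((n + 1 : ℕ) * c (J + 1) : ℂ) = 0 := by
      refine ih _ fun w => ?_
      rw [← sum_harmD_up n c w]
      have h2 : HasFDerivAt (fun w => ∑ J ∈ Finset.range (2 * (n + 1) + 1),
          c J * harm (n + 1) J w) (∑ J ∈ Finset.range (2 * (n + 1) + 1),
          c J • harmCLM (n + 1) J w) w :=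
        HasFDerivAt.fun_sum fun J _ => (hasFDerivAt_harm (n + 1) J w).const_mul (c J)
      have h3 := h2.unique (f := fun w => ∑ J ∈ Finset.range (2 * (n + 1) + 1),
          c J * harm (n + 1) J w) (by simp only [h]; exact hasFDerivAt_const (0 : ℂ) w)
      have h4 := congrArg (fun L : Space →L[ℝ] ℂ => L up) h3
      simpa using h4
    have h1' : ∀ J ≤ 2 * n, c (J + 1) = 0 := fun J hJ =>
      (mul_eq_zero.1 (h1 J hJ)).resolve_left (by exact_mod_cast n.succ_ne_zero)
    have h2 : ∀ w, c 0 * (-(starRingEnd ℂ) (hor w) / 2) ^ (n + 1) +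
        c (2 * (n + 1)) * (hor w / 2) ^ (n + 1) = 0 := by
      intro w
      rw [← h w, Finset.sum_range_succ, harm_two_mul,
        show 2 * (n + 1) = (2 * n + 1) + 1 by ring, Finset.sum_range_succ',
        Finset.sum_eq_zero fun J hJ => ?_, harm_zero_right, zero_add]
      rw [h1' J (by simp at hJ; omega), zero_mul]
    have h3 : ∀ u : ℂ, c 0 * (-(starRingEnd ℂ) u) ^ (n + 1) + c (2 * (n + 1)) * u ^ (n + 1) = 0 := by
      intro u
      have h4 := h2 !₂[u.re, u.im, 0]
      have h5 : hor !₂[u.re, u.im, 0] = u := by apply Complex.ext <;> simp [hor]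
      rw [h5, div_pow, div_pow] at h4
      field_simp at h4
      rwa [mul_zero] at h4
    have h4 := h3 1
    -- At this point `u^(n+1) = i`; together with `u = 1` it separates the two extreme coefficients.
    have h5 := h3 (Complex.exp (Real.pi * I / (2 * (n + 1 : ℕ))))
    have hn : ((n + 1 : ℕ) : ℂ) ≠ 0 := by exact_mod_cast n.succ_ne_zero
    rw [neg_pow, ← map_pow, ← Complex.exp_nat_mul,
      show ((n + 1 : ℕ) : ℂ) * (Real.pi * I / (2 * (n + 1 : ℕ))) = Real.pi / 2 * I by
        field_simp, Complex.exp_pi_div_two_mul_I, Complex.conj_I] at h5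
    rw [map_one, neg_pow, one_pow, mul_one, mul_one] at h4
    have h6 : c (2 * (n + 1)) = 0 := by
      have h7 : 2 * I * c (2 * (n + 1)) = 0 := by linear_combination I * h4 + h5
      simpa using h7
    have h7 : c 0 = 0 := by
      rw [h6, add_zero] at h4
      simpa using h4
    intro J hJ
    rcases Nat.eq_zero_or_pos J with rfl | hJ0
    · exact h7
    rcases eq_or_lt_of_le hJ with rfl | hJ1
    · exact h6
    · obtain ⟨i, rfl⟩ := Nat.exists_eq_succ_of_ne_zero hJ0.ne'
      exact h1' i (by omega)

/-- Uniqueness of power series in one real variable, used along lines through the origin. -/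
lemma coeff_eq_zero_of_hasSum_zero {p : ℕ → ℂ}
    (h : ∀ᶠ s : ℝ in 𝓝 0, HasSum (fun n => (s : ℂ) ^ n * p n) 0) (n : ℕ) : p n = 0 := by
  let P : FormalMultilinearSeries ℝ ℝ ℂ :=
    fun n => ContinuousMultilinearMap.mkPiRing ℝ (Fin n) (p n)
  have hc : ∀ n, P.coeff n = p n := fun n => by
    simp [FormalMultilinearSeries.coeff, P]
  have hP : HasFPowerSeriesAt (fun _ : ℝ => (0 : ℂ)) P 0 := by
    rw [hasFPowerSeriesAt_iff]
    filter_upwards [h] with s hs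
    have : (fun n => s ^ n • P.coeff n) = fun n => (s : ℂ) ^ n * p n := by
      funext n; rw [hc, Complex.real_smul]; push_cast; rfl
    rw [this]
    exact hs
  have := hP.eq_zero
  rw [← hc, this]
  simp [FormalMultilinearSeries.coeff]

/-- Uniqueness of the expansion in solid harmonics. -/
lemma coeff_unique {c : ℕ → ℕ → ℂ} {r : ℝ} (hr : 0 < r)
    (h : ∀ v : Space, ‖v‖ < r →
      HasSum (fun N => ∑ J ∈ Finset.range (2 * N + 1), c N J * harm N J v) 0) :
    ∀ N, ∀ J ≤ 2 * N, c N J = 0 := by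
  intro N
  refine harm_linearIndependent N (c N) fun w => ?_
  refine coeff_eq_zero_of_hasSum_zero
    (p := fun N => ∑ J ∈ Finset.range (2 * N + 1), c N J * harm N J w) ?_ N
  have h1 : ∀ᶠ s : ℝ in 𝓝 0, ‖s • w‖ < r := by
    have : Continuous fun s : ℝ => ‖s • w‖ := by fun_prop
    exact this.continuousAt.eventually_lt continuousAt_const (by simpa using hr)
  filter_upwards [h1] with s hs
  have h2 := h (s • w) hs
  simp only [harm_smul] at h2
  convert h2 using 2 with n
  rw [Finset.mul_sum]
  exact Finset.sum_congr rfl fun J _ => by ring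

lemma summable_linear_mul_geometric {x : ℝ} (h0 : 0 ≤ x) (h1 : x < 1) (k : ℕ) :
    Summable fun n : ℕ => ((n : ℝ) + 1) ^ k * x ^ n := by
  rcases eq_or_lt_of_le h0 with rfl | hx
  · refine summable_of_ne_finset_zero (s := {0}) fun n hn => ?_
    rw [zero_pow (by simpa using hn), mul_zero]
  · have h2 := (summable_nat_add_iff 1).2 (summable_pow_mul_geometric_of_norm_lt_one (R := ℝ) k
      (r := x) (by rwa [Real.norm_of_nonneg h0]))
    refine (h2.mul_left x⁻¹).congr fun n => ?_
    push_cast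
    rw [pow_succ]
    field_simp

/-- Expansions in solid harmonics are differentiated term by term. -/
lemma hasFDerivAt_of_hasSum {c : ℕ → ℕ → ℂ} {K r : ℝ} (hK : 0 ≤ K) {f : Space → ℂ}
    (hc : ∀ N, ∀ J ≤ 2 * N, ‖c N J‖ ≤ K * (wt N J * (r ^ N)⁻¹))
    (h : ∀ v : Space, ‖v‖ < r →
      HasSum (fun N => ∑ J ∈ Finset.range (2 * N + 1), c N J * harm N J v) (f v))
    {v : Space} (hv : ‖v‖ < r) :
    ∃ L : Space →L[ℝ] ℂ, HasFDerivAt f L v ∧ ∀ F,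
      HasSum (fun N => ∑ J ∈ Finset.range (2 * N + 1), c N J * harmD N J v F) (L F) := by
  obtain ⟨ρ, hρ1, hρ2⟩ := exists_between hv
  have hρ0 : 0 < ρ := (norm_nonneg v).trans_lt hρ1
  have hr0 : 0 < r := hρ0.trans hρ2
  set f' : ℕ → Space → Space →L[ℝ] ℂ := fun N v =>
    ∑ J ∈ Finset.range (2 * N + 1), c N J • harmCLM N J v with hf'
  set u : ℕ → ℝ := fun N => (2 * K / ρ) * (((N : ℝ) + 1) ^ 2 * (ρ / r) ^ N) with hu
  have hsu : Summable u := (summable_linear_mul_geometric (by positivity)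
    ((div_lt_one hr0).2 hρ2) 2).mul_left _
  have hbound : ∀ N, ∀ x ∈ Metric.ball (0 : Space) ρ, ‖f' N x‖ ≤ u N := by
    intro N x hx
    rw [mem_ball_zero_iff] at hx
    refine ContinuousLinearMap.opNorm_le_bound _ (by simp only [hu]; positivity) fun F => ?_
    simp only [hf', sum_apply, smul_apply, harmCLM_apply, smul_eq_mul]
    have h1 : ∀ J ∈ Finset.range (2 * N + 1), ‖c N J * harmD N J x F‖ ≤
        K * (r ^ N)⁻¹ * (N * ρ ^ (N - 1) * ‖F‖) := by
      intro J hJ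
      have hw := wt_pos N J
      rw [norm_mul]
      have h2 := norm_harmD_mul_wt_le N J x F
      have h3 : (N : ℝ) * ‖x‖ ^ (N - 1) * ‖F‖ ≤ N * ρ ^ (N - 1) * ‖F‖ := by gcongr
      calc ‖c N J‖ * ‖harmD N J x F‖ ≤ K * (wt N J * (r ^ N)⁻¹) * ‖harmD N J x F‖ := by
            gcongr; exact hc N J (by simp at hJ; omega)
        _ = K * (r ^ N)⁻¹ * (‖harmD N J x F‖ * wt N J) := by ring
        _ ≤ _ := mul_le_mul_of_nonneg_left (h2.trans h3) (by positivity)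
    refine (norm_sum_le_of_le _ h1).trans ?_
    rw [Finset.sum_const, Finset.card_range, nsmul_eq_mul]
    have h4 : (N : ℝ) * ρ ^ (N - 1) = N * ρ ^ N / ρ := by
      rcases N with _ | N
      · simp
      · rw [Nat.add_sub_cancel, pow_succ]; field_simp
    rw [h4]
    have h5 : ((2 * N + 1 : ℕ) : ℝ) * N ≤ 2 * ((N : ℝ) + 1) ^ 2 := by push_cast; nlinarith
    calc ((2 * N + 1 : ℕ) : ℝ) * (K * (r ^ N)⁻¹ * (N * ρ ^ N / ρ * ‖F‖))
        = (((2 * N + 1 : ℕ) : ℝ) * N) * (K / ρ * (ρ / r) ^ N * ‖F‖) := by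
          rw [div_pow]; field_simp
      _ ≤ (2 * ((N : ℝ) + 1) ^ 2) * (K / ρ * (ρ / r) ^ N * ‖F‖) := by gcongr
      _ = u N * ‖F‖ := by simp only [hu]; ring
  have hv' : v ∈ Metric.ball (0 : Space) ρ := by rwa [mem_ball_zero_iff]
  have h1 := hasFDerivAt_tsum_of_isPreconnected (𝕜 := ℝ) (f := fun N v =>
    ∑ J ∈ Finset.range (2 * N + 1), c N J * harm N J v) (f' := f') hsu Metric.isOpen_ball
    (convex_ball (0 : Space) ρ).isPreconnected
    (fun N x _ => HasFDerivAt.fun_sum fun J _ => (hasFDerivAt_harm N J x).const_mul (c N J))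
    hbound hv' (h v hv).summable hv'
  refine ⟨∑' N, f' N v, h1.congr_of_eventuallyEq ?_, fun F => ?_⟩
  · filter_upwards [Metric.isOpen_ball.mem_nhds hv'] with x hx
    rw [mem_ball_zero_iff] at hx
    exact (h x (hx.trans hρ2)).tsum_eq.symm
  · have h2 : Summable fun N => f' N v := Summable.of_norm_bounded hsu fun N => hbound N v hv'
    have h3 := h2.hasSum.mapL (ContinuousLinearMap.apply ℝ ℂ F)
    simpa [hf'] using h3

lemma hasSum_up_of_hasSum {c : ℕ → ℕ → ℂ} {v : Space} {y : ℂ}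
    (h : HasSum (fun N => ∑ J ∈ Finset.range (2 * N + 1), c N J * harmD N J v up) y) :
    HasSum (fun N => ∑ J ∈ Finset.range (2 * N + 1),
      ((N + 1 : ℕ) * c (N + 1) (J + 1)) * harm N J v) y := by
  have h1 := (hasSum_nat_add_iff' 1).2 h
  rw [Finset.sum_range_one] at h1
  simp only [sum_harmD_up] at h1
  simpa [harmD] using h1

/-- Passing to a smaller radius absorbs the factor `N + 1` of the derivative, so that a
differentiated expansion can be differentiated again. -/
lemma exists_norm_up_coeff_le {c : ℕ → ℕ → ℂ} {K r r' : ℝ} (hK : 0 ≤ K) (hr' : 0 < r')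
    (hr : r' < r) (hc : ∀ N, ∀ J ≤ 2 * N, ‖c N J‖ ≤ K * (wt N J * (r ^ N)⁻¹)) :
    ∃ K', 0 ≤ K' ∧ ∀ N, ∀ J ≤ 2 * N,
      ‖((N + 1 : ℕ) : ℂ) * c (N + 1) (J + 1)‖ ≤ K' * (wt N J * (r' ^ N)⁻¹) := by
  have hr0 : 0 < r := hr'.trans hr
  have hs := summable_linear_mul_geometric (div_nonneg hr'.le hr0.le) ((div_lt_one hr0).2 hr) 1
  refine ⟨K * wt 1 1 / r * ∑' n : ℕ, ((n : ℝ) + 1) ^ 1 * (r' / r) ^ n, ?_, fun N J hJ => ?_⟩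
  · have := wt_pos 1 1
    exact mul_nonneg (by positivity) (tsum_nonneg fun n => by positivity)
  · have h1 := hs.le_tsum N fun n _ => by positivity
    have h2 := wt_add_le (k := 1) (i := 1) hJ (by norm_num)
    have hw := wt_pos N J
    have hw1 := wt_pos 1 1
    rw [norm_mul, Complex.norm_natCast]
    calc ((N + 1 : ℕ) : ℝ) * ‖c (N + 1) (J + 1)‖
        ≤ ((N + 1 : ℕ) : ℝ) * (K * ((wt N J * wt 1 1) * (r ^ (N + 1))⁻¹)) := by
          gcongr
          refine (hc (N + 1) (J + 1) (by omega)).trans ?_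
          gcongr
      _ = K * wt 1 1 / r * (((N : ℝ) + 1) ^ 1 * (r' / r) ^ N) * (wt N J * (r' ^ N)⁻¹) := by
          rw [div_pow, pow_succ]; push_cast; field_simp
      _ ≤ _ := by gcongr

/-- The second vertical derivative of `potB` is the Coulomb potential. -/
lemma potBCoef_eq {b : Space} (hb : 0 < b 2) (N J : ℕ) (hJ : J ≤ 2 * N) :
    ((N + 2 : ℕ) : ℂ) * ((N + 1 : ℕ) : ℂ) * potBCoef b (N + 2) (J + 2) = coulCoef b N J := by
  have h0 := norm_pos_of_pos hb
  obtain ⟨K, hK, hKb⟩ := exists_norm_potBCoef_le hb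
  obtain ⟨K', hK', hKb'⟩ := exists_norm_up_coeff_le (r' := ‖b‖ / 2) hK (by positivity) (by linarith)
    (fun N J _ => hKb N J)
  have hline : ∀ {f : Space → ℂ} {L : Space →L[ℝ] ℂ} {v : Space} {y : ℝ} {g : Space → ℝ},
      HasFDerivAt f L v → (∀ᶠ τ : ℝ in 𝓝 0, f (v + τ • up) = (g (b + v + τ • up) : ℂ)) →
      HasDerivAt (fun τ : ℝ => g (b + v + τ • up)) y 0 → L up = (y : ℂ) := by
    intro f L v y g h1 h2 h3
    have h4 : HasDerivAt (fun τ : ℝ => f (v + τ • up)) (L up) 0 := h1.hasLineDerivAt up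
    exact h4.unique (h3.ofReal_comp.congr_of_eventuallyEq h2)
  have hA : ∀ v : Space, ‖v‖ < ‖b‖ / 2 → HasSum (fun N => ∑ J ∈ Finset.range (2 * N + 1),
      ((N + 1 : ℕ) * potBCoef b (N + 1) (J + 1)) * harm N J v)
      (Real.log (‖b + v‖ + (b + v) 2) : ℂ) := by
    intro v hv
    have hv' : ‖v‖ < ‖b‖ := by linarith
    obtain ⟨L, hL, hL'⟩ := hasFDerivAt_of_hasSum hK (fun N J _ => hKb N J)
      (fun v hv => hasSum_potB hb hv) hv'
    have h1 := hasSum_up_of_hasSum (hL' up)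
    have h2 := reg_add hb hv'
    rw [hline (g := potB) hL (Eventually.of_forall fun τ => by rw [add_assoc])
      (hasDerivAt_potB_up (w := b + v) (τ := 0) (by simpa using h2))] at h1
    simpa using h1
  have hB : ∀ v : Space, ‖v‖ < ‖b‖ / 2 → HasSum (fun N => ∑ J ∈ Finset.range (2 * N + 1),
      ((N + 1 : ℕ) * ((N + 1 + 1 : ℕ) * potBCoef b (N + 1 + 1) (J + 1 + 1))) * harm N J v)
      ((‖b + v‖⁻¹ : ℝ) : ℂ) := by
    intro v hv
    have hv' : ‖v‖ < ‖b‖ := by linarith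
    obtain ⟨L, hL, hL'⟩ := hasFDerivAt_of_hasSum hK' hKb' hA hv
    have h1 := hasSum_up_of_hasSum (hL' up)
    have h2 := reg_add hb hv'
    rw [hline (g := fun w => Real.log (‖w‖ + w 2)) hL
      (Eventually.of_forall fun τ => by rw [add_assoc])
      (hasDerivAt_log_up (w := b + v) (τ := 0) (by simpa using h2))] at h1
    simpa using h1
  -- The twice differentiated series of `𝓑` and the Coulomb series have the same sum near the
  -- origin, hence the same coefficients.
  have h1 := coeff_unique (c := fun N J => ((N + 1 : ℕ) * ((N + 1 + 1 : ℕ) *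
    potBCoef b (N + 1 + 1) (J + 1 + 1))) - coulCoef b N J) (r := ‖b‖ / 2) (by positivity)
    (fun v hv => by
      have h2 := (hB v hv).sub (hasSum_coulomb hb (v := v) (by linarith))
      rw [sub_self] at h2
      simpa only [← Finset.sum_sub_distrib, ← sub_mul] using h2) N J hJ
  linear_combination h1

end HalfSpace

end

/-! ### Two-centre expansions and their truncation -/

noncomputable section

namespace HalfSpace

open Polynomial Complex Filter Topology

lemma sum_antidiagonal_eq {A B e : ℕ → ℂ} {n k : ℕ} (hA : ∀ j, 2 * n < j → A j = 0)
    (hB : ∀ i, 2 * k < i → B i = 0) :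
    ∑ J ∈ Finset.range (2 * (n + k) + 1), e J *
      ∑ x ∈ Finset.HasAntidiagonal.antidiagonal J, A x.1 * B x.2 =
    ∑ j ∈ Finset.range (2 * n + 1), ∑ i ∈ Finset.range (2 * k + 1), e (j + i) * (A j * B i) := by
  rw [← Finset.sum_product', ← Finset.sum_fiberwise_of_maps_to
    (t := Finset.range (2 * (n + k) + 1)) (g := fun x : ℕ × ℕ => x.1 + x.2)
    (by intro x hx; simp at hx ⊢; omega)]
  refine Finset.sum_congr rfl fun J hJ => ?_
  rw [Finset.mul_sum]
  symm
  refine Finset.sum_subset_zero_on_sdiff ?_ ?_ ?_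
  · intro x hx
    rw [Finset.mem_filter] at hx
    rw [Finset.HasAntidiagonal.mem_antidiagonal]
    exact hx.2
  · intro x hx
    rw [Finset.mem_sdiff, Finset.HasAntidiagonal.mem_antidiagonal, Finset.mem_filter,
      Finset.mem_product, Finset.mem_range, Finset.mem_range] at hx
    rcases lt_or_ge (2 * n) x.1 with h | h
    · rw [hA _ h]; ring
    rcases lt_or_ge (2 * k) x.2 with h' | h'
    · rw [hB _ h']; ring
    · exact absurd ⟨⟨by omega, by omega⟩, hx.1⟩ hx.2
  · intro x hx
    rw [(Finset.mem_filter.1 hx).2]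

/-- The contribution of the degrees `n` (sources) and `k` (targets) to the expansion with
coefficients `e` of a functional with the values `Λ` at the solid harmonics. -/
def block (e Λ : ℕ → ℕ → ℂ) (w : Space) (n k : ℕ) : ℂ :=
  ((n + k).choose n : ℂ) * ∑ j ∈ Finset.range (2 * n + 1), ∑ i ∈ Finset.range (2 * k + 1),
    e (n + k) (j + i) * (Λ n j * harm k i w)

/-- The coefficients of the local expansion that is obtained from the values `Λ n j`, `n ≤ p`. -/
def locCoef (e Λ : ℕ → ℕ → ℂ) (p k i : ℕ) : ℂ :=
  ∑ n ∈ Finset.range (p + 1), ((n + k).choose n : ℂ) *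
    ∑ j ∈ Finset.range (2 * n + 1), e (n + k) (j + i) * Λ n j

lemma sum_block_eq (e Λ : ℕ → ℕ → ℂ) (w : Space) (p k : ℕ) :
    ∑ n ∈ Finset.range (p + 1), block e Λ w n k =
      ∑ i ∈ Finset.range (2 * k + 1), locCoef e Λ p k i * harm k i w := by
  simp only [block, locCoef, Finset.mul_sum, Finset.sum_mul]
  rw [Finset.sum_comm]
  refine Finset.sum_congr rfl fun n _ => ?_
  rw [Finset.sum_comm]
  refine Finset.sum_congr rfl fun i _ => Finset.sum_congr rfl fun j _ => ?_
  ring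

variable {e Λ : ℕ → ℕ → ℂ} {K A q a r : ℝ}

/-- The weight in the bound for `e` is at most the product of the weights by which the bounds for
`Λ` and `harm` divide. Each of the `(2n+1)(2k+1)` terms is thus bounded without weights. -/
lemma norm_block_le (hK : 0 ≤ K) (hA : 0 ≤ A) (hq : 0 ≤ q) (hr : 0 < r)
    (he : ∀ N, ∀ J ≤ 2 * N, ‖e N J‖ ≤ K * (wt N J * (r ^ N)⁻¹))
    (hΛ : ∀ n, ∀ j ≤ 2 * n, ‖Λ n j‖ ≤ A * ((n : ℝ) + 1) ^ 2 * q ^ n / wt n j)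
    {w : Space} (hw : ‖w‖ ≤ a) (n k : ℕ) :
    ‖block e Λ w n k‖ ≤ 4 * K * A * ((n + k : ℕ) + 1) ^ 4 *
      ((q / r) ^ n * (a / r) ^ k * ((n + k).choose n : ℝ)) := by
  have ha : 0 ≤ a := (norm_nonneg w).trans hw
  have h1 : ∀ j ∈ Finset.range (2 * n + 1), ∀ i ∈ Finset.range (2 * k + 1),
      ‖e (n + k) (j + i) * (Λ n j * harm k i w)‖ ≤
        K * A * ((n : ℝ) + 1) ^ 2 * ((q / r) ^ n * (a / r) ^ k) := by
    intro j hj i hi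
    have hj' : j ≤ 2 * n := by simp at hj; omega
    have hi' : i ≤ 2 * k := by simp at hi; omega
    have w1 := wt_pos n j
    have w2 := wt_pos k i
    have w3 := wt_pos (n + k) (j + i)
    have w4 := wt_add_le hj' hi'
    rw [norm_mul, norm_mul]
    calc ‖e (n + k) (j + i)‖ * (‖Λ n j‖ * ‖harm k i w‖)
        ≤ (K * ((wt n j * wt k i) * (r ^ (n + k))⁻¹)) *
          ((A * ((n : ℝ) + 1) ^ 2 * q ^ n / wt n j) * (a ^ k / wt k i)) := by
          gcongr
          · refine (he (n + k) (j + i) (by omega)).trans ?_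
            gcongr
          · exact hΛ n j hj'
          · exact (norm_harm_le k i w).trans (by gcongr)
      _ = _ := by rw [div_pow, div_pow, pow_add]; field_simp
  have h2 : ‖∑ j ∈ Finset.range (2 * n + 1), ∑ i ∈ Finset.range (2 * k + 1),
      e (n + k) (j + i) * (Λ n j * harm k i w)‖ ≤ ((2 * n + 1 : ℕ) : ℝ) * (((2 * k + 1 : ℕ) : ℝ) *
        (K * A * ((n : ℝ) + 1) ^ 2 * ((q / r) ^ n * (a / r) ^ k))) := by
    refine (norm_sum_le_of_le _ fun j hj => norm_sum_le_of_le _ (h1 j hj)).trans_eq ?_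
    simp only [Finset.sum_const, Finset.card_range, nsmul_eq_mul]
  rw [block, norm_mul, Complex.norm_natCast]
  calc ((n + k).choose n : ℝ) * ‖∑ j ∈ Finset.range (2 * n + 1), ∑ i ∈ Finset.range (2 * k + 1),
      e (n + k) (j + i) * (Λ n j * harm k i w)‖
      ≤ ((n + k).choose n : ℝ) * (((2 * n + 1 : ℕ) : ℝ) * (((2 * k + 1 : ℕ) : ℝ) *
        (K * A * ((n : ℝ) + 1) ^ 2 * ((q / r) ^ n * (a / r) ^ k)))) := by gcongr
    _ = ((2 * n + 1 : ℕ) : ℝ) * ((2 * k + 1 : ℕ) : ℝ) * ((n : ℝ) + 1) ^ 2 * (K * A *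
        (((n + k).choose n : ℝ) * ((q / r) ^ n * (a / r) ^ k))) := by ring
    _ ≤ (4 * ((n + k : ℕ) + 1) ^ 4) * (K * A *
        (((n + k).choose n : ℝ) * ((q / r) ^ n * (a / r) ^ k))) := by
        refine mul_le_mul_of_nonneg_right ?_ (by positivity)
        have h3 : ((2 * n + 1 : ℕ) : ℝ) ≤ 2 * ((n + k : ℕ) + 1) := by
          push_cast; linarith [Nat.cast_nonneg (α := ℝ) k]
        have h4 : ((2 * k + 1 : ℕ) : ℝ) ≤ 2 * ((n + k : ℕ) + 1) := by
          push_cast; linarith [Nat.cast_nonneg (α := ℝ) n]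
        have h5 : (n : ℝ) + 1 ≤ (n + k : ℕ) + 1 := by
          push_cast; linarith [Nat.cast_nonneg (α := ℝ) k]
        calc ((2 * n + 1 : ℕ) : ℝ) * ((2 * k + 1 : ℕ) : ℝ) * ((n : ℝ) + 1) ^ 2
            ≤ (2 * ((n + k : ℕ) + 1)) * (2 * ((n + k : ℕ) + 1)) * ((n + k : ℕ) + 1) ^ 2 := by gcongr
          _ = _ := by ring
    _ = _ := by ring

/-- The binomial theorem sums the bounds for `n + k = N` to a power of `(q + a)/r`. -/
lemma sum_norm_block_le (hK : 0 ≤ K) (hA : 0 ≤ A) (hq : 0 ≤ q) (hr : 0 < r)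
    (he : ∀ N, ∀ J ≤ 2 * N, ‖e N J‖ ≤ K * (wt N J * (r ^ N)⁻¹))
    (hΛ : ∀ n, ∀ j ≤ 2 * n, ‖Λ n j‖ ≤ A * ((n : ℝ) + 1) ^ 2 * q ^ n / wt n j)
    {w : Space} (hw : ‖w‖ ≤ a) (N : ℕ) :
    ∑ n ∈ Finset.range (N + 1), ‖block e Λ w n (N - n)‖ ≤
      4 * K * A * ((N : ℝ) + 1) ^ 4 * ((q + a) / r) ^ N := by
  rw [add_div, add_pow (q / r), Finset.mul_sum]
  refine Finset.sum_le_sum fun n hn => ?_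
  have h := norm_block_le hK hA hq hr he hΛ hw n (N - n)
  have h1 : n + (N - n) = N := by simp at hn; omega
  rwa [h1] at h

/-- Truncation of the expansion to the degrees at most `p`: the error decays geometrically. -/
lemma exists_truncation_bound (hK : 0 ≤ K) (hq : 0 < q) (ha : 0 ≤ a) (hqa : q + a < r)
    (he : ∀ N, ∀ J ≤ 2 * N, ‖e N J‖ ≤ K * (wt N J * (r ^ N)⁻¹)) :
    ∃ C ρ : ℝ, 0 ≤ C ∧ 0 < ρ ∧ ρ < 1 ∧ ∀ (A : ℝ) (Λ : ℕ → ℕ → ℂ) (w : Space) (y : ℂ) (p : ℕ),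
      0 ≤ A → (∀ n, ∀ j ≤ 2 * n, ‖Λ n j‖ ≤ A * ((n : ℝ) + 1) ^ 2 * q ^ n / wt n j) → ‖w‖ ≤ a →
      HasSum (fun N => ∑ n ∈ Finset.range (N + 1), block e Λ w n (N - n)) y →
      ‖y - ∑ k ∈ Finset.range (p + 1), ∑ i ∈ Finset.range (2 * k + 1),
        locCoef e Λ p k i * harm k i w‖ ≤ C * A * ρ ^ p := by
  have hr : 0 < r := by linarith
  -- A ratio strictly above `(q + a)/r` leaves room for the polynomial factor `(N + 1)^4`.
  obtain ⟨ρ, hρ1, hρ2⟩ := exists_between ((div_lt_one hr).2 hqa)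
  have hx : 0 < (q + a) / r := by positivity
  have hρ0 : 0 < ρ := hx.trans hρ1
  have hs := summable_linear_mul_geometric (x := ((q + a) / r) / ρ) (by positivity)
    ((div_lt_one hρ0).2 hρ1) 4
  refine ⟨4 * K * ∑' N : ℕ, ((N : ℝ) + 1) ^ 4 * (((q + a) / r) / ρ) ^ N, ρ,
    mul_nonneg (by positivity) (tsum_nonneg fun N => by positivity), hρ0, hρ2, ?_⟩
  intro A Λ w y p hA hΛ hw hy
  -- The part retained by truncating source and target degrees to at most `p`, grouped by total
  -- degree; it contains all of `N ≤ p` and nothing of `N > 2p`.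
  set t' : ℕ → ℂ := fun N => ∑ n ∈ Finset.range (N + 1),
    if n ≤ p ∧ N - n ≤ p then block e Λ w n (N - n) else 0 with ht'
  have h1 : HasSum t' (∑ k ∈ Finset.range (p + 1), ∑ i ∈ Finset.range (2 * k + 1),
        locCoef e Λ p k i * harm k i w) := by
    have h2 : ∀ N ∉ Finset.range (2 * p + 1), t' N = 0 := by
      intro N hN
      simp only [Finset.mem_range, not_lt] at hN
      refine Finset.sum_eq_zero fun n hn => if_neg ?_
      rintro ⟨h3, h4⟩
      omega
    have h3 := hasSum_sum_of_ne_finset_zero (L := SummationFilter.unconditional ℕ) h2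
    refine hasSum_of_eq h3 ?_
    simp only [← sum_block_eq]
    rw [Finset.sum_comm, ← Finset.sum_product', ← Finset.sum_fiberwise_of_maps_to
      (t := Finset.range (2 * p + 1)) (g := fun x : ℕ × ℕ => x.1 + x.2)
      (by intro x hx; simp at hx ⊢; omega)]
    refine Finset.sum_congr rfl fun N hN => ?_
    simp only [ht']
    rw [← Finset.sum_filter]
    refine Finset.sum_bij' (fun n _ => (n, N - n)) (fun x _ => x.1) ?_ ?_ ?_ ?_ ?_
    · intro n hn
      simp at hn ⊢
      omega
    · intro x hx
      simp at hx ⊢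
      omega
    · intro n hn; rfl
    · rintro ⟨n, k⟩ hx
      simp at hx ⊢
      omega
    · intro n hn; rfl
  have h4 := hy.sub h1
  have h5 : ∀ N, ‖(∑ n ∈ Finset.range (N + 1), block e Λ w n (N - n)) - t' N‖ ≤
      (4 * K * A * ρ ^ p) * (((N : ℝ) + 1) ^ 4 * (((q + a) / r) / ρ) ^ N) := by
    intro N
    simp only [ht', ← Finset.sum_sub_distrib]
    rcases le_or_gt N p with hN | hN
    · rw [Finset.sum_eq_zero]
      · rw [norm_zero]; positivity
      · intro n hn
        simp at hn
        rw [if_pos (by omega), sub_self]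
    · refine ((norm_sum_le _ _).trans (Finset.sum_le_sum fun n hn => ?_)).trans
        ((sum_norm_block_le hK hA hq.le hr he hΛ hw N).trans ?_)
      · split_ifs
        · simp
        · simp
      · have h6 : ((q + a) / r) ^ N ≤ ρ ^ p * (((q + a) / r) / ρ) ^ N := by
          have : ((q + a) / r) ^ N = ρ ^ N * (((q + a) / r) / ρ) ^ N := by
            rw [← mul_pow]; congr 1; field_simp
          rw [this]
          refine mul_le_mul_of_nonneg_right ?_ (by positivity)
          exact pow_le_pow_of_le_one hρ0.le hρ2.le hN.le
        calc 4 * K * A * ((N : ℝ) + 1) ^ 4 * ((q + a) / r) ^ N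
            ≤ 4 * K * A * ((N : ℝ) + 1) ^ 4 * (ρ ^ p * (((q + a) / r) / ρ) ^ N) := by gcongr
          _ = _ := by ring
  have h6 := tsum_of_norm_bounded (hs.mul_left (4 * K * A * ρ ^ p)).hasSum h5
  rw [h4.tsum_eq, tsum_mul_left] at h6
  refine h6.trans_eq ?_
  ring

end HalfSpace

end

/-! ### The expansion of the dipole field -/

noncomputable section

namespace HalfSpace

open Polynomial Complex Filter Topology

/-- Reflection in the horizontal plane. -/
def flip (v : Space) : Space := !₂[v 0, v 1, -v 2]

lemma norm_flip (v : Space) : ‖flip v‖ = ‖v‖ := by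
  have h : ‖flip v‖ ^ 2 = ‖v‖ ^ 2 := by
    rw [norm_sq_space, norm_sq_space]; simp [flip]
  exact (pow_left_inj₀ (norm_nonneg _) (norm_nonneg _) two_ne_zero).1 h

lemma harm_flip (n j : ℕ) (v : Space) : harm n j (flip v) = (-1) ^ j * harm n j v := by
  have h : quad (flip v) = (quad v).comp (C (-1) * X) := by
    simp [quad, quadPoly, flip, hor]
  rw [harm, h, ← pow_comp, comp_C_mul_X_coeff, harm, mul_comm]

lemma okada_eq (S T w w' : Space) : okada (T + w') (S + w) = okada T S + flip (w' - w) := by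
  ext i
  fin_cases i <;> simp [okada, flip] <;> ring

lemma norm_okada (S T : Space) : ‖okada T S‖ = dist S T := by
  have h : okada T S = flip (T - S) := by ext i; fin_cases i <;> simp [okada, flip]
  rw [h, norm_flip, dist_comm, dist_eq_norm]

/-- The coefficients of the expansion of `v ↦ potB (b + flip v)` in solid harmonics. -/
def flipCoef (b : Space) (N J : ℕ) : ℂ := (-1) ^ J * potBCoef b N J

lemma exists_norm_flipCoef_le {b : Space} (hb : 0 < b 2) :
    ∃ K, 0 ≤ K ∧ ∀ N J, ‖flipCoef b N J‖ ≤ K * (wt N J * (‖b‖ ^ N)⁻¹) := by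
  obtain ⟨K, hK, h⟩ := exists_norm_potBCoef_le hb
  exact ⟨K, hK, fun N J => by simpa [flipCoef] using h N J⟩

lemma hasSum_potB_flip {b v : Space} (hb : 0 < b 2) (hv : ‖v‖ < ‖b‖) :
    HasSum (fun N => ∑ J ∈ Finset.range (2 * N + 1), flipCoef b N J * harm N J v)
      (potB (b + flip v) : ℂ) := by
  have h := hasSum_potB hb (v := flip v) (by rwa [norm_flip])
  have h' : (fun N => ∑ J ∈ Finset.range (2 * N + 1), flipCoef b N J * harm N J v) =
      fun N => ∑ J ∈ Finset.range (2 * N + 1), potBCoef b N J * harm N J (flip v) := by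
    funext N
    refine Finset.sum_congr rfl fun J _ => ?_
    rw [harm_flip, flipCoef]; ring
  rwa [h']

lemma sum_harm_add (e : ℕ → ℕ → ℂ) (v w : Space) (N : ℕ) :
    ∑ J ∈ Finset.range (2 * N + 1), e N J * harm N J (v + w) =
      ∑ n ∈ Finset.range (N + 1), block e (fun n j => harm n j v) w n (N - n) := by
  simp only [harm_add, Finset.mul_sum (s := Finset.range (N + 1))]
  rw [Finset.sum_comm]
  refine Finset.sum_congr rfl fun n hn => ?_
  have hN : n + (N - n) = N := by simp at hn; omega
  have h := sum_antidiagonal_eq (A := fun j => harm n j v) (B := fun i => harm (N - n) i w)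
    (e := e N) (n := n) (k := N - n) (fun j hj => harm_eq_zero hj _) (fun j hj => harm_eq_zero hj _)
  rw [block, hN]
  rw [hN] at h
  rw [← h, Finset.mul_sum]
  exact Finset.sum_congr rfl fun J _ => by ring

lemma hasDerivAt_harm_line (n j : ℕ) (v F : Space) :
    HasDerivAt (fun τ : ℝ => harm n j (v + τ • F)) (harmD n j v F) 0 := by
  have h1 : HasDerivAt (fun τ : ℝ => v + τ • F) F 0 := by
    simpa using ((hasDerivAt_id (0 : ℝ)).smul_const F).const_add v
  have h2 : HasFDerivAt (harm n j) (harmCLM n j v) (v + (0 : ℝ) • F) := by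
    simpa using hasFDerivAt_harm n j v
  exact h2.comp_hasDerivAt 0 h1

/-- Both sides are derivatives of the two sides of `sum_harm_add` as `v` moves along `F`. -/
lemma sum_harmD_add (e : ℕ → ℕ → ℂ) (v w F : Space) (N : ℕ) :
    ∑ J ∈ Finset.range (2 * N + 1), e N J * harmD N J (v + w) F =
      ∑ n ∈ Finset.range (N + 1), block e (fun n j => harmD n j v F) w n (N - n) := by
  have h1 : HasDerivAt (fun τ : ℝ => ∑ J ∈ Finset.range (2 * N + 1),
      e N J * harm N J (v + w + τ • F))
      (∑ J ∈ Finset.range (2 * N + 1), e N J * harmD N J (v + w) F) 0 :=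
    HasDerivAt.fun_sum fun J _ => (hasDerivAt_harm_line N J (v + w) F).const_mul _
  have h2 : HasDerivAt (fun τ : ℝ => ∑ n ∈ Finset.range (N + 1),
      block e (fun n j => harm n j (v + τ • F)) w n (N - n))
      (∑ n ∈ Finset.range (N + 1), block e (fun n j => harmD n j v F) w n (N - n)) 0 := by
    refine HasDerivAt.fun_sum fun n _ => ?_
    unfold block
    refine HasDerivAt.const_mul _ ?_
    refine HasDerivAt.fun_sum fun j _ => HasDerivAt.fun_sum fun i _ => ?_
    exact ((hasDerivAt_harm_line n j v F).mul_const _).const_mul _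
  have h3 : (fun τ : ℝ => ∑ J ∈ Finset.range (2 * N + 1), e N J * harm N J (v + w + τ • F)) =
      fun τ : ℝ => ∑ n ∈ Finset.range (N + 1),
        block e (fun n j => harm n j (v + τ • F)) w n (N - n) := by
    funext τ
    rw [← sum_harm_add, add_right_comm]
  rw [h3] at h1
  exact h1.unique h2

lemma block_finset_sum {ι : Type*} (s : Finset ι) (e : ℕ → ℕ → ℂ) (Λ : ι → ℕ → ℕ → ℂ) (w : Space)
    (n k : ℕ) : block e (fun n j => ∑ i ∈ s, Λ i n j) w n k = ∑ i ∈ s, block e (Λ i) w n k := by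
  simp only [block, Finset.sum_mul, Finset.mul_sum]
  rw [Finset.sum_comm (s := s)]
  refine Finset.sum_congr rfl fun j _ => ?_
  rw [Finset.sum_comm (s := s)]

lemma block_add (e Λ Λ' : ℕ → ℕ → ℂ) (w : Space) (n k : ℕ) :
    block e (fun n j => Λ n j + Λ' n j) w n k = block e Λ w n k + block e Λ' w n k := by
  simp only [block, add_mul, mul_add, Finset.sum_add_distrib]

/-- The values of a sum of dipoles at the solid harmonics. -/
def dipole {N : ℕ} (S : Space) (F Q : Fin N → Space) (n j : ℕ) : ℂ :=
  ∑ i, harmD n j (S - Q i) (-F i)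

/-- The kernel depends on `x - T - (y - S)`, so the gradient in `y` is minus the termwise derivative
of its expansion; this is the sign of `-F i` in `dipole`. -/
lemma hasSum_PhiB {N : ℕ} {S T x : Space} {F Q : Fin N → Space} (hb : 0 < okada T S 2)
    (hQ : ∀ i, ‖x - T - (Q i - S)‖ < ‖okada T S‖) :
    HasSum (fun N => ∑ n ∈ Finset.range (N + 1),
      block (flipCoef (okada T S)) (dipole S F Q) (x - T) n (N - n)) (PhiB F Q x : ℂ) := by
  obtain ⟨K, hK, hKb⟩ := exists_norm_flipCoef_le hb
  have key : ∀ i, HasSum (fun N => ∑ n ∈ Finset.range (N + 1),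
      block (flipCoef (okada T S)) (fun n j => harmD n j (S - Q i) (-F i)) (x - T) n (N - n))
      (fderiv ℝ (fun y : Space => potB (okada x y)) (Q i) (F i) : ℂ) := by
    intro i
    obtain ⟨L, hL, hLF⟩ := hasFDerivAt_of_hasSum hK (fun N J _ => hKb N J)
      (fun v hv => hasSum_potB_flip hb hv) (hQ i)
    have hx : ∀ y, okada x y = okada T S + flip (x - T - (y - S)) := by
      intro y
      rw [← okada_eq]; simp
    have h1 : HasFDerivAt (fun y : Space => x - T - (y - S)) (-ContinuousLinearMap.id ℝ Space)
        (Q i) := ((hasFDerivAt_id (Q i)).sub_const S).const_sub (x - T)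
    have h2 : HasFDerivAt (fun y : Space => (potB (okada x y) : ℂ))
        (L.comp (-ContinuousLinearMap.id ℝ Space)) (Q i) := by
      simp only [hx]
      exact HasFDerivAt.comp (g := fun v => (potB (okada T S + flip v) : ℂ)) (Q i) hL h1
    -- The expansion differentiates the complexified kernel. The real part supplies the real
    -- derivative, and uniqueness shows that nothing is lost by it.
    have h3 : HasFDerivAt (fun y : Space => potB (okada x y))
        (reCLM.comp (L.comp (-ContinuousLinearMap.id ℝ Space))) (Q i) :=
      (reCLM.hasFDerivAt).comp (Q i) h2
    have h4 : HasFDerivAt (fun y : Space => (potB (okada x y) : ℂ))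
        (ofRealCLM.comp (reCLM.comp (L.comp (-ContinuousLinearMap.id ℝ Space)))) (Q i) :=
      (ofRealCLM.hasFDerivAt).comp (Q i) h3
    have h5 : (fderiv ℝ (fun y : Space => potB (okada x y)) (Q i) (F i) : ℂ) = L (-F i) := by
      rw [h3.fderiv]
      have := congrArg (fun f : Space →L[ℝ] ℂ => f (F i)) (h4.unique h2)
      simpa using this
    rw [h5]
    have h6 := hLF (-F i)
    have h7 : x - T - (Q i - S) = (S - Q i) + (x - T) := by abel
    simp only [h7, sum_harmD_add] at h6
    exact h6
  have h := hasSum_sum (s := Finset.univ) fun i _ => key i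
  have h' : (fun N' => ∑ n ∈ Finset.range (N' + 1),
      block (flipCoef (okada T S)) (dipole S F Q) (x - T) n (N' - n)) =
      fun N' => ∑ i, ∑ n ∈ Finset.range (N' + 1),
      block (flipCoef (okada T S)) (fun n j => harmD n j (S - Q i) (-F i)) (x - T) n (N' - n) := by
    funext N'
    rw [Finset.sum_comm]
    exact Finset.sum_congr rfl fun n _ => block_finset_sum _ _ _ _ _ _
  rw [h', PhiB, ofReal_sum]
  exact h

end HalfSpace

end

/-! ### The expansion of the ring field -/

noncomputable section

namespace HalfSpace

open Polynomial Complex Filter Topology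

lemma continuous_harm (n j : ℕ) : Continuous (harm n j) :=
  continuous_iff_continuousAt.2 fun w => (hasFDerivAt_harm n j w).continuousAt

@[fun_prop] lemma continuous_ringPoint (S : Space) (R θ : ℝ) : Continuous (ringPoint S R θ) := by
  unfold ringPoint
  refine continuous_const.add (Continuous.const_smul ?_ R)
  refine (PiLp.continuous_toLp 2 _).comp (continuous_pi fun i => ?_)
  fin_cases i <;> simp <;> fun_prop

@[fun_prop] lemma continuous_ringDensity (p : ℕ) (s : ℤ → ℂ) : Continuous (ringDensity p s) := by
  unfold ringDensity
  fun_prop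

lemma norm_ringPoint_sub {R : ℝ} (hR : 0 ≤ R) (S : Space) (θ φ : ℝ) :
    ‖ringPoint S R θ φ - S‖ = R := by
  have h : ‖ringPoint S R θ φ - S‖ ^ 2 = R ^ 2 := by
    rw [norm_sq_space]
    simp [ringPoint]
    linear_combination R ^ 2 * Real.sin θ ^ 2 * Real.sin_sq_add_cos_sq φ +
      R ^ 2 * Real.sin_sq_add_cos_sq θ
  exact (pow_left_inj₀ (norm_nonneg _) hR two_ne_zero).1 h

/-- The values of a ring of charge at the solid harmonics. -/
def ringMoment (S : Space) (R θ : ℝ) (p : ℕ) (s : ℤ → ℂ) (n j : ℕ) : ℂ :=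
  ringIntegral S R θ p s (fun y => harm n j (S - y))

lemma ringIntegral_block (S : Space) (R θ : ℝ) (p : ℕ) (s : ℤ → ℂ) (e : ℕ → ℕ → ℂ) (w : Space)
    (n k : ℕ) : ringIntegral S R θ p s (fun y => block e (fun n j => harm n j (S - y)) w n k) =
      block e (ringMoment S R θ p s) w n k := by
  have hc : ∀ j, Continuous fun φ => harm n j (S - ringPoint S R θ φ) := fun j =>
    (continuous_harm n j).comp (continuous_const.sub (continuous_ringPoint S R θ))
  unfold ringMoment ringIntegral block
  simp only [Finset.mul_sum, Finset.sum_mul]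
  rw [intervalIntegral.integral_finsetSum]
  · refine Finset.sum_congr rfl fun j _ => ?_
    rw [intervalIntegral.integral_finsetSum]
    · refine Finset.sum_congr rfl fun i _ => ?_
      rw [← intervalIntegral.integral_mul_const, ← intervalIntegral.integral_const_mul,
        ← intervalIntegral.integral_const_mul]
      congr 1
      funext φ
      ring
    · intro i _
      apply Continuous.intervalIntegrable
      have := hc j
      fun_prop
  · intro j _
    apply Continuous.intervalIntegrable
    have := hc j
    fun_prop

lemma ringIntegral_finset_sum {ι : Type*} (t : Finset ι) (S : Space) (R θ : ℝ) (p : ℕ) (s : ℤ → ℂ)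
    {g : ι → Space → ℂ} (hg : ∀ i ∈ t, Continuous (g i)) :
    ringIntegral S R θ p s (fun y => ∑ i ∈ t, g i y) = ∑ i ∈ t, ringIntegral S R θ p s (g i) := by
  unfold ringIntegral
  simp only [Finset.sum_mul]
  rw [intervalIntegral.integral_finsetSum]
  intro i hi
  apply Continuous.intervalIntegrable
  have := (hg i hi).comp (continuous_ringPoint S R θ)
  simp only [Function.comp_def] at this
  fun_prop

lemma continuous_block_harm (e : ℕ → ℕ → ℂ) (S w : Space) (n k : ℕ) :
    Continuous fun y => block e (fun n j => harm n j (S - y)) w n k := by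
  have := fun j => (continuous_harm n j).comp (continuous_const.sub continuous_id : Continuous
    fun y : Space => S - y)
  simp only [Function.comp_def] at this
  unfold block
  fun_prop

/-- On the ring the displacement stays in a ball strictly inside the region of convergence, so the
series is uniformly dominated and may be integrated term by term. -/
lemma hasSum_ringIntegral {S T x : Space} {R θ ρ : ℝ} (p : ℕ) (s : ℤ → ℂ) (hb : 0 < okada T S 2)
    (hρ : ∀ φ, ‖x - T - (ringPoint S R θ φ - S)‖ ≤ ρ) (hρb : ρ < ‖okada T S‖) :
    HasSum (fun N => ∑ n ∈ Finset.range (N + 1),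
      block (flipCoef (okada T S)) (ringMoment S R θ p s) (x - T) n (N - n))
      (ringIntegral S R θ p s (fun y => (potB (okada x y) : ℂ))) := by
  obtain ⟨K, hK, hKb⟩ := exists_norm_flipCoef_le hb
  have hb0 := norm_pos_of_pos hb
  have hρ0 : 0 ≤ ρ := (norm_nonneg _).trans (hρ 0)
  set G : ℕ → Space → ℂ := fun N y => ∑ n ∈ Finset.range (N + 1),
    block (flipCoef (okada T S)) (fun n j => harm n j (S - y)) (x - T) n (N - n) with hG
  have hGc : ∀ N, Continuous (G N) := fun N =>
    continuous_finsetSum _ fun n _ => continuous_block_harm _ _ _ _ _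
  have hGe : ∀ N y, G N y = ∑ J ∈ Finset.range (2 * N + 1),
      flipCoef (okada T S) N J * harm N J (x - T - (y - S)) := by
    intro N y
    rw [hG, show x - T - (y - S) = (S - y) + (x - T) by abel, sum_harm_add]
  have hGn : ∀ N φ, ‖G N (ringPoint S R θ φ)‖ ≤
      (2 * K) * (((N : ℝ) + 1) ^ 1 * (ρ / ‖okada T S‖) ^ N) := by
    intro N φ
    rw [hGe]
    refine (norm_sum_le_of_le (n := fun _ => K * (ρ / ‖okada T S‖) ^ N) _ fun J _ => ?_).trans ?_
    · rw [norm_mul]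
      have hw := wt_pos N J
      calc _ ≤ (K * (wt N J * (‖okada T S‖ ^ N)⁻¹)) * (ρ ^ N / wt N J) := by
            gcongr
            · exact hKb N J
            · exact (norm_harm_le N J _).trans (by gcongr; exact hρ φ)
        _ = _ := by rw [div_pow]; field_simp
    · rw [Finset.sum_const, Finset.card_range, nsmul_eq_mul]
      have : ((2 * N + 1 : ℕ) : ℝ) ≤ 2 * ((N : ℝ) + 1) := by push_cast; linarith
      calc _ ≤ 2 * ((N : ℝ) + 1) * (K * (ρ / ‖okada T S‖) ^ N) := by gcongr
        _ = _ := by ring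
  have hsum := (summable_linear_mul_geometric (x := ρ / ‖okada T S‖) (by positivity)
    ((div_lt_one hb0).2 hρb) 1).mul_left (2 * K)
  set d : ℝ → ℂ := fun φ => ringDensity p s φ * ((R * Real.sin θ : ℝ) : ℂ) with hd
  have hdc : Continuous d := by fun_prop
  have h : HasSum (fun N => ringIntegral S R θ p s (G N))
      (ringIntegral S R θ p s (fun y => (potB (okada x y) : ℂ))) := by
    unfold ringIntegral
    refine intervalIntegral.hasSum_integral_of_dominated_convergence
      (fun N φ => (2 * K) * (((N : ℝ) + 1) ^ 1 * (ρ / ‖okada T S‖) ^ N) * ‖d φ‖) ?_ ?_ ?_ ?_ ?_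
    · intro N
      apply Continuous.aestronglyMeasurable
      have := (hGc N).comp (continuous_ringPoint S R θ)
      simp only [Function.comp_def] at this
      fun_prop
    · refine fun N => Eventually.of_forall fun φ _ => ?_
      rw [mul_assoc, norm_mul]
      exact mul_le_mul_of_nonneg_right (hGn N φ) (norm_nonneg _)
    · exact Eventually.of_forall fun φ _ => hsum.mul_right _
    · simp only [tsum_mul_right]
      apply Continuous.intervalIntegrable
      fun_prop
    · refine Eventually.of_forall fun φ _ => ?_
      refine HasSum.mul_right _ (HasSum.mul_right _ ?_)
      have h1 := hasSum_potB_flip hb ((hρ φ).trans_lt hρb)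
      rw [← okada_eq] at h1
      simp only [← hGe] at h1
      simpa using h1
  have h' : (fun N => ringIntegral S R θ p s (G N)) = fun N => ∑ n ∈ Finset.range (N + 1),
      block (flipCoef (okada T S)) (ringMoment S R θ p s) (x - T) n (N - n) := by
    funext N
    rw [hG, ringIntegral_finset_sum _ _ _ _ _ _ fun n _ => continuous_block_harm _ _ _ _ _]
    exact Finset.sum_congr rfl fun n _ => ringIntegral_block _ _ _ _ _ _ _ _ _
  rwa [h'] at h

lemma integral_exp_int (k : ℤ) :
    ∫ φ in (0 : ℝ)..(2 * Real.pi), Complex.exp (Complex.I * k * φ) =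
      if k = 0 then (2 * Real.pi : ℂ) else 0 := by
  split_ifs with h
  · subst h; simp
  · have h1 : (Complex.I * k : ℂ) ≠ 0 := mul_ne_zero I_ne_zero (by exact_mod_cast h)
    rw [integral_exp_mul_complex h1]
    have h2 : Complex.exp (Complex.I * k * ((2 * Real.pi : ℝ) : ℂ)) = 1 := by
      rw [Complex.exp_eq_one_iff]
      exact ⟨k, by push_cast; ring⟩
    rw [h2]; simp

/-- The point with longitude `0` on the circle of latitude `θ`. -/
def meridian (R θ : ℝ) : Space := !₂[R * Real.sin θ, 0, R * Real.cos θ]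

lemma norm_meridian {R : ℝ} (hR : 0 ≤ R) (θ : ℝ) : ‖meridian R θ‖ = R := by
  have h : ‖meridian R θ‖ ^ 2 = R ^ 2 := by
    rw [norm_sq_space]
    simp [meridian]
    linear_combination R ^ 2 * Real.sin_sq_add_cos_sq θ
  exact (pow_left_inj₀ (norm_nonneg _) hR two_ne_zero).1 h

/-- Rotation by `φ` about the vertical axis multiplies the spinor components by the half-angle
phases `e^(±iφ/2)`; homogeneity gives the phase of order `j - n`. -/
lemma harm_ringPoint (S : Space) (R θ φ : ℝ) {n j : ℕ} (hj : j ≤ 2 * n) :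
    harm n j (ringPoint S R θ φ - S) =
      Complex.exp (Complex.I * ((j : ℤ) - n : ℤ) * φ) * harm n j (meridian R θ) := by
  have hh : hor (ringPoint S R θ φ - S) = (R * Real.sin θ : ℝ) * Complex.exp (φ * I) := by
    rw [Complex.exp_mul_I]
    apply Complex.ext <;> simp [hor, ringPoint, ← Complex.ofReal_cos, ← Complex.ofReal_sin] <;> ring
  have hs : Complex.exp (φ / 2 * I) * Complex.exp (-(φ / 2 * I)) = 1 := by
    rw [← Complex.exp_add]; simp
  have h1 : quad (ringPoint S R θ φ - S) =
      quadPoly (-(starRingEnd ℂ) (hor (meridian R θ)) / 2 * Complex.exp (-(φ / 2 * I)) ^ 2)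
        ((meridian R θ 2 : ℝ) * (Complex.exp (φ / 2 * I) * Complex.exp (-(φ / 2 * I))))
        (hor (meridian R θ) / 2 * Complex.exp (φ / 2 * I) ^ 2) := by
    have e1 : hor (meridian R θ) = (R * Real.sin θ : ℝ) := by
      apply Complex.ext <;> simp [hor, meridian, -ofReal_mul, -ofReal_sin]
    have e2 : Complex.exp (φ / 2 * I) ^ 2 = Complex.exp (φ * I) := by
      rw [← Complex.exp_nat_mul]; congr 1; push_cast; ring
    have e3 : Complex.exp (-(φ / 2 * I)) ^ 2 = (starRingEnd ℂ) (Complex.exp (φ * I)) := by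
      rw [← Complex.exp_nat_mul, ← Complex.exp_conj]; congr 1; simp; ring
    rw [hs, e1, e2, e3, quad, hh, map_mul, Complex.conj_ofReal]
    congr 1
    · ring
    · simp [ringPoint, meridian]
    · ring
  rw [harm, h1, coeff_quadPoly_pow_homogeneous _ _ _ _ _ _ _ hj, ← Complex.exp_nat_mul,
    ← Complex.exp_nat_mul, ← Complex.exp_add, mul_comm]
  congr 2
  rw [Nat.cast_sub hj]
  push_cast
  ring

/-- Orthogonality of the exponentials: each moment sees a single Fourier coefficient of the density.
-/
lemma ringMoment_eq (S : Space) (R θ : ℝ) (p : ℕ) (s : ℤ → ℂ) {n j : ℕ} (hj : j ≤ 2 * n) :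
    ringMoment S R θ p s n j = (-1) ^ n * harm n j (meridian R θ) *
      (2 * Real.pi * (R * Real.sin θ : ℝ)) *
        if |(n : ℤ) - j| ≤ p then s (n - j) else 0 := by
  have h1 : ∀ φ : ℝ, harm n j (S - ringPoint S R θ φ) * ringDensity p s φ *
      ((R * Real.sin θ : ℝ) : ℂ) = ∑ m ∈ Finset.Icc (-(p : ℤ)) p,
        ((-1) ^ n * harm n j (meridian R θ) * ((R * Real.sin θ : ℝ) : ℂ) * s m) *
          Complex.exp (Complex.I * ((j : ℤ) - n + m : ℤ) * φ) := by
    intro φ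
    rw [← neg_sub, harm_neg, harm_ringPoint S R θ φ hj, ringDensity, Finset.mul_sum, Finset.sum_mul]
    refine Finset.sum_congr rfl fun m _ => ?_
    have : Complex.exp (Complex.I * ((j : ℤ) - n + m : ℤ) * φ) =
        Complex.exp (Complex.I * ((j : ℤ) - n : ℤ) * φ) * Complex.exp (Complex.I * m * φ) := by
      rw [← Complex.exp_add]; congr 1; push_cast; ring
    rw [this]; ring
  unfold ringMoment ringIntegral
  simp only [h1]
  rw [intervalIntegral.integral_finsetSum]
  · simp only [intervalIntegral.integral_const_mul, integral_exp_int]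
    have h2 : ∀ m : ℤ, ((j : ℤ) - n + m = 0) = ((n : ℤ) - j = m) := fun m => by
      rw [eq_iff_iff]; omega
    simp only [h2, mul_ite, mul_zero]
    rw [Finset.sum_ite_eq]
    simp only [Finset.mem_Icc, ← abs_le]
    split_ifs <;> ring
  · intro m _
    apply Continuous.intervalIntegrable
    fun_prop

end HalfSpace

end

/-! ### Harmonics of extremal order and the equations for the densities -/

noncomputable section

namespace HalfSpace

open Polynomial Complex Filter Topology

lemma coeff_one_quadPoly_pow (γ α β : ℂ) (n : ℕ) :
    (quadPoly γ α β ^ n).coeff 1 = n * α * γ ^ (n - 1) := by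
  induction n with
  | zero => simp [coeff_one]
  | succ n ih =>
    rw [pow_succ', coeff_quadPoly_mul_one, ih, coeff_quadPoly_pow_zero]
    rcases n with _ | n
    · simp
    · simp only [Nat.add_sub_cancel]; push_cast; ring

/-- Reflection in the plane `x₁ = 0`. -/
def mirror (w : Space) : Space := !₂[-w 0, w 1, w 2]

lemma norm_mirror (w : Space) : ‖mirror w‖ = ‖w‖ := by
  have h : ‖mirror w‖ ^ 2 = ‖w‖ ^ 2 := by
    rw [norm_sq_space, norm_sq_space]; simp [mirror]
  exact (pow_left_inj₀ (norm_nonneg _) (norm_nonneg _) two_ne_zero).1 h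

@[simp] lemma hor_mirror (w : Space) : hor (mirror w) = -(starRingEnd ℂ) (hor w) := by
  apply Complex.ext <;> simp [hor, mirror]

@[simp] lemma mirror_two (w : Space) : mirror w 2 = w 2 := by simp [mirror]

lemma mirror_add_smul (w v : Space) (τ : ℝ) : mirror (w + τ • v) = mirror w + τ • mirror v := by
  ext i; fin_cases i <;> (simp [mirror]; try ring)

lemma harm_mirror {n j : ℕ} (hj : j ≤ 2 * n) (w : Space) :
    harm n j (mirror w) = harm n (2 * n - j) w := by
  rw [harm, harm, quad, quad, coeff_quadPoly_pow_reverse _ _ _ hj, hor_mirror, mirror_two]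
  simp

lemma harmD_mirror {n j : ℕ} (hj : j ≤ 2 * n) (w v : Space) :
    harmD n j (mirror w) (mirror v) = harmD n (2 * n - j) w v := by
  have h := hasDerivAt_harm_line n j (mirror w) (mirror v)
  simp only [← mirror_add_smul, harm_mirror hj] at h
  exact h.unique (hasDerivAt_harm_line n (2 * n - j) w v)

lemma harmD_neg_neg (n j : ℕ) (w v : Space) :
    harmD n j (-w) (-v) = (-1) ^ n * harmD n j w v := by
  have h : ∀ w, quad (-w) = C (-1) * quad w := fun w => by simpa using quad_smul (-1) w
  rcases n with _ | n
  · simp [harmD]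
  · rw [harmD, harmD, h, h, mul_pow, ← C_pow, show C (-1) * quad v * (C ((-1) ^ (n + 1 - 1)) *
      quad w ^ (n + 1 - 1)) = C ((-1) ^ (n + 1)) * (quad v * quad w ^ (n + 1 - 1)) by
        rw [Nat.add_sub_cancel, pow_succ', C_mul]; ring, coeff_C_mul]
    ring

lemma norm_hor_le (w : Space) : ‖hor w‖ ≤ ‖w‖ := by
  have := norm_hor_sq w
  refine (pow_le_pow_iff_left₀ (norm_nonneg _) (norm_nonneg _) two_ne_zero).1 ?_
  nlinarith [sq_nonneg (w 2)]

lemma abs_two_le (w : Space) : |w 2| ≤ ‖w‖ := by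
  rw [← Real.norm_eq_abs]; exact PiLp.norm_apply_le w 2

/-! ### Harmonics of maximal and of next to maximal order -/

lemma norm_harm_zero (n : ℕ) (w : Space) : ‖harm n 0 w‖ = (‖hor w‖ / 2) ^ n := by
  rw [harm_zero_right]; simp

lemma norm_harm_one (n : ℕ) (w : Space) :
    ‖harm (n + 1) 1 w‖ = (n + 1) * |w 2| * (‖hor w‖ / 2) ^ n := by
  rw [harm, quad, coeff_one_quadPoly_pow, norm_mul, norm_mul, Complex.norm_natCast, norm_real,
    Real.norm_eq_abs]
  simp

lemma norm_harmD_zero_le (n : ℕ) (w v : Space) :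
    ‖harmD n 0 w v‖ ≤ n * (‖hor w‖ / 2) ^ (n - 1) * ‖v‖ := by
  rw [harmD, quad, coeff_quadPoly_mul_zero, quad, coeff_quadPoly_pow_zero]
  simp only [norm_mul, norm_pow, norm_div, norm_neg, RCLike.norm_conj, Complex.norm_natCast,
    Complex.norm_ofNat]
  have := norm_hor_le v
  have h0 := norm_nonneg (hor v)
  calc (n : ℝ) * (‖hor v‖ / 2 * (‖hor w‖ / 2) ^ (n - 1))
      ≤ (n : ℝ) * (‖v‖ * (‖hor w‖ / 2) ^ (n - 1)) := by gcongr; linarith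
    _ = _ := by ring

lemma norm_harmD_one_le (n : ℕ) (w v : Space) :
    ‖harmD (n + 1) 1 w v‖ ≤ (n + 1) * (n * |w 2| * (‖hor w‖ / 2) ^ (n - 1) +
      (‖hor w‖ / 2) ^ n) * ‖v‖ := by
  rw [harmD, quad, coeff_quadPoly_mul_one, quad, coeff_quadPoly_pow_zero, coeff_one_quadPoly_pow,
    norm_mul, Complex.norm_natCast, Nat.add_sub_cancel]
  push_cast
  have h1 := norm_hor_le v
  have h2 := abs_two_le v
  have h0 := norm_nonneg (hor v)
  have h3 : (0 : ℝ) ≤ (n : ℝ) + 1 := by positivity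
  rw [mul_assoc ((n : ℝ) + 1)]
  refine mul_le_mul_of_nonneg_left ((norm_add_le _ _).trans ?_) h3
  simp only [norm_mul, norm_pow, norm_div, norm_neg, RCLike.norm_conj, Complex.norm_natCast,
    Complex.norm_ofNat, norm_real, Real.norm_eq_abs]
  calc ‖hor v‖ / 2 * (n * |w 2| * (‖hor w‖ / 2) ^ (n - 1)) + |v 2| * (‖hor w‖ / 2) ^ n
      ≤ ‖v‖ * (n * |w 2| * (‖hor w‖ / 2) ^ (n - 1)) + ‖v‖ * (‖hor w‖ / 2) ^ n := by
        gcongr; linarith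
    _ = _ := by ring

/-- The index of the harmonic of degree `n` that is paired with the order `m`. -/
def idx (n : ℕ) (m : ℤ) : ℕ := (n - m).toNat

lemma idx_le {n : ℕ} {m : ℤ} (h : |m| ≤ n) : idx n m ≤ 2 * n := by
  have := abs_le.1 h
  unfold idx; omega

lemma sub_idx {n : ℕ} {m : ℤ} (h : |m| ≤ n) : (n : ℤ) - (idx n m : ℤ) = m := by
  have := abs_le.1 h
  unfold idx; omega

lemma idx_sub {n j : ℕ} : idx n ((n : ℤ) - j) = j := by
  unfold idx; omega

/-- Subtracting zero keeps the shape `2n - j` to which the mirror symmetry applies. -/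
lemma idx_natAbs (m : ℤ) : (idx m.natAbs m = 0 ∨ idx m.natAbs m = 2 * m.natAbs - 0) := by
  unfold idx; omega

lemma idx_natAbs_succ (m : ℤ) :
    (idx (m.natAbs + 1) m = 1 ∨ idx (m.natAbs + 1) m = 2 * (m.natAbs + 1) - 1) := by
  unfold idx; omega

lemma norm_harm_idx (m : ℤ) (w : Space) :
    ‖harm m.natAbs (idx m.natAbs m) w‖ = (‖hor w‖ / 2) ^ m.natAbs := by
  rcases idx_natAbs m with h | h <;> rw [h]
  · exact norm_harm_zero _ _
  · rw [← harm_mirror (by omega), norm_harm_zero]; simp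

lemma norm_harm_idx_succ (m : ℤ) (w : Space) :
    ‖harm (m.natAbs + 1) (idx (m.natAbs + 1) m) w‖ =
      (m.natAbs + 1) * |w 2| * (‖hor w‖ / 2) ^ m.natAbs := by
  rcases idx_natAbs_succ m with h | h <;> rw [h]
  · exact norm_harm_one _ _
  · rw [← harm_mirror (by omega), norm_harm_one]; simp

lemma norm_harmD_idx_le (m : ℤ) (w v : Space) :
    ‖harmD m.natAbs (idx m.natAbs m) w v‖ ≤
      m.natAbs * (‖hor w‖ / 2) ^ (m.natAbs - 1) * ‖v‖ := by
  rcases idx_natAbs m with h | h <;> rw [h]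
  · exact norm_harmD_zero_le _ _ _
  · rw [← harmD_mirror (by omega)]
    simpa [norm_mirror] using norm_harmD_zero_le m.natAbs (mirror w) (mirror v)

lemma norm_harmD_idx_succ_le (m : ℤ) (w v : Space) :
    ‖harmD (m.natAbs + 1) (idx (m.natAbs + 1) m) w v‖ ≤
      (m.natAbs + 1) * (m.natAbs * |w 2| * (‖hor w‖ / 2) ^ (m.natAbs - 1) +
      (‖hor w‖ / 2) ^ m.natAbs) * ‖v‖ := by
  rcases idx_natAbs_succ m with h | h <;> rw [h]
  · exact norm_harmD_one_le _ _ _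
  · rw [← harmD_mirror (by omega)]
    simpa [norm_mirror] using norm_harmD_one_le m.natAbs (mirror w) (mirror v)

/-! ### Multipole coefficients as moments -/

lemma fderiv_solidY {n : ℕ} {m : ℤ} (hm : |m| ≤ n) (w v : Space) :
    fderiv ℝ (solidY n m) w v = solCoef n m * harmD n (n + m).toNat w v := by
  have h : solidY n m = fun w => solCoef n m * harm n (n + m).toNat w :=
    funext fun w => solidY_eq hm w
  rw [h, ((hasFDerivAt_harm n (n + m).toNat w).const_mul (solCoef n m)).fderiv]
  simp

/-- The ratio of a multipole coefficient and a moment. -/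
def momentCoef (n : ℕ) (m : ℤ) : ℂ :=
  ((4 * Real.pi / (2 * n + 1) : ℝ) : ℂ) * solCoef n (-m) * (-1) ^ n

lemma momentCoef_ne_zero (n : ℕ) (m : ℤ) : momentCoef n m ≠ 0 := by
  unfold momentCoef
  refine mul_ne_zero (mul_ne_zero ?_ (solCoef_ne_zero _ _)) (pow_ne_zero _ (by norm_num))
  have := Real.pi_pos
  have h : 4 * Real.pi / (2 * n + 1) ≠ 0 := by positivity
  exact_mod_cast h

lemma neg_one_pow_mul_self (n : ℕ) : (-1 : ℂ) ^ n * (-1) ^ n = 1 := by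
  rw [← mul_pow]; simp

lemma multipoleCoeff_eq {N : ℕ} (S : Space) (F Q : Fin N → Space) {n : ℕ} {m : ℤ} (hm : |m| ≤ n) :
    multipoleCoeff S F Q n m = momentCoef n m * dipole S F Q n (idx n m) := by
  have h1 : ∀ i, harmD n (idx n m) (S - Q i) (-F i) =
      (-1) ^ n * harmD n (idx n m) (Q i - S) (F i) := fun i => by
    rw [← neg_sub, harmD_neg_neg]
  simp only [multipoleCoeff, dipole, h1, fderiv_solidY (show |(-m)| ≤ (n : ℤ) by simpa using hm)]
  rw [← Finset.mul_sum, ← Finset.mul_sum, momentCoef, idx, ← sub_eq_add_neg]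
  linear_combination -(((4 * Real.pi / (2 * n + 1) : ℝ) : ℂ) * solCoef n (-m) *
    ∑ i, harmD n (n - m).toNat (Q i - S) (F i)) * neg_one_pow_mul_self n

/-- The values of the two rings of charge at the solid harmonics. -/
def ringsMoment (S : Space) (R θ₁ : ℝ) (p : ℕ) (s₁ s₂ : ℤ → ℂ) (n j : ℕ) : ℂ :=
  ringMoment S R θ₁ p s₁ n j + ringMoment S R (Real.pi - θ₁) p s₂ n j

lemma ringIntegral_solidY (S : Space) (R θ : ℝ) (p : ℕ) (s : ℤ → ℂ) {n : ℕ} {m : ℤ}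
    (hm : |m| ≤ n) : ringIntegral S R θ p s (fun y => solidY n (-m) (y - S)) =
      solCoef n (-m) * (-1) ^ n * ringMoment S R θ p s n (idx n m) := by
  unfold ringMoment ringIntegral
  rw [← intervalIntegral.integral_const_mul]
  congr 1
  funext φ
  beta_reduce
  rw [solidY_eq (by simpa using hm), ← neg_sub (ringPoint S R θ φ), harm_neg, idx,
    ← sub_eq_add_neg]
  linear_combination -(solCoef n (-m) * harm n (n - m).toNat (ringPoint S R θ φ - S) *
    ringDensity p s φ * ((R * Real.sin θ : ℝ) : ℂ)) * neg_one_pow_mul_self n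

lemma ringCoeff_eq (S : Space) (R θ₁ : ℝ) (p : ℕ) (s₁ s₂ : ℤ → ℂ) {n : ℕ} {m : ℤ}
    (hm : |m| ≤ n) : ringCoeff S R θ₁ p s₁ s₂ n m =
      momentCoef n m * ringsMoment S R θ₁ p s₁ s₂ n (idx n m) := by
  rw [ringCoeff, ringIntegral_solidY _ _ _ _ _ hm, ringIntegral_solidY _ _ _ _ _ hm, momentCoef,
    ringsMoment]
  ring

lemma meridian_pi_sub (R θ : ℝ) : meridian R (Real.pi - θ) = flip (meridian R θ) := by
  ext i; fin_cases i <;> simp [meridian, flip]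

/-- The second ring is the reflection of the first, which changes its moments by the parity of the
index. -/
lemma ringsMoment_eq (S : Space) (R θ₁ : ℝ) (p : ℕ) (s₁ s₂ : ℤ → ℂ) {n j : ℕ} (hj : j ≤ 2 * n) :
    ringsMoment S R θ₁ p s₁ s₂ n j = (-1) ^ n * harm n j (meridian R θ₁) *
      (2 * Real.pi * (R * Real.sin θ₁ : ℝ)) *
        if |(n : ℤ) - j| ≤ p then s₁ (n - j) + (-1) ^ j * s₂ (n - j) else 0 := by
  rw [ringsMoment, ringMoment_eq _ _ _ _ _ hj, ringMoment_eq _ _ _ _ _ hj, meridian_pi_sub,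
    harm_flip, Real.sin_pi_sub]
  split_ifs <;> ring

/-- The coefficients of the equations for the densities. -/
def ringCoef (R θ₁ : ℝ) (n : ℕ) (m : ℤ) : ℂ :=
  (-1) ^ n * harm n (idx n m) (meridian R θ₁) * (2 * Real.pi * (R * Real.sin θ₁ : ℝ))

variable {S : Space} {R θ₁ : ℝ} {p : ℕ}

lemma neg_one_pow_idx (m : ℤ) : (-1 : ℂ) ^ idx m.natAbs m = 1 := by
  rcases idx_natAbs m with h | h <;> simp [h]

lemma neg_one_pow_idx_succ (m : ℤ) : (-1 : ℂ) ^ idx (m.natAbs + 1) m = -1 := by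
  rcases idx_natAbs_succ m with h | h
  · simp [h]
  · rw [h, show 2 * (m.natAbs + 1) - 1 = 2 * m.natAbs + 1 by omega, pow_succ, pow_mul]; simp

lemma abs_le_natAbs (m : ℤ) : |m| ≤ m.natAbs := by simp
lemma abs_le_natAbs_succ (m : ℤ) : |m| ≤ (m.natAbs + 1 : ℕ) := by push_cast; simp

lemma ringsMoment_natAbs (s₁ s₂ : ℤ → ℂ) {m : ℤ} (hm : |m| ≤ p) :
    ringsMoment S R θ₁ p s₁ s₂ m.natAbs (idx m.natAbs m) =
      ringCoef R θ₁ m.natAbs m * (s₁ m + s₂ m) := by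
  rw [ringsMoment_eq _ _ _ _ _ _ (idx_le (abs_le_natAbs m)), sub_idx (abs_le_natAbs m),
    if_pos hm, neg_one_pow_idx, one_mul, ringCoef]

lemma ringsMoment_natAbs_succ (s₁ s₂ : ℤ → ℂ) {m : ℤ} (hm : |m| ≤ p) :
    ringsMoment S R θ₁ p s₁ s₂ (m.natAbs + 1) (idx (m.natAbs + 1) m) =
      ringCoef R θ₁ (m.natAbs + 1) m * (s₁ m - s₂ m) := by
  rw [ringsMoment_eq _ _ _ _ _ _ (idx_le (abs_le_natAbs_succ m)), sub_idx (abs_le_natAbs_succ m),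
    if_pos hm, neg_one_pow_idx_succ, ringCoef]
  ring

lemma norm_hor_meridian (hR : 0 < R) (hs : 0 < Real.sin θ₁) :
    ‖hor (meridian R θ₁)‖ = R * Real.sin θ₁ := by
  have e1 : hor (meridian R θ₁) = (R * Real.sin θ₁ : ℝ) := by
    apply Complex.ext <;> simp [hor, meridian, -ofReal_mul, -ofReal_sin]
  rw [e1, Complex.norm_of_nonneg (by positivity)]

lemma norm_ringCoef_natAbs (hR : 0 < R) (hs : 0 < Real.sin θ₁) (m : ℤ) :
    ‖ringCoef R θ₁ m.natAbs m‖ = (R * Real.sin θ₁ / 2) ^ m.natAbs *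
      (2 * Real.pi * (R * Real.sin θ₁)) := by
  have h := Real.pi_pos
  rw [ringCoef, norm_mul, norm_mul, norm_harm_idx, norm_hor_meridian hR hs, norm_pow, norm_neg,
    norm_one, one_pow, one_mul, norm_mul, norm_mul, norm_real, norm_real, Real.norm_of_nonneg h.le,
    Real.norm_of_nonneg (show 0 ≤ R * Real.sin θ₁ by positivity)]
  simp

lemma norm_ringCoef_natAbs_succ (hR : 0 < R) (hs : 0 < Real.sin θ₁) (hc : 0 < Real.cos θ₁)
    (m : ℤ) : ‖ringCoef R θ₁ (m.natAbs + 1) m‖ =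
      (m.natAbs + 1) * (R * Real.cos θ₁) * (R * Real.sin θ₁ / 2) ^ m.natAbs *
      (2 * Real.pi * (R * Real.sin θ₁)) := by
  have h := Real.pi_pos
  rw [ringCoef, norm_mul, norm_mul, norm_harm_idx_succ, norm_hor_meridian hR hs, norm_pow, norm_neg,
    norm_one, one_pow, one_mul, norm_mul, norm_mul, norm_real, norm_real, Real.norm_of_nonneg h.le,
    Real.norm_of_nonneg (show 0 ≤ R * Real.sin θ₁ by positivity),
    show meridian R θ₁ 2 = R * Real.cos θ₁ by simp [meridian], abs_of_pos (by positivity)]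
  simp

lemma ringCoef_natAbs_ne_zero (hR : 0 < R) (hs : 0 < Real.sin θ₁) (m : ℤ) :
    ringCoef R θ₁ m.natAbs m ≠ 0 := by
  have h := Real.pi_pos
  rw [← norm_pos_iff, norm_ringCoef_natAbs hR hs]
  positivity

lemma ringCoef_natAbs_succ_ne_zero (hR : 0 < R) (hs : 0 < Real.sin θ₁) (hc : 0 < Real.cos θ₁)
    (m : ℤ) : ringCoef R θ₁ (m.natAbs + 1) m ≠ 0 := by
  have h := Real.pi_pos
  rw [← norm_pos_iff, norm_ringCoef_natAbs_succ hR hs hc]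
  positivity

/-- The indices for `n = |m|` and `n = |m| + 1` have opposite parity, so the two equations decouple
into sum and difference. The second is solvable because `cos θ₁ ≠ 0`: the rings are off the equator.
-/
lemma ringsCancel_iff (hR : 0 < R) (hs : 0 < Real.sin θ₁) (hc : 0 < Real.cos θ₁)
    (M : ℕ → ℤ → ℂ) (s₁ s₂ : ℤ → ℂ) : RingsCancel S R θ₁ p M s₁ s₂ ↔
      ∀ m : ℤ, |m| ≤ p →
        s₁ m + s₂ m = M m.natAbs m / (momentCoef m.natAbs m * ringCoef R θ₁ m.natAbs m) ∧
        s₁ m - s₂ m = (if m.natAbs + 1 ≤ p then M (m.natAbs + 1) m else 0) /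
          (momentCoef (m.natAbs + 1) m * ringCoef R θ₁ (m.natAbs + 1) m) := by
  refine forall_congr' fun m => forall_congr' fun hm => ?_
  simp only [forall_eq_or_imp, forall_eq]
  rw [ringCoeff_eq _ _ _ _ _ _ (abs_le_natAbs m), ringCoeff_eq _ _ _ _ _ _ (abs_le_natAbs_succ m),
    ringsMoment_natAbs _ _ hm, ringsMoment_natAbs_succ _ _ hm,
    if_pos (show m.natAbs ≤ p by have := abs_le.1 hm; omega),
    eq_div_iff (mul_ne_zero (momentCoef_ne_zero _ _) (ringCoef_natAbs_ne_zero hR hs m)),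
    eq_div_iff (mul_ne_zero (momentCoef_ne_zero _ _) (ringCoef_natAbs_succ_ne_zero hR hs hc m))]
  refine and_congr (by rw [← mul_assoc, mul_comm]) (by rw [← mul_assoc, mul_comm])

lemma exists_ringsCancel (hR : 0 < R) (hs : 0 < Real.sin θ₁) (hc : 0 < Real.cos θ₁)
    (M : ℕ → ℤ → ℂ) : ∃ s₁ s₂ : ℤ → ℂ, RingsCancel S R θ₁ p M s₁ s₂ := by
  simp only [ringsCancel_iff hR hs hc]
  set x : ℤ → ℂ := fun m => M m.natAbs m / (momentCoef m.natAbs m * ringCoef R θ₁ m.natAbs m)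
  set y : ℤ → ℂ := fun m => (if m.natAbs + 1 ≤ p then M (m.natAbs + 1) m else 0) /
    (momentCoef (m.natAbs + 1) m * ringCoef R θ₁ (m.natAbs + 1) m)
  exact ⟨fun m => (x m + y m) / 2, fun m => (x m - y m) / 2, fun m _ => ⟨by ring, by ring⟩⟩

end HalfSpace

end

/-! ### Growth of the moments and convergence of the local expansions -/

noncomputable section

namespace HalfSpace

open Polynomial Complex Filter Topology

variable {S T : Space} {D R θ₁ : ℝ}

lemma norm_sub_le_of_mem_box {x : Space} (hD : 0 < D) (hx : x ∈ box S D) :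
    ‖x - S‖ ≤ Real.sqrt 3 / 2 * D := by
  have h : ∀ i, (x i - S i) ^ 2 ≤ (D / 2) ^ 2 := fun i => sq_le_sq' (by
    have := (abs_le.1 (hx i)).1; linarith) (abs_le.1 (hx i)).2
  refine (pow_le_pow_iff_left₀ (norm_nonneg _) (by positivity) two_ne_zero).1 ?_
  rw [norm_sq_space, mul_pow, div_pow, Real.sq_sqrt (by norm_num)]
  simp only [PiLp.sub_apply]
  nlinarith [h 0, h 1, h 2]

lemma norm_hor_sub_le_of_mem_box {x : Space} (hD : 0 < D) (hx : x ∈ box S D) :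
    ‖hor (x - S)‖ ≤ D / Real.sqrt 2 := by
  have h : ∀ i, (x i - S i) ^ 2 ≤ (D / 2) ^ 2 := fun i => sq_le_sq' (by
    have := (abs_le.1 (hx i)).1; linarith) (abs_le.1 (hx i)).2
  refine (pow_le_pow_iff_left₀ (norm_nonneg _) (by positivity) two_ne_zero).1 ?_
  rw [norm_hor_sq, norm_sq_space, div_pow, Real.sq_sqrt (by norm_num)]
  simp only [PiLp.sub_apply]
  nlinarith [h 0, h 1, h 2]

lemma hor_neg (w : Space) : hor (-w) = -hor w := by
  apply Complex.ext <;> simp [hor]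

lemma natCast_mul_pow_pred_le {x : ℝ} (hx : 0 < x) (n : ℕ) :
    (n : ℝ) * x ^ (n - 1) ≤ n * x ^ n / x := by
  rcases n with _ | n
  · simp
  · rw [Nat.add_sub_cancel, pow_succ]
    apply le_of_eq
    field_simp

lemma norm_dipole_le {N : ℕ} (F Q : Fin N → Space) {n j : ℕ} {B : ℝ}
    (hB : ∀ i, ‖harmD n j (S - Q i) (-F i)‖ ≤ B * ‖F i‖) :
    ‖dipole S F Q n j‖ ≤ B * ∑ i, ‖F i‖ := by
  rw [dipole, Finset.mul_sum]
  exact norm_sum_le_of_le _ fun i _ => hB i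

lemma exists_norm_dipole_le (S : Space) (hD : 0 < D) {q : ℝ} (hq : Real.sqrt 3 / 2 * D ≤ q) :
    ∃ C : ℝ, 0 ≤ C ∧ ∀ {N : ℕ} (F Q : Fin N → Space), (∀ i, Q i ∈ box S D) →
      ∀ n, ∀ j ≤ 2 * n, ‖dipole S F Q n j‖ ≤
        (C * ∑ i, ‖F i‖) * ((n : ℝ) + 1) ^ 2 * q ^ n / wt n j := by
  have hq0 : 0 < q := lt_of_lt_of_le (by positivity) hq
  refine ⟨q⁻¹, by positivity, fun F Q hQ n j hj => ?_⟩
  have hw := wt_pos n j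
  refine (norm_dipole_le F Q (B := (n * q ^ n / q) / wt n j) fun i => ?_).trans ?_
  · rw [div_mul_eq_mul_div, le_div_iff₀ hw]
    refine (norm_harmD_mul_wt_le n j _ _).trans ?_
    rw [norm_neg]
    refine mul_le_mul_of_nonneg_right (le_trans ?_ (natCast_mul_pow_pred_le hq0 n)) (norm_nonneg _)
    gcongr
    rw [norm_sub_rev]
    exact (norm_sub_le_of_mem_box hD (hQ i)).trans hq
  · have h1 : (n : ℝ) ≤ ((n : ℝ) + 1) ^ 2 := by nlinarith [Nat.cast_nonneg (α := ℝ) n]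
    have hF : 0 ≤ ∑ i, ‖F i‖ := Finset.sum_nonneg fun i _ => norm_nonneg _
    calc (n * q ^ n / q) / wt n j * ∑ i, ‖F i‖
        ≤ (((n : ℝ) + 1) ^ 2 * q ^ n / q) / wt n j * ∑ i, ‖F i‖ := by gcongr
      _ = _ := by field_simp

/-- The decoupled equations divide extremal moments of the sources, with horizontal distance at most
`D/√2`, by those of a unit ring, with horizontal distance `R sin θ₁`. -/
lemma exists_norm_density_le (S : Space) (hD : 0 < D) (hR : 0 < R) (hs : 0 < Real.sin θ₁)
    (hc : 0 < Real.cos θ₁) :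
    ∃ C : ℝ, 0 ≤ C ∧ ∀ {N : ℕ} (F Q : Fin N → Space) (p : ℕ) (s₁ s₂ : ℤ → ℂ),
      (∀ i, Q i ∈ box S D) → RingsCancel S R θ₁ p (multipoleCoeff S F Q) s₁ s₂ →
      ∀ m : ℤ, |m| ≤ p → ‖s₁ m‖ + ‖s₂ m‖ ≤ (C * ∑ i, ‖F i‖) * ((m.natAbs : ℝ) + 1) *
        (D / Real.sqrt 2 / Real.sin θ₁ / R) ^ m.natAbs := by
  have hπ := Real.pi_pos
  set h := D / Real.sqrt 2 with hh
  have hh0 : 0 < h := by positivity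
  set c := 2 * Real.pi * (R * Real.sin θ₁) with hcdef
  have hc0 : 0 < c := by positivity
  refine ⟨2 * ((h / 2)⁻¹ / c + ((D / 2) * (h / 2)⁻¹ + 1) / (R * Real.cos θ₁ * c)), by positivity,
    fun F Q p s₁ s₂ hQ hrc m hm => ?_⟩
  have hF : 0 ≤ ∑ i, ‖F i‖ := Finset.sum_nonneg fun i _ => norm_nonneg _
  obtain ⟨h1, h2⟩ := (ringsCancel_iff hR hs hc _ s₁ s₂).1 hrc m hm
  set M := m.natAbs with hM
  have hhor : ∀ i, ‖hor (S - Q i)‖ ≤ h := fun i => by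
    rw [← neg_sub, hor_neg, norm_neg]; exact norm_hor_sub_le_of_mem_box hD (hQ i)
  have hz : ∀ i, |(S - Q i) 2| ≤ D / 2 := fun i => by
    rw [PiLp.sub_apply, abs_sub_comm]; exact hQ i 2
  have hx := natCast_mul_pow_pred_le (x := h / 2) (by positivity) M
  have hd0 : ‖dipole S F Q M (idx M m)‖ ≤ (M * (h / 2) ^ M / (h / 2)) * ∑ i, ‖F i‖ := by
    refine norm_dipole_le F Q fun i => (norm_harmD_idx_le m _ _).trans ?_
    rw [norm_neg]
    refine mul_le_mul_of_nonneg_right (le_trans ?_ hx) (norm_nonneg _)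
    gcongr
    exact hhor i
  have hd1 : ‖dipole S F Q (M + 1) (idx (M + 1) m)‖ ≤
      ((M + 1) * ((D / 2) * (M * (h / 2) ^ M / (h / 2)) + (h / 2) ^ M)) * ∑ i, ‖F i‖ := by
    refine norm_dipole_le F Q fun i => (norm_harmD_idx_succ_le m _ _).trans ?_
    rw [norm_neg]
    refine mul_le_mul_of_nonneg_right ?_ (norm_nonneg _)
    calc ((M : ℝ) + 1) * (M * |(S - Q i) 2| * (‖hor (S - Q i)‖ / 2) ^ (M - 1) +
          (‖hor (S - Q i)‖ / 2) ^ M)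
        ≤ ((M : ℝ) + 1) * (M * (D / 2) * (h / 2) ^ (M - 1) + (h / 2) ^ M) := by
          gcongr
          · exact hz i
          · exact hhor i
          · exact hhor i
      _ = ((M : ℝ) + 1) * ((D / 2) * (M * (h / 2) ^ (M - 1)) + (h / 2) ^ M) := by ring
      _ ≤ _ := by gcongr
  set y := R * Real.sin θ₁ / 2 with hy
  have hy0 : 0 < y := by positivity
  have hratio : (h / 2) ^ M / y ^ M = (h / Real.sin θ₁ / R) ^ M := by
    rw [← div_pow]; congr 1; rw [hy]; field_simp
  have hk0 := momentCoef_ne_zero M m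
  have hk1 := momentCoef_ne_zero (M + 1) m
  have e1 : ‖s₁ m + s₂ m‖ ≤ M * (h / 2)⁻¹ * (h / Real.sin θ₁ / R) ^ M / c * ∑ i, ‖F i‖ := by
    rw [h1, multipoleCoeff_eq S F Q (abs_le_natAbs m), mul_div_mul_left _ _ hk0, norm_div,
      norm_ringCoef_natAbs hR hs, div_le_iff₀ (by positivity), ← hratio]
    refine hd0.trans_eq ?_
    rw [← hM, ← hcdef, ← hy]
    field_simp
  have e2 : ‖s₁ m - s₂ m‖ ≤ ((D / 2) * (M * (h / 2)⁻¹) + 1) * (h / Real.sin θ₁ / R) ^ M /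
      (R * Real.cos θ₁ * c) * ∑ i, ‖F i‖ := by
    rw [h2]
    split_ifs with hp
    · rw [multipoleCoeff_eq S F Q (abs_le_natAbs_succ m), mul_div_mul_left _ _ hk1, norm_div,
        norm_ringCoef_natAbs_succ hR hs hc, div_le_iff₀ (by positivity), ← hratio]
      refine hd1.trans_eq ?_
      rw [← hM, ← hcdef, ← hy]
      field_simp
    · rw [zero_div, norm_zero]
      positivity
  have e3 : ‖s₁ m‖ + ‖s₂ m‖ ≤ 2 * (‖s₁ m + s₂ m‖ + ‖s₁ m - s₂ m‖) := by
    have t1 : ‖s₁ m‖ ≤ ‖s₁ m + s₂ m‖ + ‖s₁ m - s₂ m‖ := by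
      have := norm_add_le (s₁ m + s₂ m) (s₁ m - s₂ m)
      rw [show s₁ m + s₂ m + (s₁ m - s₂ m) = 2 * s₁ m by ring, norm_mul, Complex.norm_ofNat] at this
      linarith [norm_nonneg (s₁ m)]
    have t2 : ‖s₂ m‖ ≤ ‖s₁ m + s₂ m‖ + ‖s₁ m - s₂ m‖ := by
      have := norm_sub_le (s₁ m + s₂ m) (s₁ m - s₂ m)
      rw [show s₁ m + s₂ m - (s₁ m - s₂ m) = 2 * s₂ m by ring, norm_mul, Complex.norm_ofNat] at this
      linarith [norm_nonneg (s₂ m)]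
    linarith
  have hM0 : (0 : ℝ) ≤ M := Nat.cast_nonneg M
  calc ‖s₁ m‖ + ‖s₂ m‖ ≤ 2 * (‖s₁ m + s₂ m‖ + ‖s₁ m - s₂ m‖) := e3
    _ ≤ 2 * (M * (h / 2)⁻¹ * (h / Real.sin θ₁ / R) ^ M / c * ∑ i, ‖F i‖ +
        ((D / 2) * (M * (h / 2)⁻¹) + 1) * (h / Real.sin θ₁ / R) ^ M /
      (R * Real.cos θ₁ * c) * ∑ i, ‖F i‖) := by gcongr
    _ ≤ 2 * (((M : ℝ) + 1) * (h / 2)⁻¹ * (h / Real.sin θ₁ / R) ^ M / c * ∑ i, ‖F i‖ +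
        (((M : ℝ) + 1) * ((D / 2) * (h / 2)⁻¹ + 1)) * (h / Real.sin θ₁ / R) ^ M /
      (R * Real.cos θ₁ * c) * ∑ i, ‖F i‖) := by
        have t0 : 0 ≤ (D / 2) * (h / 2)⁻¹ := by positivity
        gcongr ?_ * (?_ + ?_)
        · gcongr; linarith
        · gcongr; nlinarith
    _ = _ := by ring

/-- A ring harmonic contributes `R^n` and the density at most `(q/R)^|m|` up to a linear factor; as
`|m| ≤ n` and `q ≥ R`, the product is controlled by `q^n`. -/
lemma exists_norm_ringsMoment_le (S : Space) (hD : 0 < D) (hR : 0 < R) (hs : 0 < Real.sin θ₁)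
    (hc : 0 < Real.cos θ₁) {q : ℝ} (hRq : R ≤ q) (hq : D / Real.sqrt 2 / Real.sin θ₁ ≤ q) :
    ∃ C : ℝ, 0 ≤ C ∧ ∀ {N : ℕ} (F Q : Fin N → Space) (p : ℕ) (s₁ s₂ : ℤ → ℂ),
      (∀ i, Q i ∈ box S D) → RingsCancel S R θ₁ p (multipoleCoeff S F Q) s₁ s₂ →
      ∀ n, ∀ j ≤ 2 * n, ‖ringsMoment S R θ₁ p s₁ s₂ n j‖ ≤
        (C * ∑ i, ‖F i‖) * ((n : ℝ) + 1) ^ 2 * q ^ n / wt n j := by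
  obtain ⟨C, hC, hCb⟩ := exists_norm_density_le S hD hR hs hc
  have hπ := Real.pi_pos
  have hq0 : 0 < q := hR.trans_le hRq
  refine ⟨C * (2 * Real.pi * (R * Real.sin θ₁)), by positivity,
    fun F Q p s₁ s₂ hQ hrc n j hj => ?_⟩
  have hF : 0 ≤ ∑ i, ‖F i‖ := Finset.sum_nonneg fun i _ => norm_nonneg _
  have hw := wt_pos n j
  rw [ringsMoment_eq _ _ _ _ _ _ hj]
  split_ifs with hp
  · have h1 := hCb F Q p s₁ s₂ hQ hrc _ hp
    set m : ℤ := (n : ℤ) - j with hm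
    have hmn : m.natAbs ≤ n := by omega
    have h2 : ‖s₁ m + (-1) ^ j * s₂ m‖ ≤ ‖s₁ m‖ + ‖s₂ m‖ :=
      (norm_add_le _ _).trans (by simp)
    have h3 : (D / Real.sqrt 2 / Real.sin θ₁ / R) ^ m.natAbs ≤ (q / R) ^ n := by
      calc (D / Real.sqrt 2 / Real.sin θ₁ / R) ^ m.natAbs ≤ (q / R) ^ m.natAbs := by gcongr
        _ ≤ (q / R) ^ n := pow_le_pow_right₀ ((one_le_div hR).2 hRq) hmn
    have h4 : ‖harm n j (meridian R θ₁)‖ ≤ R ^ n / wt n j := by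
      simpa [norm_meridian hR.le] using norm_harm_le n j (meridian R θ₁)
    have h5 : ‖(2 * Real.pi * (R * Real.sin θ₁ : ℝ) : ℂ)‖ = 2 * Real.pi * (R * Real.sin θ₁) := by
      rw [norm_mul, norm_mul, norm_real, norm_real, Real.norm_of_nonneg hπ.le,
        Real.norm_of_nonneg (show 0 ≤ R * Real.sin θ₁ by positivity), Complex.norm_ofNat]
    rw [norm_mul, norm_mul, norm_mul, h5, norm_pow, norm_neg, norm_one, one_pow, one_mul]
    have h6 : (m.natAbs : ℝ) + 1 ≤ ((n : ℝ) + 1) ^ 2 := by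
      have : (m.natAbs : ℝ) ≤ n := by exact_mod_cast hmn
      nlinarith
    calc ‖harm n j (meridian R θ₁)‖ * (2 * Real.pi * (R * Real.sin θ₁)) *
          ‖s₁ m + (-1) ^ j * s₂ m‖
        ≤ (R ^ n / wt n j) * (2 * Real.pi * (R * Real.sin θ₁)) *
          ((C * ∑ i, ‖F i‖) * ((n : ℝ) + 1) ^ 2 * (q / R) ^ n) := by
          gcongr
          exact (h2.trans h1).trans (by gcongr)
      _ = _ := by rw [div_pow]; field_simp
  · rw [mul_zero, norm_zero]
    positivity

/-- The truncated local expansions of the field and of the rings. -/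
lemma exists_localExpansion_bound (hD : 0 < D) (hS : D / 2 ≤ S 2) (hT : T 2 + D / 2 ≤ 0)
    (hDR : Real.sqrt 3 / 2 * D ≤ R) (hRST : R + Real.sqrt 3 / 2 * D < dist S T)
    (hs : 0 < Real.sin θ₁) (hc : 0 < Real.cos θ₁)
    (hθ : D / Real.sqrt 2 < (dist S T - Real.sqrt 3 / 2 * D) * Real.sin θ₁) :
    ∃ C ρ : ℝ, 0 < ρ ∧ ρ < 1 ∧ ∀ {N : ℕ} (F Q : Fin N → Space) (p : ℕ) (s₁ s₂ : ℤ → ℂ),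
      (∀ i, Q i ∈ box S D) → RingsCancel S R θ₁ p (multipoleCoeff S F Q) s₁ s₂ →
      ∀ x ∈ box T D,
        ‖(PhiB F Q x : ℂ) - ∑ k ∈ Finset.range (p + 1), ∑ i ∈ Finset.range (2 * k + 1),
          locCoef (flipCoef (okada T S)) (dipole S F Q) p k i * harm k i (x - T)‖ ≤
            C * (∑ i, ‖F i‖) * ρ ^ p ∧
        ‖ringField S R θ₁ p s₁ s₂ x - ∑ k ∈ Finset.range (p + 1), ∑ i ∈ Finset.range (2 * k + 1),
          locCoef (flipCoef (okada T S)) (ringsMoment S R θ₁ p s₁ s₂) p k i *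
            harm k i (x - T)‖ ≤ C * (∑ i, ‖F i‖) * ρ ^ p := by
  -- The cubes lie on opposite sides of the plane, whence `S₃ - T₃ ≥ D > 0`.
  have hb : 0 < okada T S 2 := by simp [okada]; linarith
  have hbn := norm_okada S T
  have ha : 0 < Real.sqrt 3 / 2 * D := by positivity
  have hR : 0 < R := ha.trans_le hDR
  set q := max R (D / Real.sqrt 2 / Real.sin θ₁) with hq
  have hRq : R ≤ q := le_max_left _ _
  -- The two terms of the maximum correspond to the separation hypothesis and to the condition on
  -- `sin θ₁`.
  have hqa : q + Real.sqrt 3 / 2 * D < ‖okada T S‖ := by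
    rw [hbn, ← lt_sub_iff_add_lt, hq, max_lt_iff]
    exact ⟨by linarith, (div_lt_iff₀ hs).2 hθ⟩
  obtain ⟨K, hK, hKb⟩ := exists_norm_flipCoef_le hb
  obtain ⟨C, ρ, hC, hρ0, hρ1, htr⟩ := exists_truncation_bound hK (hR.trans_le hRq) ha.le hqa
    (fun N J _ => hKb N J)
  obtain ⟨C₁, hC₁, hd⟩ := exists_norm_dipole_le S hD (hDR.trans hRq)
  obtain ⟨C₂, hC₂, hr⟩ := exists_norm_ringsMoment_le S hD hR hs hc hRq (le_max_right _ _)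
  refine ⟨C * (C₁ + C₂), ρ, hρ0, hρ1, fun {N} F Q p s₁ s₂ hQ hrc x hx => ?_⟩
  have hF : 0 ≤ ∑ i, ‖F i‖ := Finset.sum_nonneg fun i _ => norm_nonneg _
  have hxT := norm_sub_le_of_mem_box hD hx
  have h1 := hasSum_PhiB (F := F) (Q := Q) (x := x) hb fun i => by
    have h2 := norm_sub_le_of_mem_box hD (hQ i)
    have h3 := norm_sub_le (x - T) (Q i - S)
    linarith
  have h2 : HasSum (fun N => ∑ n ∈ Finset.range (N + 1), block (flipCoef (okada T S))
      (ringsMoment S R θ₁ p s₁ s₂) (x - T) n (N - n)) (ringField S R θ₁ p s₁ s₂ x) := by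
    have h1 : ∀ θ φ, ‖x - T - (ringPoint S R θ φ - S)‖ ≤ R + Real.sqrt 3 / 2 * D := fun θ φ => by
      have h2 := norm_sub_le (x - T) (ringPoint S R θ φ - S)
      rw [norm_ringPoint_sub hR.le] at h2
      linarith
    rw [← hbn] at hRST
    have h3 := (hasSum_ringIntegral p s₁ hb (h1 θ₁) hRST).add
      (hasSum_ringIntegral p s₂ hb (h1 (Real.pi - θ₁)) hRST)
    simp only [← Finset.sum_add_distrib, ← block_add] at h3
    exact h3
  have h3 := htr (C₁ * ∑ i, ‖F i‖) (dipole S F Q) (x - T) (PhiB F Q x) p (mul_nonneg hC₁ hF)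
    (hd F Q hQ) hxT h1
  have h4 := htr (C₂ * ∑ i, ‖F i‖) (ringsMoment S R θ₁ p s₁ s₂) (x - T) _ p (mul_nonneg hC₂ hF)
    (hr F Q p s₁ s₂ hQ hrc) hxT h2
  refine ⟨h3.trans ?_, h4.trans ?_⟩
  · rw [← mul_assoc]
    exact mul_le_mul_of_nonneg_right (mul_le_mul_of_nonneg_right (mul_le_mul_of_nonneg_left
      (le_add_of_nonneg_right hC₂) hC) hF) (pow_nonneg hρ0.le p)
  · rw [← mul_assoc]
    exact mul_le_mul_of_nonneg_right (mul_le_mul_of_nonneg_right (mul_le_mul_of_nonneg_left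
      (le_add_of_nonneg_left hC₁) hC) hF) (pow_nonneg hρ0.le p)

end HalfSpace

end

/-! ### Computing the multipole coefficients from the sources -/

noncomputable section

namespace StraightLine

variable {ι : Type} {𝓕 : Set ((ι → ℂ) → ℂ)} {n : ℕ}

lemma Cost.biUnion {α : Type*} (s : Finset α) (𝓖 : α → Set ((ι → ℂ) → ℂ))
    (h : ∀ i ∈ s, Cost n 𝓕 (𝓖 i)) : Cost (s.card * n) 𝓕 (⋃ i ∈ s, 𝓖 i) := by
  classical
  induction s using Finset.induction_on with
  | empty => exact Cost.of_subset (by simp)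
  | insert a s ha ih =>
    have h1 := (h a (by simp)).trans
      ((ih fun i hi => h i (by simp [hi])).subset Set.subset_union_left le_rfl)
    refine (h1.mono (n := (insert a s).card * n) ?_).subset le_rfl ?_
    · rw [Finset.card_insert_of_notMem ha]; linarith [add_mul s.card 1 n]
    · rw [Finset.set_biUnion_insert]

end StraightLine

namespace HalfSpace

open Polynomial Complex StraightLine

variable {ι : Type} {𝓕 : Set ((ι → ℂ) → ℂ)}

lemma cost_coeff_quadPoly_mul {γ α β : (ι → ℂ) → ℂ} {f : (ι → ℂ) → ℂ[X]} {j : ℕ}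
    (hγ : γ ∈ 𝓕) (hα : α ∈ 𝓕) (hβ : β ∈ 𝓕) (hf : ∀ i ≤ j, (fun x => (f x).coeff i) ∈ 𝓕) :
    Cost 5 𝓕 {fun x => (quadPoly (γ x) (α x) (β x) * f x).coeff j} := by
  rcases j with _ | _ | j
  · simp only [coeff_quadPoly_mul_zero]
    exact (cost_mul hγ (hf 0 le_rfl)).mono (by norm_num)
  · simp only [zero_add, coeff_quadPoly_mul_one]
    exact ((cost_mul hγ (hf 1 le_rfl)).add (cost_mul hα (hf 0 (by norm_num)))).mono (by norm_num)
  · simp only [show j + 1 + 1 = j + 2 from rfl, coeff_quadPoly_mul_add_two]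
    exact ((cost_mul hγ (hf _ le_rfl)).add (cost_mul hα (hf (j + 1) (by omega)))).add
      (cost_mul hβ (hf j (by omega)))

/-- Multiplying by a quadratic is a three-term recurrence, so each entry in the table of
coefficients of powers costs at most five operations. -/
lemma cost_quadPoly_pow {γ α β : (ι → ℂ) → ℂ} (hγ : γ ∈ 𝓕) (hα : α ∈ 𝓕) (hβ : β ∈ 𝓕) (B p : ℕ) :
    Cost ((p + 1) * (B * 5)) 𝓕 ((fun (k : ℕ × ℕ) (x : ι → ℂ) =>
      (quadPoly (γ x) (α x) (β x) ^ k.1).coeff k.2) ''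
        (Finset.range (p + 1) ×ˢ Finset.range B : Finset (ℕ × ℕ))) := by
  induction p with
  | zero =>
    refine ((Cost.family (𝓕 := 𝓕) (n := 5) (Finset.range B) (fun j (x : ι → ℂ) =>
      (quadPoly (γ x) (α x) (β x) ^ 0).coeff j) fun j _ => ?_).mono (by simp)).subset le_rfl ?_
    · simp only [pow_zero]
      exact (cost_const _).mono (by norm_num)
    · rintro _ ⟨⟨n, j⟩, h, rfl⟩
      simp at h
      obtain ⟨h, rfl⟩ := h
      exact ⟨j, by simpa using h, rfl⟩
  | succ p ih =>
    set 𝓖 := ((fun (k : ℕ × ℕ) (x : ι → ℂ) => (quadPoly (γ x) (α x) (β x) ^ k.1).coeff k.2) ''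
        (Finset.range (p + 1) ×ˢ Finset.range B : Finset (ℕ × ℕ))) with h𝓖
    have h := ih.trans (Cost.family (𝓕 := 𝓕 ∪ 𝓖) (n := 5) (Finset.range B) (fun j (x : ι → ℂ) =>
      (quadPoly (γ x) (α x) (β x) ^ (p + 1)).coeff j) fun j hj => by
        simp only [pow_succ']
        refine cost_coeff_quadPoly_mul (.inl hγ) (.inl hα) (.inl hβ) fun i hi => .inr ?_
        refine ⟨(p, i), ?_, rfl⟩
        simp at hj ⊢
        omega)
    refine (h.mono ?_).subset le_rfl ?_
    · rw [Finset.card_range]; linarith [add_mul (p + 1) 1 (B * 5)]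
    · rintro _ ⟨⟨n, j⟩, h, rfl⟩
      simp at h
      rcases Nat.lt_or_ge n (p + 1) with hn | hn
      · exact .inl ⟨(n, j), by simp; omega, rfl⟩
      · obtain rfl : n = p + 1 := by omega
        exact .inr ⟨j, by simp; omega, rfl⟩

lemma cost_quadPoly_gradient {γ α β γ' α' β' : (ι → ℂ) → ℂ} (hγ : γ ∈ 𝓕) (hα : α ∈ 𝓕)
    (hβ : β ∈ 𝓕) (hγ' : γ' ∈ 𝓕) (hα' : α' ∈ 𝓕) (hβ' : β' ∈ 𝓕) (B p : ℕ) :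
    Cost ((p + 1) * (B * 12)) 𝓕 ((fun (k : ℕ × ℕ) (x : ι → ℂ) => (k.1 : ℂ) *
      (quadPoly (γ' x) (α' x) (β' x) * quadPoly (γ x) (α x) (β x) ^ (k.1 - 1)).coeff k.2) ''
        (Finset.range (p + 1) ×ˢ Finset.range B : Finset (ℕ × ℕ))) := by
  have h := (cost_quadPoly_pow hγ hα hβ B p).trans (Cost.family (n := 7)
    (Finset.range (p + 1) ×ˢ Finset.range B) (fun (k : ℕ × ℕ) (x : ι → ℂ) => (k.1 : ℂ) *
      (quadPoly (γ' x) (α' x) (β' x) * quadPoly (γ x) (α x) (β x) ^ (k.1 - 1)).coeff k.2)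
    fun k hk => by
      refine Cost.const_mul (m := 5) _ ?_
      refine cost_coeff_quadPoly_mul (.inl hγ') (.inl hα') (.inl hβ') fun i hi => .inr ?_
      -- For `k.1 = 0` the truncated exponent refers to the zeroth power, which the table contains;
      -- the factor `k.1` makes its value immaterial.
      refine ⟨(k.1 - 1, i), ?_, rfl⟩
      simp at hk ⊢
      omega)
  refine (h.mono ?_).subset le_rfl Set.subset_union_right
  rw [Finset.card_product, Finset.card_range, Finset.card_range]
  apply le_of_eq
  ring

lemma cost_affine {f : Fin 3 → (ι → ℂ) → ℂ} (hf : ∀ i, f i ∈ 𝓕) (c : Fin 3 → ℂ) (d : ℂ) :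
    Cost 12 𝓕 {fun x => d + ∑ i, c i * f i x} :=
  (cost_const d).add (cost_linear Finset.univ c f fun i _ => hf i)

/-- The null form of a complex vector. -/
def quadC (a : Fin 3 → ℂ) : ℂ[X] :=
  quadPoly (-(a 0 - I * a 1) / 2) (a 2) ((a 0 + I * a 1) / 2)

lemma quadC_ofReal (w : Space) : quadC (fun i => (w i : ℂ)) = quad w := by
  have h1 : hor w = w 0 + I * w 1 := by apply Complex.ext <;> simp [hor]
  have h2 : (starRingEnd ℂ) (hor w) = w 0 - I * w 1 := by apply Complex.ext <;> simp [hor]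
  rw [quadC, quad, h1, ← h1, h2, h1]

lemma cost_gradient {f g : Fin 3 → (ι → ℂ) → ℂ} (hf : ∀ i, f i ∈ 𝓕) (hg : ∀ i, g i ∈ 𝓕)
    (c : Fin 3 → ℂ) (B p : ℕ) :
    Cost (72 + (p + 1) * (B * 12)) 𝓕 ((fun (k : ℕ × ℕ) (x : ι → ℂ) => (k.1 : ℂ) *
      (quadC (fun i => f i x) * quadC (fun i => g i x - c i) ^ (k.1 - 1)).coeff k.2) ''
        (Finset.range (p + 1) ×ˢ Finset.range B : Finset (ℕ × ℕ))) := by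
  -- The rows express the three coefficients of the null form through the coordinates. Six affine
  -- forms at 12 operations each account for the 72.
  set C₀ : Fin 3 → Fin 3 → ℂ := ![![-1 / 2, I / 2, 0], ![0, 0, 1], ![1 / 2, I / 2, 0]] with hC
  set F : Fin 3 → (ι → ℂ) → ℂ := fun k x => 0 + ∑ i, C₀ k i * f i x with hF
  set G : Fin 3 → (ι → ℂ) → ℂ := fun k x => -(∑ i, C₀ k i * c i) + ∑ i, C₀ k i * g i x with hG
  have e1 : ∀ x, quadC (fun i => f i x) = quadPoly (F 0 x) (F 1 x) (F 2 x) := by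
    intro x
    simp only [hF, hC, quadC, Fin.sum_univ_three]
    congr 1 <;> simp <;> ring
  have e2 : ∀ x, quadC (fun i => g i x - c i) = quadPoly (G 0 x) (G 1 x) (G 2 x) := by
    intro x
    simp only [hG, hC, quadC, Fin.sum_univ_three]
    congr 1 <;> simp <;> ring
  have h1 := (Cost.family Finset.univ F fun k _ => cost_affine hf (C₀ k) 0).trans
    ((Cost.family Finset.univ G fun k _ => cost_affine hg (C₀ k) _).subset
      Set.subset_union_left le_rfl)
  simp only [e1, e2]
  refine (h1.comp (cost_quadPoly_gradient (γ := G 0) (α := G 1) (β := G 2) (γ' := F 0) (α' := F 1)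
    (β' := F 2) ?_ ?_ ?_ ?_ ?_ ?_ B p)).mono (by simp)
  all_goals first
    | exact .inl ⟨_, by simp, rfl⟩
    | exact .inr ⟨_, by simp, rfl⟩

lemma mem_modes {p n : ℕ} {m : ℤ} : (n, m) ∈ modes p ↔ n ≤ p ∧ |m| ≤ (n : ℤ) := by
  simp only [modes, Finset.mem_filter, Finset.mem_product, Finset.mem_range, Finset.mem_Icc,
    ← abs_le]
  omega

lemma card_modes_le (p : ℕ) : (modes p).card ≤ (p + 1) * (2 * p + 1) := by
  refine (Finset.card_filter_le _ _).trans ?_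
  rw [Finset.card_product, Finset.card_range, Int.card_Icc]
  refine Nat.mul_le_mul_left _ ?_
  omega

/-- The gradient of `harm n j` in the direction of the `i`th force at the `i`th source, as a
polynomial in the source data. -/
def sourceTerm (S : Space) {N : ℕ} (i : Fin N) (k : ℕ × ℕ)
    (x : (Fin N × Fin 3) ⊕ (Fin N × Fin 3) → ℂ) : ℂ :=
  (k.1 : ℂ) * (quadC (fun l => x (.inl (i, l))) *
    quadC (fun l => x (.inr (i, l)) - (S l : ℂ)) ^ (k.1 - 1)).coeff k.2

lemma sourceTerm_sourceData (S : Space) {N : ℕ} (F Q : Fin N → Space) (i : Fin N) (k : ℕ × ℕ) :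
    sourceTerm S i k (sourceData F Q) = harmD k.1 k.2 (Q i - S) (F i) := by
  have e : (fun l => sourceData F Q (.inr (i, l)) - (S l : ℂ)) =
      fun l => (((Q i - S : Space) l : ℝ) : ℂ) := by
    funext l; simp [sourceData]
  rw [sourceTerm, e, quadC_ofReal, harmD]
  simp only [sourceData, Sum.elim_inl]
  rw [quadC_ofReal]

lemma cost_sourceTerm (S : Space) {N : ℕ} (i : Fin N) (B p : ℕ) :
    Cost (72 + (p + 1) * (B * 12))
      (Set.range fun i : (Fin N × Fin 3) ⊕ (Fin N × Fin 3) => fun x : _ → ℂ => x i)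
      (sourceTerm S i '' (Finset.range (p + 1) ×ˢ Finset.range B : Finset (ℕ × ℕ))) := by
  have h := cost_gradient (ι := (Fin N × Fin 3) ⊕ (Fin N × Fin 3))
    (𝓕 := Set.range fun i : (Fin N × Fin 3) ⊕ (Fin N × Fin 3) => fun x : _ → ℂ => x i)
    (f := fun l x => x (.inl (i, l))) (g := fun l x => x (.inr (i, l)))
    (fun l => ⟨.inl (i, l), rfl⟩) (fun l => ⟨.inr (i, l), rfl⟩) (fun l => (S l : ℂ)) B p
  exact h

lemma multipoleCoeff_eq_sum {N : ℕ} (S : Space) (F Q : Fin N → Space) {n : ℕ} {m : ℤ}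
    (hm : |m| ≤ n) : multipoleCoeff S F Q n m =
      ∑ i, (momentCoef n m * (-1) ^ n) * sourceTerm S i (n, idx n m) (sourceData F Q) := by
  rw [multipoleCoeff_eq S F Q hm, dipole, Finset.mul_sum]
  refine Finset.sum_congr rfl fun i _ => ?_
  rw [sourceTerm_sourceData, ← neg_sub (Q i) S, harmD_neg_neg, mul_assoc]

/-- The multipole coefficients of order `p` of `N` sources are computed in `O(N p²)` operations. -/
lemma exists_program_multipoleCoeff (S : Space) {p N : ℕ} (hp : 1 ≤ p) (hN : 1 ≤ N) :
    ∃ A₀ : Program ((Fin N × Fin 3) ⊕ (Fin N × Fin 3)) (modes p), A₀.cost ≤ 168 * N * p ^ 2 ∧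
      ∀ F Q : Fin N → Space, ∀ k,
        A₀.run (sourceData F Q) k = multipoleCoeff S F Q k.1.1 k.1.2 := by
  have h1 := Cost.biUnion (Finset.univ : Finset (Fin N)) (fun i => sourceTerm S i ''
    (Finset.range (p + 1) ×ˢ Finset.range (2 * p + 1) : Finset (ℕ × ℕ))) fun i _ =>
    cost_sourceTerm S i (2 * p + 1) p
  have h2 := h1.comp (Cost.family (Finset.univ : Finset (modes p)) (fun k x =>
    ∑ i, (momentCoef k.1.1 k.1.2 * (-1) ^ k.1.1) * sourceTerm S i (k.1.1, idx k.1.1 k.1.2) x)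
    fun k _ => cost_linear Finset.univ
    (fun _ => momentCoef k.1.1 k.1.2 * (-1) ^ k.1.1)
    (fun i => sourceTerm S i (k.1.1, idx k.1.1 k.1.2)) fun i _ => by
      obtain ⟨⟨n, m⟩, hk⟩ := k
      obtain ⟨hn, hm⟩ := mem_modes.1 hk
      have h3 := idx_le hm
      simp only [Set.mem_iUnion]
      refine ⟨i, Finset.mem_univ i, (n, idx n m), ?_, rfl⟩
      simp only [Finset.coe_product, Finset.coe_range, Set.mem_prod, Set.mem_Iio]
      omega)
  obtain ⟨A, hA, hrun⟩ := Cost.exists_program (fun (k : modes p) x =>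
    ∑ i, (momentCoef k.1.1 k.1.2 * (-1) ^ k.1.1) * sourceTerm S i (k.1.1, idx k.1.1 k.1.2) x)
    (h2.subset le_rfl (by simp))
  refine ⟨A, hA.trans ?_, fun F Q k => ?_⟩
  · simp only [Finset.card_univ, Fintype.card_fin, Fintype.card_coe]
    have h3 : (p + 1) * (2 * p + 1) ≤ 6 * p ^ 2 := by nlinarith
    have h4 := (card_modes_le p).trans h3
    calc N * (72 + (p + 1) * ((2 * p + 1) * 12)) + (modes p).card * (N * 3 + 1)
        ≤ N * (72 * p ^ 2 + (6 * p ^ 2) * 12) + (6 * p ^ 2) * (N * 3 + N) := by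
          rw [← mul_assoc (p + 1)]
          gcongr
          nlinarith
      _ = 168 * N * p ^ 2 := by ring
  · rw [hrun, multipoleCoeff_eq_sum S F Q (mem_modes.1 k.2).2]

end HalfSpace

end

/-! ### The program for the local expansions -/

noncomputable section

namespace HalfSpace

open Polynomial Complex StraightLine

/-! ### Translation of the difference field in three stages -/

/-- The values of the spinor components at the nodes of the quadrature. -/
def nodeS (b : Space) (q l : ℕ) : ℂ := (polyS b).eval (rootU q ^ l)

/-- The values of the spinor components at the nodes of the quadrature. -/
def nodeT (b : Space) (q l : ℕ) : ℂ := (polyT b).eval (rootU q ^ l)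

/-- At each node the monomial in the spinor splits into a source factor and a target factor; the
quadrature is exact for this number of nodes. -/
lemma angCoef_add (b : Space) {q ν k μ i : ℕ} (hq : 2 * (ν + k) < q) (hμ : μ ≤ 2 * ν)
    (hi : i ≤ 2 * k) : angCoef b (ν + k) (μ + i) =
      (q : ℂ)⁻¹ * ∑ l ∈ Finset.range q, ((rootU q ^ l) ^ (ν + k))⁻¹ *
        ((nodeS b q l ^ μ * nodeT b q l ^ (2 * ν - μ)) *
          (nodeS b q l ^ i * nodeT b q l ^ (2 * k - i))) := by
  have hS : (polyS b).natDegree ≤ 1 := natDegree_linear_le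
  have hT : (polyT b).natDegree ≤ 1 := natDegree_linear_le
  have h2 := natDegree_mul_le (p := polyS b ^ (μ + i)) (q := polyT b ^ (2 * (ν + k) - (μ + i)))
  have h3 := natDegree_pow_le_of_le (μ + i) hS
  have h4 := natDegree_pow_le_of_le (2 * (ν + k) - (μ + i)) hT
  rw [angCoef, coeff_eq_sum_rootU (q := q) _ (by omega) (by omega)]
  congr 1
  refine Finset.sum_congr rfl fun l _ => ?_
  rw [eval_mul, eval_pow, eval_pow, ← nodeS, ← nodeT,
    show 2 * (ν + k) - (μ + i) = (2 * ν - μ) + (2 * k - i) by omega, pow_add, pow_add]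
  ring

lemma flipCoef_add_two {b : Space} (hb : 0 < b 2) {N J : ℕ} (hJ : J ≤ 2 * N) :
    flipCoef b (N + 2) (J + 2) =
      (-1) ^ J * (((N + 2 : ℕ) : ℂ) * ((N + 1 : ℕ) : ℂ))⁻¹ * coulCoef b N J := by
  have h0 : ((N + 2 : ℕ) : ℂ) * ((N + 1 : ℕ) : ℂ) ≠ 0 :=
    mul_ne_zero (Nat.cast_ne_zero.2 (Nat.succ_ne_zero _)) (Nat.cast_ne_zero.2 (Nat.succ_ne_zero _))
  rw [flipCoef, ← potBCoef_eq hb N J hJ, mul_assoc ((-1) ^ J), inv_mul_cancel_left₀ h0, pow_add]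
  norm_num

/-- First factor of the translation operator. -/
def transl₁ (b : Space) (q ν μ l : ℕ) : ℂ :=
  (-1) ^ μ * (nodeS b q l ^ μ * nodeT b q l ^ (2 * ν - μ))

/-- Second factor of the translation operator. -/
def transl₂ (b : Space) (q ν k l : ℕ) : ℂ :=
  ((ν + 2 + k).choose (ν + 2) : ℂ) * (((ν + k + 2 : ℕ) : ℂ) * ((ν + k + 1 : ℕ) : ℂ))⁻¹ *
    ((-1) ^ (ν + k) * ((‖b‖ : ℂ) ^ (ν + k + 1))⁻¹) * (q : ℂ)⁻¹ * ((rootU q ^ l) ^ (ν + k))⁻¹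

/-- Third factor of the translation operator. -/
def transl₃ (b : Space) (q k i l : ℕ) : ℂ :=
  (-1) ^ i * (nodeS b q l ^ i * nodeT b q l ^ (2 * k - i))

/-- The separation behind the fast translation: at a node `l` the source index `μ` meets only `ν`,
the degrees `ν` and `k` meet each other, and the target index `i` meets only `k`. -/
lemma choose_mul_flipCoef {b : Space} (hb : 0 < b 2) {q ν k μ i : ℕ} (hq : 2 * (ν + k) < q)
    (hμ : μ ≤ 2 * ν) (hi : i ≤ 2 * k) :
    ((ν + 2 + k).choose (ν + 2) : ℂ) * flipCoef b (ν + 2 + k) (μ + 2 + i) =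
      ∑ l ∈ Finset.range q, transl₃ b q k i l * (transl₂ b q ν k l * transl₁ b q ν μ l) := by
  rw [show ν + 2 + k = ν + k + 2 by omega, show μ + 2 + i = μ + i + 2 by omega,
    flipCoef_add_two hb (by omega), coulCoef, angCoef_add b hq hμ hi]
  simp only [Finset.mul_sum, transl₁, transl₂, transl₃]
  refine Finset.sum_congr rfl fun l _ => ?_
  rw [show ν + 2 + k = ν + k + 2 by omega, pow_add (-1 : ℂ) μ i]
  ring

/-- In degrees 0 and 1 every index is extremal, and in higher degrees two drop out at each end. What
remains involves only those coefficients of `𝓑` that are multiples of Coulomb coefficients. -/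
lemma locCoef_eq_sum_shift (e Λ : ℕ → ℕ → ℂ) {p : ℕ} (hp : 1 ≤ p) (k i : ℕ)
    (hΛ : ∀ n ≤ p, ∀ j ≤ 2 * n, (j ≤ 1 ∨ 2 * n ≤ j + 1) → Λ n j = 0) :
    locCoef e Λ p k i = ∑ ν ∈ Finset.range (p - 1), ((ν + 2 + k).choose (ν + 2) : ℂ) *
      ∑ μ ∈ Finset.range (2 * ν + 1), e (ν + 2 + k) (μ + 2 + i) * Λ (ν + 2) (μ + 2) := by
  have h0 : ∀ n ≤ p, n ≤ 1 → ∑ j ∈ Finset.range (2 * n + 1), e (n + k) (j + i) * Λ n j = 0 := by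
    intro n hn hn1
    refine Finset.sum_eq_zero fun j hj => ?_
    simp only [Finset.mem_range] at hj
    rw [hΛ n hn j (by omega) (by omega), mul_zero]
  rw [locCoef, show p + 1 = p - 1 + 1 + 1 by omega, Finset.sum_range_succ', Finset.sum_range_succ',
    h0 0 (by omega) (by omega), h0 (0 + 1) (by omega) (by omega), mul_zero, mul_zero, add_zero,
    add_zero]
  refine Finset.sum_congr rfl fun ν hν => ?_
  simp only [Finset.mem_range] at hν
  rw [show ν + 1 + 1 = ν + 2 from rfl]
  congr 1
  rw [show 2 * (ν + 2) + 1 = 2 * ν + 1 + 1 + 1 + 1 + 1 by omega, Finset.sum_range_succ',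
    Finset.sum_range_succ', Finset.sum_range_succ, Finset.sum_range_succ,
    hΛ (ν + 2) (by omega) (2 * ν + 1 + 1 + 1 + 1) (by omega) (by omega),
    hΛ (ν + 2) (by omega) (2 * ν + 1 + 1 + 1) (by omega) (by omega),
    hΛ (ν + 2) (by omega) (0 + 1) (by omega) (by omega), hΛ (ν + 2) (by omega) 0 (by omega)
    (by omega)]
  simp

/-- Since `ν ≤ p - 2` and `k ≤ p`, `4p` nodes suffice for all terms at once; the sums over `μ`, `ν`
and `l` can then be nested. -/
lemma locCoef_eq_transl {b : Space} (hb : 0 < b 2) {Λ : ℕ → ℕ → ℂ} {p : ℕ} (hp : 1 ≤ p) {k i : ℕ}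
    (hk : k ≤ p) (hi : i ≤ 2 * k)
    (hΛ : ∀ n ≤ p, ∀ j ≤ 2 * n, (j ≤ 1 ∨ 2 * n ≤ j + 1) → Λ n j = 0) :
    locCoef (flipCoef b) Λ p k i = ∑ l ∈ Finset.range (4 * p), transl₃ b (4 * p) k i l *
      ∑ ν ∈ Finset.range (p - 1), transl₂ b (4 * p) ν k l *
        ∑ μ ∈ Finset.range (2 * ν + 1), transl₁ b (4 * p) ν μ l * Λ (ν + 2) (μ + 2) := by
  rw [locCoef_eq_sum_shift _ _ hp k i hΛ]
  simp only [Finset.mul_sum]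
  rw [Finset.sum_comm]
  refine Finset.sum_congr rfl fun ν hν => ?_
  rw [Finset.sum_comm]
  refine Finset.sum_congr rfl fun μ hμ => ?_
  simp only [Finset.mem_range] at hν hμ
  rw [← mul_assoc, choose_mul_flipCoef hb (q := 4 * p) (by omega) (by omega) hi, Finset.sum_mul]
  exact Finset.sum_congr rfl fun l _ => by ring

lemma locCoef_sub (e Λ Λ' : ℕ → ℕ → ℂ) (p k i : ℕ) :
    locCoef e (fun n j => Λ n j - Λ' n j) p k i = locCoef e Λ p k i - locCoef e Λ' p k i := by
  simp only [locCoef, mul_sub, Finset.sum_sub_distrib]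

lemma locCoef_congr {e Λ Λ' : ℕ → ℕ → ℂ} {p : ℕ} (h : ∀ n ≤ p, ∀ j ≤ 2 * n, Λ n j = Λ' n j)
    (k i : ℕ) : locCoef e Λ p k i = locCoef e Λ' p k i := by
  unfold locCoef
  refine Finset.sum_congr rfl fun n hn => ?_
  congr 1
  refine Finset.sum_congr rfl fun j hj => ?_
  simp only [Finset.mem_range] at hn hj
  rw [h n (by omega) j (by omega)]

/-! ### The local expansion of the rings -/

/-- The coefficient of a density in the local expansion of a ring. -/
def ringTransl (e d : ℕ → ℕ → ℂ) (p k i : ℕ) (m : ℤ) : ℂ :=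
  ∑ n ∈ Finset.range (p + 1), ∑ j ∈ Finset.range (2 * n + 1),
    if (n : ℤ) - j = m then ((n + k).choose n : ℂ) * e (n + k) (j + i) * d n j else 0

/-- Moments with the same order share one density coefficient. Collecting them leaves `2p + 1` terms
per output, with constants that do not depend on the data. -/
lemma locCoef_density (e d : ℕ → ℕ → ℂ) (s : ℤ → ℂ) (p k i : ℕ) :
    locCoef e (fun n j => d n j * s (n - j)) p k i =
      ∑ m ∈ Finset.Icc (-(p : ℤ)) p, ringTransl e d p k i m * s m := by
  simp only [ringTransl, Finset.sum_mul, locCoef, Finset.mul_sum]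
  rw [Finset.sum_comm]
  refine Finset.sum_congr rfl fun n hn => ?_
  rw [Finset.sum_comm]
  refine Finset.sum_congr rfl fun j hj => ?_
  simp only [Finset.mem_range] at hn hj
  simp only [ite_mul, zero_mul]
  rw [Finset.sum_ite_eq, if_pos (by rw [Finset.mem_Icc]; omega)]
  ring

lemma locCoef_add (e Λ Λ' : ℕ → ℕ → ℂ) (p k i : ℕ) :
    locCoef e (fun n j => Λ n j + Λ' n j) p k i = locCoef e Λ p k i + locCoef e Λ' p k i := by
  simp only [locCoef, mul_add, Finset.sum_add_distrib]

/-! ### The stages of the program -/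

variable {p : ℕ}

/-- The multipole coefficient of degree `n` and order `m` as a function of the input. -/
def input (p n : ℕ) (m : ℤ) (x : modes p → ℂ) : ℂ :=
  if h : (n, m) ∈ modes p then x ⟨(n, m), h⟩ else 0

lemma cost_input (n : ℕ) (m : ℤ) :
    Cost 1 (Set.range fun k : modes p => fun x : modes p → ℂ => x k) {input p n m} := by
  by_cases h : (n, m) ∈ modes p
  · have e : input p n m = fun x => x ⟨(n, m), h⟩ := by funext x; simp [input, h]
    rw [e]
    exact (cost_of_mem (Set.mem_range_self (⟨(n, m), h⟩ : modes p))).mono (by norm_num)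
  · have e : input p n m = fun _ => 0 := by funext x; simp [input, h]
    rw [e]
    exact cost_const 0

/-- The densities of the rings, `ε = 1` for the first and `ε = -1` for the second ring. -/
def density (R θ₁ : ℝ) (p : ℕ) (ε : ℂ) (m : ℤ) (x : modes p → ℂ) : ℂ :=
  (2 * (momentCoef m.natAbs m * ringCoef R θ₁ m.natAbs m))⁻¹ * input p m.natAbs m x +
    (ε * (2 * (momentCoef (m.natAbs + 1) m * ringCoef R θ₁ (m.natAbs + 1) m))⁻¹) *
      input p (m.natAbs + 1) m x

lemma cost_density (R θ₁ : ℝ) (ε : ℂ) (m : ℤ) :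
    Cost 7 (Set.range fun k : modes p => fun x : modes p → ℂ => x k) {density R θ₁ p ε m} :=
  ((cost_input _ _).const_mul _).add ((cost_input _ _).const_mul _)

/-- The moment of a ring with a density of modulus one. -/
def ringUnit (R θ₁ : ℝ) (n j : ℕ) : ℂ :=
  (-1) ^ n * harm n j (meridian R θ₁) * (2 * Real.pi * (R * Real.sin θ₁ : ℝ))

/-- The moments of the difference field. -/
def diffMoment (R θ₁ : ℝ) (p : ℕ) (k : ℕ × ℕ) (x : modes p → ℂ) : ℂ :=
  (momentCoef k.1 ((k.1 : ℤ) - k.2))⁻¹ * input p k.1 ((k.1 : ℤ) - k.2) x +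
    ((-ringUnit R θ₁ k.1 k.2) * density R θ₁ p 1 ((k.1 : ℤ) - k.2) x +
      (-ringUnit R θ₁ k.1 k.2 * (-1) ^ k.2) * density R θ₁ p (-1) ((k.1 : ℤ) - k.2) x)

/-- The first stage of the translation. -/
def stage₁ (b : Space) (R θ₁ : ℝ) (p : ℕ) (k : ℕ × ℕ) (x : modes p → ℂ) : ℂ :=
  ∑ μ ∈ Finset.range (2 * k.1 + 1), transl₁ b (4 * p) k.1 μ k.2 *
    diffMoment R θ₁ p (k.1 + 2, μ + 2) x

/-- The second stage of the translation. -/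
def stage₂ (b : Space) (R θ₁ : ℝ) (p : ℕ) (k : ℕ × ℕ) (x : modes p → ℂ) : ℂ :=
  ∑ ν ∈ Finset.range (p - 1), transl₂ b (4 * p) ν k.1 k.2 * stage₁ b R θ₁ p (ν, k.2) x

/-- The coefficients of the local expansion of the difference field. -/
def outDiff (b : Space) (R θ₁ : ℝ) (p : ℕ) (k : modes p) (x : modes p → ℂ) : ℂ :=
  ∑ l ∈ Finset.range (4 * p), ((solCoef k.1.1 k.1.2)⁻¹ *
    transl₃ b (4 * p) k.1.1 (k.1.1 + k.1.2).toNat l) * stage₂ b R θ₁ p (k.1.1, l) x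

/-- The coefficients of the local expansion of the rings. -/
def outRing (b : Space) (R θ₁ : ℝ) (p : ℕ) (k : modes p) (x : modes p → ℂ) : ℂ :=
  (∑ m ∈ Finset.Icc (-(p : ℤ)) p, ((solCoef k.1.1 k.1.2)⁻¹ * ringTransl (flipCoef b)
    (ringUnit R θ₁) p k.1.1 (k.1.1 + k.1.2).toNat m) * density R θ₁ p 1 m x) +
  ∑ m ∈ Finset.Icc (-(p : ℤ)) p, ((solCoef k.1.1 k.1.2)⁻¹ * ringTransl (flipCoef b)
    (fun n j => ringUnit R θ₁ n j * (-1) ^ j) p k.1.1 (k.1.1 + k.1.2).toNat m) *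
      density R θ₁ p (-1) m x

/-- The output of the program. -/
def output (b : Space) (R θ₁ : ℝ) (p : ℕ) : Part × modes p → (modes p → ℂ) → ℂ
  | (.difference, k) => outDiff b R θ₁ p k
  | (.ring, k) => outRing b R θ₁ p k
  | (.total, k) => fun x => outDiff b R θ₁ p k x + outRing b R θ₁ p k x

lemma cost_densities (R θ₁ : ℝ) (ε : ℂ) (hp : 1 ≤ p) :
    Cost (21 * p) (Set.range fun k : modes p => fun x : modes p → ℂ => x k)
      (density R θ₁ p ε '' (Finset.Icc (-(p : ℤ)) p : Finset ℤ)) := by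
  refine (Cost.family (Finset.Icc (-(p : ℤ)) p) (density R θ₁ p ε) fun m _ =>
    cost_density R θ₁ ε m).mono ?_
  rw [Int.card_Icc]
  omega

lemma cost_outDiff (b : Space) (R θ₁ : ℝ) (hp : 1 ≤ p) :
    Cost (300 * p ^ 3) ((Set.range fun k : modes p => fun x : modes p → ℂ => x k) ∪
      (density R θ₁ p 1 '' (Finset.Icc (-(p : ℤ)) p : Finset ℤ) ∪
        density R θ₁ p (-1) '' (Finset.Icc (-(p : ℤ)) p : Finset ℤ)))
      (Set.range (outDiff b R θ₁ p)) := by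
  -- The restriction `j ≤ 2n` ensures `|n - j| ≤ p`, so the densities of this order are available.
  set s₀ : Finset (ℕ × ℕ) := (Finset.range (p + 1) ×ˢ Finset.range (2 * p + 1)).filter
    (fun k => k.2 ≤ 2 * k.1) with hs₀
  have h0 := Cost.family (n := 10) (𝓕 := (Set.range fun k : modes p => fun x : modes p → ℂ => x k) ∪
      (density R θ₁ p 1 '' (Finset.Icc (-(p : ℤ)) p : Finset ℤ) ∪
        density R θ₁ p (-1) '' (Finset.Icc (-(p : ℤ)) p : Finset ℤ))) s₀ (diffMoment R θ₁ p)
    fun k hk => by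
      have hm : (k.1 : ℤ) - k.2 ∈ Finset.Icc (-(p : ℤ)) p := by
        simp only [hs₀, Finset.mem_filter, Finset.mem_product, Finset.mem_range] at hk
        rw [Finset.mem_Icc]; omega
      refine ((((cost_input _ _).subset Set.subset_union_left le_rfl).const_mul _).add
        (((cost_of_mem (.inr (.inl ⟨_, hm, rfl⟩))).const_mul _).add
          ((cost_of_mem (.inr (.inr ⟨_, hm, rfl⟩))).const_mul _))).mono (by norm_num)
  have h1 := Cost.family (n := 6 * p + 1) (𝓕 := diffMoment R θ₁ p '' s₀)
    (Finset.range (p - 1) ×ˢ Finset.range (4 * p)) (stage₁ b R θ₁ p) fun k hk => by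
      simp only [Finset.mem_product, Finset.mem_range] at hk
      have hmem : ∀ μ ∈ Finset.range (2 * k.1 + 1),
          diffMoment R θ₁ p (k.1 + 2, μ + 2) ∈ diffMoment R θ₁ p '' s₀ := fun μ hμ => by
        refine Set.mem_image_of_mem _ ?_
        simp only [Finset.mem_range] at hμ
        simp only [hs₀, Finset.coe_filter, Set.mem_ofPred_eq, Finset.mem_product, Finset.mem_range]
        omega
      refine (cost_linear _ _ _ hmem).mono ?_
      · rw [Finset.card_range]; omega
  have h2 := Cost.family (n := 3 * p + 1)
    (𝓕 := stage₁ b R θ₁ p '' (Finset.range (p - 1) ×ˢ Finset.range (4 * p) : Finset (ℕ × ℕ)))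
    (Finset.range (p + 1) ×ˢ Finset.range (4 * p)) (stage₂ b R θ₁ p) fun k hk => by
      simp only [Finset.mem_product, Finset.mem_range] at hk
      have hmem : ∀ ν ∈ Finset.range (p - 1), stage₁ b R θ₁ p (ν, k.2) ∈ stage₁ b R θ₁ p ''
          (Finset.range (p - 1) ×ˢ Finset.range (4 * p) : Finset (ℕ × ℕ)) := fun ν hν => by
        refine Set.mem_image_of_mem _ ?_
        simp only [Finset.mem_range] at hν
        simp only [Finset.coe_product, Finset.coe_range, Set.mem_prod, Set.mem_Iio]
        omega
      refine (cost_linear _ _ _ hmem).mono ?_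
      · rw [Finset.card_range]; omega
  have h3 := Cost.family (n := 12 * p + 1)
    (𝓕 := stage₂ b R θ₁ p '' (Finset.range (p + 1) ×ˢ Finset.range (4 * p) : Finset (ℕ × ℕ)))
    (Finset.univ : Finset (modes p)) (outDiff b R θ₁ p) fun k _ => by
      have hk := (mem_modes.1 k.2).1
      have hmem : ∀ l ∈ Finset.range (4 * p), stage₂ b R θ₁ p (k.1.1, l) ∈ stage₂ b R θ₁ p ''
          (Finset.range (p + 1) ×ˢ Finset.range (4 * p) : Finset (ℕ × ℕ)) := fun l hl => by
        refine Set.mem_image_of_mem _ ?_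
        simp only [Finset.coe_product, Finset.coe_range, Set.mem_prod, Set.mem_Iio]
        exact ⟨Nat.lt_succ_of_le hk, Finset.mem_range.1 hl⟩
      refine (cost_linear _ _ _ hmem).mono ?_
      · rw [Finset.card_range]; omega
  refine ((h0.comp (h1.comp (h2.comp h3))).mono ?_).subset le_rfl (by simp)
  have c0 : s₀.card ≤ 6 * p ^ 2 := by
    refine (Finset.card_filter_le _ _).trans ?_
    rw [Finset.card_product, Finset.card_range, Finset.card_range]
    nlinarith
  have c3 : (modes p).card ≤ 6 * p ^ 2 := (card_modes_le p).trans (by nlinarith)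
  simp only [Finset.card_product, Finset.card_range, Finset.card_univ, Fintype.card_coe]
  calc s₀.card * 10 + ((p - 1) * (4 * p) * (6 * p + 1) + ((p + 1) * (4 * p) * (3 * p + 1) +
        (modes p).card * (12 * p + 1)))
      ≤ 6 * p ^ 2 * (10 * p) + (p * (4 * p) * (6 * p + p) + ((p + p) * (4 * p) * (3 * p + p) +
        6 * p ^ 2 * (12 * p + p))) := by gcongr <;> omega
    _ = 198 * p ^ 3 := by ring
    _ ≤ _ := by gcongr; norm_num

lemma cost_outRing (b : Space) (R θ₁ : ℝ) (hp : 1 ≤ p) :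
    Cost (150 * p ^ 3) (density R θ₁ p 1 '' (Finset.Icc (-(p : ℤ)) p : Finset ℤ) ∪
        density R θ₁ p (-1) '' (Finset.Icc (-(p : ℤ)) p : Finset ℤ))
      (Set.range (outRing b R θ₁ p)) := by
  have h := Cost.family (n := 25 * p)
    (𝓕 := density R θ₁ p 1 '' (Finset.Icc (-(p : ℤ)) p : Finset ℤ) ∪
        density R θ₁ p (-1) '' (Finset.Icc (-(p : ℤ)) p : Finset ℤ))
    (Finset.univ : Finset (modes p)) (outRing b R θ₁ p) fun k _ => by
      refine ((cost_linear (Finset.Icc (-(p : ℤ)) p) _ (density R θ₁ p 1) fun m hm =>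
        .inl ⟨_, hm, rfl⟩).add (cost_linear (Finset.Icc (-(p : ℤ)) p) _ (density R θ₁ p (-1))
          fun m hm => .inr ⟨_, hm, rfl⟩)).mono ?_
      rw [Int.card_Icc]
      omega
  refine (h.mono ?_).subset le_rfl (by simp)
  have c3 : (modes p).card ≤ 6 * p ^ 2 := (card_modes_le p).trans (by nlinarith)
  simp only [Finset.card_univ, Fintype.card_coe]
  calc (modes p).card * (25 * p) ≤ 6 * p ^ 2 * (25 * p) := by gcongr
    _ = _ := by ring

lemma exists_program_output (b : Space) (R θ₁ : ℝ) (hp : 1 ≤ p) :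
    ∃ A : Program (modes p) (Part × modes p), A.cost ≤ 498 * p ^ 3 ∧
      ∀ x k, A.run x k = output b R θ₁ p k x := by
  have h1 := (cost_densities R θ₁ 1 hp).trans ((cost_densities R θ₁ (-1) hp).subset
    Set.subset_union_left le_rfl)
  have h2 := h1.trans ((cost_outDiff b R θ₁ hp).trans
    ((cost_outRing b R θ₁ hp).subset (Set.subset_union_right.trans Set.subset_union_left) le_rfl))
  have h3 := h2.trans (Cost.family (Finset.univ : Finset (modes p))
    (fun k x => outDiff b R θ₁ p k x + outRing b R θ₁ p k x) fun k _ =>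
      cost_add (.inr (.inr (.inl ⟨k, rfl⟩))) (.inr (.inr (.inr ⟨k, rfl⟩))))
  obtain ⟨A, hA, hrun⟩ := Cost.exists_program (output b R θ₁ p) (h3.subset le_rfl (by
    rintro _ ⟨⟨_ | _ | _, k⟩, rfl⟩
    · exact .inl (.inr (.inl ⟨k, rfl⟩))
    · exact .inl (.inr (.inr ⟨k, rfl⟩))
    · exact .inr ⟨k, by simp, rfl⟩))
  refine ⟨A, hA.trans ?_, hrun⟩
  have c3 : (modes p).card ≤ 6 * p ^ 2 := (card_modes_le p).trans (by nlinarith)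
  simp only [Finset.card_univ, Fintype.card_coe]
  -- The constant is `498 = 21 + 21 + 300 + 150 + 6`: two families of densities, difference, rings,
  -- and the final additions.
  have c1 : p ≤ p ^ 3 := Nat.le_self_pow (by norm_num) p
  have c2 : p ^ 2 ≤ p ^ 3 := Nat.pow_le_pow_right hp (by norm_num)
  omega

end HalfSpace

end

/-! ### Correctness of the program on multipole data -/

noncomputable section

namespace HalfSpace

open Polynomial Complex StraightLine

variable {S T : Space} {R θ₁ : ℝ} {p N : ℕ} {F Q : Fin N → Space} {s₁ s₂ : ℤ → ℂ}

lemma input_multipoleCoeff {n : ℕ} {m : ℤ} (hm : |m| ≤ n) :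
    input p n m (fun k => multipoleCoeff S F Q k.1.1 k.1.2) =
      if n ≤ p then multipoleCoeff S F Q n m else 0 := by
  simp only [input, mem_modes, hm, and_true]
  split_ifs <;> rfl

/-- The equations determine the densities for `|m| ≤ p`, the only orders that enter the rings; hence
one program serves every admissible choice. Absent inputs read as `0` match the convention for `n >
p`. -/
lemma density_multipoleCoeff (hR : 0 < R) (hs : 0 < Real.sin θ₁) (hc : 0 < Real.cos θ₁)
    (h : RingsCancel S R θ₁ p (multipoleCoeff S F Q) s₁ s₂) {m : ℤ} (hm : |m| ≤ p) :
    density R θ₁ p 1 m (fun k => multipoleCoeff S F Q k.1.1 k.1.2) = s₁ m ∧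
      density R θ₁ p (-1) m (fun k => multipoleCoeff S F Q k.1.1 k.1.2) = s₂ m := by
  obtain ⟨h1, h2⟩ := (ringsCancel_iff hR hs hc _ s₁ s₂).1 h m hm
  have hp : m.natAbs ≤ p := by have := abs_le.1 hm; omega
  simp only [density, input_multipoleCoeff (abs_le_natAbs m),
    input_multipoleCoeff (abs_le_natAbs_succ m), if_pos hp, mul_inv]
  rw [div_eq_mul_inv, mul_inv] at h1 h2
  constructor
  · linear_combination -(h1 + h2) / 2
  · linear_combination -(h1 - h2) / 2

lemma ringsMoment_eq_ringUnit {n j : ℕ} (hn : n ≤ p) (hj : j ≤ 2 * n) :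
    ringsMoment S R θ₁ p s₁ s₂ n j =
      ringUnit R θ₁ n j * (s₁ (n - j) + (-1) ^ j * s₂ (n - j)) := by
  rw [ringsMoment_eq _ _ _ _ _ _ hj, if_pos (by rw [abs_le]; omega), ringUnit]

lemma diffMoment_multipoleCoeff (hR : 0 < R) (hs : 0 < Real.sin θ₁) (hc : 0 < Real.cos θ₁)
    (h : RingsCancel S R θ₁ p (multipoleCoeff S F Q) s₁ s₂) {n j : ℕ} (hn : n ≤ p)
    (hj : j ≤ 2 * n) :
    diffMoment R θ₁ p (n, j) (fun k => multipoleCoeff S F Q k.1.1 k.1.2) =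
      dipole S F Q n j - ringsMoment S R θ₁ p s₁ s₂ n j := by
  have hm : |(n : ℤ) - j| ≤ n := by rw [abs_le]; omega
  obtain ⟨h1, h2⟩ := density_multipoleCoeff hR hs hc h (m := (n : ℤ) - j) (hm.trans (by omega))
  simp only [diffMoment]
  rw [h1, h2, input_multipoleCoeff hm, if_pos hn, multipoleCoeff_eq S F Q hm, idx_sub,
    inv_mul_cancel_left₀ (momentCoef_ne_zero _ _), ringsMoment_eq_ringUnit hn hj]
  ring

/-- With `m = n - j`, the extremal indices are exactly those with `n = |m|` or `n = |m| + 1`. -/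
lemma dipole_sub_ringsMoment_eq_zero
    (h : RingsCancel S R θ₁ p (multipoleCoeff S F Q) s₁ s₂) {n j : ℕ} (hn : n ≤ p)
    (hj : j ≤ 2 * n) (hnj : j ≤ 1 ∨ 2 * n ≤ j + 1) :
    dipole S F Q n j - ringsMoment S R θ₁ p s₁ s₂ n j = 0 := by
  have hm : |(n : ℤ) - j| ≤ n := by rw [abs_le]; omega
  have h1 := h ((n : ℤ) - j) (hm.trans (by omega)) n (by omega)
  rw [if_pos hn, multipoleCoeff_eq S F Q hm, ringCoeff_eq S R θ₁ p s₁ s₂ hm, idx_sub] at h1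
  rw [mul_left_cancel₀ (momentCoef_ne_zero _ _) h1, sub_self]

lemma outDiff_multipoleCoeff {b : Space} (hb : 0 < b 2) (hp : 1 ≤ p) (hR : 0 < R)
    (hs : 0 < Real.sin θ₁) (hc : 0 < Real.cos θ₁)
    (h : RingsCancel S R θ₁ p (multipoleCoeff S F Q) s₁ s₂) (k : modes p) :
    outDiff b R θ₁ p k (fun k => multipoleCoeff S F Q k.1.1 k.1.2) = (solCoef k.1.1 k.1.2)⁻¹ *
      (locCoef (flipCoef b) (dipole S F Q) p k.1.1 (k.1.1 + k.1.2).toNat -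
        locCoef (flipCoef b) (ringsMoment S R θ₁ p s₁ s₂) p k.1.1 (k.1.1 + k.1.2).toNat) := by
  obtain ⟨⟨n, m⟩, hk⟩ := k
  obtain ⟨hn, hm⟩ := mem_modes.1 hk
  have hi : ((n : ℤ) + m).toNat ≤ 2 * n := by have := abs_le.1 hm; omega
  simp only
  rw [← locCoef_sub, locCoef_eq_transl hb hp hn hi fun n hn j hj hnj =>
    dipole_sub_ringsMoment_eq_zero h hn hj hnj, outDiff, Finset.mul_sum]
  refine Finset.sum_congr rfl fun l _ => ?_
  rw [mul_assoc]
  congr 2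
  simp only [stage₂, stage₁]
  refine Finset.sum_congr rfl fun ν hν => ?_
  congr 1
  refine Finset.sum_congr rfl fun μ hμ => ?_
  simp only [Finset.mem_range] at hν hμ
  rw [diffMoment_multipoleCoeff hR hs hc h (by omega) (by omega)]

lemma outRing_multipoleCoeff (b : Space) (hR : 0 < R)
    (hs : 0 < Real.sin θ₁) (hc : 0 < Real.cos θ₁)
    (h : RingsCancel S R θ₁ p (multipoleCoeff S F Q) s₁ s₂) (k : modes p) :
    outRing b R θ₁ p k (fun k => multipoleCoeff S F Q k.1.1 k.1.2) = (solCoef k.1.1 k.1.2)⁻¹ *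
      locCoef (flipCoef b) (ringsMoment S R θ₁ p s₁ s₂) p k.1.1 (k.1.1 + k.1.2).toNat := by
  have e : locCoef (flipCoef b) (ringsMoment S R θ₁ p s₁ s₂) p k.1.1 (k.1.1 + k.1.2).toNat =
      locCoef (flipCoef b) (fun n j => ringUnit R θ₁ n j * s₁ (n - j) +
        (ringUnit R θ₁ n j * (-1) ^ j) * s₂ (n - j)) p k.1.1 (k.1.1 + k.1.2).toNat :=
    locCoef_congr (fun n hn j hj => by rw [ringsMoment_eq_ringUnit hn hj]; ring) _ _
  rw [e, locCoef_add, locCoef_density, locCoef_density (flipCoef b)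
    (fun n j => ringUnit R θ₁ n j * (-1) ^ j), outRing, mul_add, Finset.mul_sum, Finset.mul_sum]
  congr 1
  all_goals
    refine Finset.sum_congr rfl fun m hm => ?_
    have h1 := density_multipoleCoeff hR hs hc h (abs_le.2 (Finset.mem_Icc.1 hm))
    first
      | rw [h1.1, mul_assoc]
      | rw [h1.2, mul_assoc]

lemma sum_modes (f : ℕ → ℤ → ℂ) : ∑ k : modes p, f k.1.1 k.1.2 =
    ∑ n ∈ Finset.range (p + 1), ∑ i ∈ Finset.range (2 * n + 1), f n (i - n) := by
  rw [Finset.sum_coe_sort (modes p) fun k => f k.1 k.2, Finset.sum_sigma']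
  refine Finset.sum_bij' (fun k _ => ⟨k.1, ((k.1 : ℤ) + k.2).toNat⟩)
    (fun k _ => (k.1, (k.2 : ℤ) - k.1)) ?_ ?_ ?_ ?_ ?_
  · rintro ⟨n, m⟩ hk
    obtain ⟨hn, hm⟩ := mem_modes.1 hk
    have := abs_le.1 hm
    simp only [Finset.mem_sigma, Finset.mem_range]
    omega
  · rintro ⟨n, i⟩ hk
    simp only [Finset.mem_sigma, Finset.mem_range] at hk
    rw [mem_modes, abs_le]
    dsimp only
    omega
  · rintro ⟨n, m⟩ hk
    obtain ⟨hn, hm⟩ := mem_modes.1 hk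
    have := abs_le.1 hm
    simp only [Prod.mk.injEq, true_and]
    omega
  · rintro ⟨n, i⟩ hk
    simp
  · rintro ⟨n, m⟩ hk
    obtain ⟨hn, hm⟩ := mem_modes.1 hk
    have := abs_le.1 hm
    simp only
    congr 1
    omega

lemma localExpansion_eq (c x : Space) (l : ℕ → ℕ → ℂ) :
    localExpansion (p := p) c
      (fun k => (solCoef k.1.1 k.1.2)⁻¹ * l k.1.1 (k.1.1 + k.1.2).toNat) x =
      ∑ n ∈ Finset.range (p + 1), ∑ i ∈ Finset.range (2 * n + 1), l n i * harm n i (x - c) := by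
  rw [localExpansion, sum_modes (p := p) fun n m =>
    (solCoef n m)⁻¹ * l n (n + m).toNat * solidY n m (x - c)]
  refine Finset.sum_congr rfl fun n _ => Finset.sum_congr rfl fun i hi => ?_
  simp only [Finset.mem_range] at hi
  have hm : |(i : ℤ) - n| ≤ n := by rw [abs_le]; omega
  have hi' : ((n : ℤ) + (i - n)).toNat = i := by omega
  rw [solidY_eq hm, hi']
  have := solCoef_ne_zero n (i - n)
  field_simp

lemma localExpansion_add (c x : Space) (L L' : modes p → ℂ) :
    localExpansion c (fun k => L k + L' k) x = localExpansion c L x + localExpansion c L' x := by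
  simp only [localExpansion, add_mul, Finset.sum_add_distrib]

end HalfSpace

end

theorem lemma3p10 :
    ∃ K : ℕ,
      -- source box (centre `S`), target box (centre `T`), both of side `D`, and two rings
      ∀ (D : ℝ) (S T : HalfSpace.Space) (R θ₁ : ℝ), 0 < D → D / 2 ≤ S 2 → T 2 + D / 2 ≤ 0 →
      Real.sqrt 3 / 2 * D ≤ R → R + Real.sqrt 3 / 2 * D < dist S T →
      0 < θ₁ → θ₁ < Real.pi / 2 →
      D / Real.sqrt 2 < (dist S T - Real.sqrt 3 / 2 * D) * Real.sin θ₁ →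
      ∃ C ρ : ℝ, 0 < ρ ∧ ρ < 1 ∧ ∀ p : ℕ, 1 ≤ p →
        -- from the multipole coefficients of order `p` to the local expansions of order `p`
        ∃ A : StraightLine.Program (HalfSpace.modes p) (HalfSpace.Part × HalfSpace.modes p),
          A.cost ≤ K * p ^ 3 ∧
          ∀ N : ℕ, 1 ≤ N →
            -- from the sources to the multipole coefficients of order `p`
            ∃ A₀ : StraightLine.Program ((Fin N × Fin 3) ⊕ (Fin N × Fin 3)) (HalfSpace.modes p),
              A₀.cost ≤ K * N * p ^ 2 ∧
              ∀ F Q : Fin N → HalfSpace.Space, (∀ i, Q i ∈ HalfSpace.box S D) →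
                (∀ k, A₀.run (HalfSpace.sourceData F Q) k =
                  HalfSpace.multipoleCoeff S F Q k.1.1 k.1.2) ∧
                (∃ s₁ s₂ : ℤ → ℂ,
                  HalfSpace.RingsCancel S R θ₁ p (HalfSpace.multipoleCoeff S F Q) s₁ s₂) ∧
                ∀ s₁ s₂ : ℤ → ℂ,
                  HalfSpace.RingsCancel S R θ₁ p (HalfSpace.multipoleCoeff S F Q) s₁ s₂ →
                  ∀ L : HalfSpace.Part × HalfSpace.modes p → ℂ,
                  L = A.run (A₀.run (HalfSpace.sourceData F Q)) →
                  (∀ k, L (.total, k) = L (.difference, k) + L (.ring, k)) ∧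
                  ∀ x ∈ HalfSpace.box T D,
                    ‖((HalfSpace.PhiB F Q x : ℂ) - HalfSpace.ringField S R θ₁ p s₁ s₂ x)
                        - HalfSpace.localExpansion T (fun k => L (.difference, k)) x‖
                      ≤ C * (∑ i, ‖F i‖) * ρ ^ p ∧
                    ‖HalfSpace.ringField S R θ₁ p s₁ s₂ x
                        - HalfSpace.localExpansion T (fun k => L (.ring, k)) x‖
                      ≤ C * (∑ i, ‖F i‖) * ρ ^ p ∧
                    ‖(HalfSpace.PhiB F Q x : ℂ)
                        - HalfSpace.localExpansion T (fun k => L (.total, k)) x‖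
                      ≤ C * (∑ i, ‖F i‖) * ρ ^ p := by
  -- The constant of the local expansions dominates the 168 of the multipole coefficients.
  refine ⟨498, fun D S T R θ₁ hD hS hT hDR hRST hθ0 hθ1 hθ => ?_⟩
  have hs : 0 < Real.sin θ₁ := Real.sin_pos_of_pos_of_lt_pi hθ0 (by linarith [Real.pi_pos])
  have hc : 0 < Real.cos θ₁ := Real.cos_pos_of_mem_Ioo ⟨by linarith, hθ1⟩
  have hR : 0 < R := lt_of_lt_of_le (by positivity) hDR
  have hb : 0 < HalfSpace.okada T S 2 := by simp [HalfSpace.okada]; linarith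
  obtain ⟨C, ρ, hρ0, hρ1, hbound⟩ :=
    HalfSpace.exists_localExpansion_bound hD hS hT hDR hRST hs hc hθ
  -- The error for the difference is bounded by the sum of the errors for the field and for the
  -- rings.
  refine ⟨2 * C, ρ, hρ0, hρ1, fun p hp => ?_⟩
  obtain ⟨A, hA, hArun⟩ := HalfSpace.exists_program_output (HalfSpace.okada T S) R θ₁ hp
  refine ⟨A, hA, fun N hN => ?_⟩
  obtain ⟨A₀, hA₀, hA₀run⟩ := HalfSpace.exists_program_multipoleCoeff S hp hN
  refine ⟨A₀, hA₀.trans (by gcongr; norm_num), fun F Q hQ => ⟨hA₀run F Q,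
    HalfSpace.exists_ringsCancel hR hs hc _, fun s₁ s₂ hrc L hL => ?_⟩⟩
  have hM : A₀.run (HalfSpace.sourceData F Q) =
      fun k => HalfSpace.multipoleCoeff S F Q k.1.1 k.1.2 := funext (hA₀run F Q)
  set e := HalfSpace.flipCoef (HalfSpace.okada T S)
  set lF := HalfSpace.locCoef e (HalfSpace.dipole S F Q) p with hlF
  set lR := HalfSpace.locCoef e (HalfSpace.ringsMoment S R θ₁ p s₁ s₂) p with hlR
  have hring : (fun k => L (.ring, k)) = fun k : HalfSpace.modes p =>
      (HalfSpace.solCoef k.1.1 k.1.2)⁻¹ * lR k.1.1 (k.1.1 + k.1.2).toNat := by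
    funext k
    rw [hL, hM, hArun]
    exact HalfSpace.outRing_multipoleCoeff _ hR hs hc hrc k
  have hdiff : (fun k => L (.difference, k)) = fun k : HalfSpace.modes p =>
      (HalfSpace.solCoef k.1.1 k.1.2)⁻¹ * (fun n i => lF n i - lR n i) k.1.1
        (k.1.1 + k.1.2).toNat := by
    funext k
    rw [hL, hM, hArun]
    exact HalfSpace.outDiff_multipoleCoeff hb hp hR hs hc hrc k
  have htotal : ∀ k, L (.total, k) = L (.difference, k) + L (.ring, k) := by
    intro k
    rw [hL, hArun, hArun, hArun]
    rfl
  refine ⟨htotal, fun x hx => ?_⟩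
  obtain ⟨h1, h2⟩ := hbound F Q p s₁ s₂ hQ hrc x hx
  have e2 := HalfSpace.localExpansion_eq (p := p) T x lR
  have e1 := HalfSpace.localExpansion_eq (p := p) T x fun n i => lF n i - lR n i
  rw [← hring] at e2
  rw [← hdiff] at e1
  simp only [sub_mul, Finset.sum_sub_distrib] at e1
  rw [← hlF] at h1
  rw [← hlR, ← e2] at h2
  rw [← e2] at e1
  have e3 : HalfSpace.localExpansion T (fun k => L (.total, k)) x =
      HalfSpace.localExpansion T (fun k => L (.difference, k)) x +
        HalfSpace.localExpansion T (fun k => L (.ring, k)) x := by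
    rw [← HalfSpace.localExpansion_add]
    simp only [htotal]
  -- The fast coefficients equal the dense ones exactly, so difference plus ring is the truncated
  -- expansion of `Φ_𝓑`, for which the bound is known.
  rw [← eq_sub_iff_add_eq.1 e1] at h1
  have h3 : 0 ≤ (C * ∑ i, ‖F i‖) * ρ ^ p := (norm_nonneg _).trans h1
  have h4 : (2 * C * ∑ i, ‖F i‖) * ρ ^ p = (C * ∑ i, ‖F i‖) * ρ ^ p + (C * ∑ i, ‖F i‖) * ρ ^ p := by
    ring
  rw [e3, h4]
  refine ⟨?_, h2.trans (le_add_of_nonneg_left h3), h1.trans (le_add_of_nonneg_left h3)⟩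
  refine le_trans (le_of_eq ?_) ((norm_sub_le _ _).trans (add_le_add h1 h2))
  congr 1
  ring
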